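/- Let $p\neq\ell$ be odd primes and $k\ge 1$ an integer such that $p$ is a primitive root modulo $2\ell^k$. Put $e=\varphi(\ell^k)=(\ell-1)\ell^{k-1}$, $q=p^e$, $N=\frac{q-1}{2\ell^k}$, $\zeta_p=e^{2\pi i/p}$, let $\operatorname{Tr}$ be the trace from $\mathbb F_q$ to $\mathbb F_p$, $\eta$ the quadratic character of $\mathbb F_p$ (with $\eta(0)=0$), and $p^*=(-1)^{(p-1)/2}p$. As $e$ is even, $\sqrt q=p^{e/2}$ and $\sqrt{p^*}^{\,e}=(p^*)^{e/2}$ are integers. For $f:\mathbb F_q\to\mathbb F_p$ let $\mathcal W_f(\lambda)=\sum_{x\in\mathbb F_q}\zeta_p^{f(x)-\operatorname{Tr}(\lambda x)}$. The function $f$ is weakly regular bent if $|\mathcal W_f(\lambda)|^2=q$ for all $\lambda$ and there are $f^*:\mathbb F_q\to\mathbb F_p$ (a dual of $f$) and $u\in\mathbb C$, $|u|=1$, with $\mathcal W_f(\lambda)=u\sqrt q\,\zeta_p^{f^*(\lambda)}$ for all $\lambda$. Let $f$ be weakly regular bent with $f(0)=0$ and $f(cx)=c^{k_f}f(x)$ for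 all $c\in\mathbb F_p^*$, $x\in\mathbb F_q$, where $k_f$ is a positive even integer with $\gcd(k_f-1,p-1)=1$, and suppose that its dual satisfies $f^*(0)=0$ and $f^*(cx)=c^2f^*(x)$ for all $c\in\mathbb F_p^*$, $x\in\mathbb F_q$. Then there is a sign $\epsilon\in\{1,-1\}$, necessarily unique, with $\mathcal W_f(\lambda)=\epsilon\sqrt{p^*}^{\,e}\zeta_p^{f^*(\lambda)}$ for all $\lambda$, and the following holds. Let $$D'=\{(x,y)\in\mathbb F_q^2\setminus\{(0,0)\}: f(x)+\operatorname{Tr}(y^N)=0\},\qquad \mathcal C=\{(\operatorname{Tr}(\gamma x+\delta y))_{(x,y)\in D'}:\gamma,\delta\in\mathbb F_q\}.$$ Write $E=\epsilon\sqrt{p^*}^{\,e}$, $B=\frac{q^2}{p^2}(p-1)$, $Z=p^{e-1}+(p-1)\frac Ep$, $Y=p^{e-1}-\frac Ep$, $t_1=\varphi(\ell^k)\bmod p$, $t_2=\ell^{k-1}\bmod p$, $T=\eta(t_1)+(\ell-1)\eta(t_2)$. The code $\mathcal C$ is linear over $\mathbb F_p$ of dimension $2e$. Its length is $\frac{q^2}{p}+E\left(\frac{q(p-1)}p-\frac{(\ell-1)(q-1)}{\ell^k}\right)-1$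 if $\ell\equiv1\pmod p$, and $\frac{q^2}{p}+E\left(\frac{q(p-1)}p-\frac{q-1}{\ell^{k-1}}\right)-1$ if $\ell\not\equiv1\pmod p$. Its weight distribution is given by the tables below, listed as (weight : frequency), to which the row $0:1$ is always to be added; rows of equal weight are added up and rows of frequency $0$ are void. (1) If $\ell\equiv1\pmod p$ and $p\equiv1\pmod4$, then $\mathcal C$ has exactly eight nonzero weights, with - $B$ : $Z-1$ - $B+E\left(\frac{q(p-1)^2}{p^2}+\frac{\sqrt q(p-1)}p-\frac{(\ell-1)(q+\sqrt q)(p-1)}{p\ell^k}\right)$ : $\frac{(q-1)(\ell-1)}{\ell^k}Z$ - $B+E\left(\frac{q(p-1)^2}{p^2}-\frac{(\ell-1)(q+\sqrt q)(p-1)}{p\ell^k}\right)$ : $\frac{(q-1)(\ell^k-\ell+1)}{\ell^k}Z$ - $B+E\left(\frac{q(p-1)}{p}-\frac{(\ell-1)(q-1)(p+1)}{p\ell^k}\right)$ : $\frac{p-1}2Y$ - $B+E\left(\frac{q(p-1)}{p}-\frac{(\ell-1)(q-1)(p-1)}{p\ell^k}\right)$ : $\frac{p-1}2Y$ - $B+E\left(\frac{q(p-1)^2}{p^2}-\frac{2\sqrt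 q}p-\frac{(\ell-1)(\sqrt q+1)(\sqrt q(p-1)-(p+1))}{p\ell^k}\right)$ : $\frac{(q-1)(\ell-1)(p-1)}{2\ell^k}Y$ - $B+E\left(\frac{q(p-1)^2}{p^2}-\frac{(\ell-1)(\sqrt q+1)(\sqrt q(p-1)-(p+1))}{p\ell^k}\right)$ : $\frac{(q-1)(\ell^k-\ell+1)(p-1)}{2\ell^k}Y$ - $B+E\left(\frac{q(p-1)^2}{p^2}-\frac{(\ell-1)(q-1)(p-1)}{p\ell^k}\right)$ : $\frac{(p-1)(q-1)}{2}Y$ (2) If $\ell\equiv1\pmod p$ and $p\equiv3\pmod4$, then $\mathcal C$ has exactly six nonzero weights, with - $B$ : $Z-1$ - $B+E\left(\frac{q(p-1)^2}{p^2}+\frac{\sqrt q(p-1)}p-\frac{(\ell-1)(q+\sqrt q)(p-1)}{p\ell^k}\right)$ : $\frac{(q-1)(\ell-1)}{\ell^k}Z$ - $B+E\left(\frac{q(p-1)^2}{p^2}-\frac{(\ell-1)(q+\sqrt q)(p-1)}{p\ell^k}\right)$ : $\frac{(q-1)(\ell^k-\ell+1)}{\ell^k}Z$ - $B+E\left(\frac{q(p-1)}{p}-\frac{(\ell-1)(q-1)}{\ell^k}\right)$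 : $(p-1)Y$ - $B+E\left(\frac{q(p-1)^2}{p^2}-\frac{2\sqrt q}p-\frac{(\ell-1)(\sqrt q+1)(\sqrt q(p-1)-p)}{p\ell^k}\right)$ : $\frac{(q-1)(\ell-1)(p-1)}{2\ell^k}Y$ - $B+E\left(\frac{q(p-1)^2}{p^2}-\frac{(\ell-1)(\sqrt q+1)(\sqrt q(p-1)-p)}{p\ell^k}\right)$ : $\frac{(q-1)(2\ell^k-\ell+1)(p-1)}{2\ell^k}Y$ (3a) If $\ell\not\equiv1\pmod p$, $p\equiv1\pmod4$ and $\eta(t_1)=\eta(t_2)$, then the table is - $B$ : $Z-1$ - $B+E\left(\frac{q(p-1)^2}{p^2}+\frac{\sqrt q(p-1)}p-\frac{(q+\sqrt q)(p-1)}{p\ell^{k-1}}\right)$ : $\frac{q-1}{\ell^{k-1}}Z$ - $B+E\left(\frac{q(p-1)^2}{p^2}-\frac{(q+\sqrt q)(p-1)}{p\ell^{k-1}}\right)$ : $\frac{(q-1)(\ell^{k-1}-1)}{\ell^{k-1}}Z$ - $B+E\left(\frac{q(p-1)}{p}-\frac{(q-1)(p\ell+T)}{p\ell^k}\right)$ :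 $\frac{p-1}2Y$ - $B+E\left(\frac{q(p-1)}{p}-\frac{(q-1)(p\ell-T)}{p\ell^k}\right)$ : $\frac{p-1}2Y$ - $B+E\left(\frac{q(p-1)^2}{p^2}-\frac{2\sqrt q}p-\frac{q-1}{\ell^{k-1}}+\frac{(\sqrt q+1)(\ell\sqrt q+\eta(t_1)T)}{p\ell^k}\right)$ : $\frac{(q-1)(p-1)}{2\ell^{k-1}}Y$ - $B+E\left(\frac{q(p-1)^2}{p^2}-\frac{q-1}{\ell^{k-1}}+\frac{(\sqrt q+1)(\ell\sqrt q-\eta(t_1)T)}{p\ell^k}\right)$ : $\frac{(p-1)(q-1)}{2}Y$ - $B+E\left(\frac{q(p-1)^2}{p^2}-\frac{q-1}{\ell^{k-1}}+\frac{(\sqrt q+1)(\ell\sqrt q+\eta(t_1)T)}{p\ell^k}\right)$ : $\frac{(p-1)(q-1)(\ell^{k-1}-1)}{2\ell^{k-1}}Y$ and, if $k\ge2$, $\mathcal C$ has exactly eight nonzero weights. (3b) If $\ell\not\equiv1\pmod p$, $p\equiv1\pmod4$ and $\eta(t_1)=-\eta(t_2)$, then the table consists of the first five rows of (3a) and - $B+E\left(\frac{q(p-1)^2}{p^2}-\frac{2\sqrt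 q}p-\frac{q-1}{\ell^{k-1}}+\frac{(\sqrt q+1)(\ell\sqrt q+\eta(t_1)T)}{p\ell^k}\right)$ : $\frac{(q-1)(p-1)}{2\ell^{k}}Y$ - $B+E\left(\frac{q(p-1)^2}{p^2}-\frac{q-1}{\ell^{k-1}}+\frac{(\sqrt q+1)(\ell\sqrt q+\eta(t_1)T)}{p\ell^k}\right)$ : $\frac{(q-1)(p-1)(\ell^{k}-1)}{2\ell^{k}}Y$ - $B+E\left(\frac{q(p-1)^2}{p^2}-\frac{2\sqrt q}p-\frac{q-1}{\ell^{k-1}}+\frac{(\sqrt q+1)(\ell\sqrt q-\eta(t_1)T)}{p\ell^k}\right)$ : $\frac{(q-1)(p-1)(\ell-1)}{2\ell^{k}}Y$ - $B+E\left(\frac{q(p-1)^2}{p^2}-\frac{q-1}{\ell^{k-1}}+\frac{(\sqrt q+1)(\ell\sqrt q-\eta(t_1)T)}{p\ell^k}\right)$ : $\frac{(q-1)(p-1)(\ell^{k}-\ell+1)}{2\ell^{k}}Y$ and, if $k\ge2$, $\mathcal C$ has exactly nine nonzero weights. (4) If $\ell\not\equiv1\pmod p$ and $p\equiv3\pmod4$,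 then the table is - $B$ : $Z-1$ - $B+E\left(\frac{q(p-1)^2}{p^2}+\frac{\sqrt q(p-1)}p-\frac{(q+\sqrt q)(p-1)}{p\ell^{k-1}}\right)$ : $\frac{q-1}{\ell^{k-1}}Z$ - $B+E\left(\frac{q(p-1)^2}{p^2}-\frac{(q+\sqrt q)(p-1)}{p\ell^{k-1}}\right)$ : $\frac{(q-1)(\ell^{k-1}-1)}{\ell^{k-1}}Z$ - $B+E\left(\frac{q(p-1)}{p}-\frac{q-1}{\ell^{k-1}}\right)$ : $(p-1)Y$ - $B+E\left(\frac{q(p-1)^2}{p^2}-\frac{2\sqrt q}p-\frac{(\sqrt q+1)(\sqrt q(p-1)-p)}{p\ell^{k-1}}\right)$ : $\frac{(q-1)(p-1)}{2\ell^{k-1}}Y$ - $B+E\left(\frac{q(p-1)^2}{p^2}-\frac{(\sqrt q+1)(\sqrt q(p-1)-p)}{p\ell^{k-1}}\right)$ : $\frac{(q-1)(p-1)(2\ell^{k-1}-1)}{2\ell^{k-1}}Y$ and, if $k\ge2$, $\mathcal C$ has exactly six nonzero weights. -/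

import Mathlib

namespace BentCode

section Bent

variable {p : ℕ} [Fact p.Prime] {F : Type*} [Field F] [Fintype F] [Algebra (ZMod p) F]

/-- The Walsh transform `W_f(a) = ∑ x, ζ_p ^ (f x - Tr (a x))`, with `ζ_p = exp (2πi/p)`
(`ZMod.stdAddChar j = exp (2πi j/p)`) and `Tr` the absolute trace of `F`. -/
noncomputable def walsh (f : F → ZMod p) (a : F) : ℂ :=
  ∑ x : F, ZMod.stdAddChar (f x - Algebra.trace (ZMod p) F (a * x))

/-- `f` is bent: `|W_f(a)|² = |F|` for all `a`. -/
def IsBent (f : F → ZMod p) : Prop :=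
  ∀ a : F, ‖walsh f a‖ ^ 2 = (Fintype.card F : ℝ)

/-- `fs` is a dual of `f`: `W_f(a) = u |F|^{1/2} ζ_p ^ (fs a)` for all `a`, where `u` is a complex
number of modulus one that does not depend on `a`. -/
def IsDual (f fs : F → ZMod p) : Prop :=
  ∃ u : ℂ, ‖u‖ = 1 ∧
    ∀ a : F, walsh f a = u * (Real.sqrt (Fintype.card F) : ℂ) * ZMod.stdAddChar (fs a)

/-- `f` is weakly regular bent. -/
def IsWeaklyRegularBent (f : F → ZMod p) : Prop :=
  IsBent f ∧ ∃ fs : F → ZMod p, IsDual f fs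

/-- The class `RF`: weakly regular bent functions with `f 0 = 0` and `f (c x) = c ^ kf * f x` for
`c ∈ 𝔽_p^*`, for some positive even `kf` with `gcd (kf - 1, p - 1) = 1`. -/
def MemRF (f : F → ZMod p) : Prop :=
  IsWeaklyRegularBent f ∧ f 0 = 0 ∧
    ∃ kf : ℕ, 0 < kf ∧ Even kf ∧ Nat.gcd (kf - 1) (p - 1) = 1 ∧
      ∀ c : ZMod p, c ≠ 0 → ∀ x : F, f (c • x) = c ^ kf * f x

open Classical in
/-- The defining set `{(x, y) ≠ (0, 0) : f x + Tr (y ^ N) = 0}`. -/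
noncomputable def definingSet (f : F → ZMod p) (N : ℕ) : Finset (F × F) :=
  Finset.univ.filter fun z => z ≠ 0 ∧ f z.1 + Algebra.trace (ZMod p) F (z.2 ^ N) = 0

variable (p) in
/-- The map sending `(γ, δ)` to the word `(Tr (γ x + δ y))`, indexed by `(x, y) ∈ D`. -/
noncomputable def codeword (D : Finset (F × F)) : (F × F) →ₗ[ZMod p] (D → ZMod p) where
  toFun g := fun z => Algebra.trace (ZMod p) F (g.1 * z.1.1 + g.2 * z.1.2)
  map_add' g h := by
    funext z
    simp only [Prod.fst_add, Prod.snd_add, Pi.add_apply, ← map_add]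
    congr 1
    ring
  map_smul' c g := by
    funext z
    simp only [Prod.smul_fst, Prod.smul_snd, smul_mul_assoc, ← smul_add, map_smul,
      RingHom.id_apply, Pi.smul_apply]

variable (p) in
/-- The linear code over `𝔽_p` with defining set `D`; its length is `D.card`. -/
noncomputable def code (D : Finset (F × F)) : Submodule (ZMod p) (D → ZMod p) :=
  LinearMap.range (codeword p D)

end Bent

section Weights

variable {p : ℕ} {ι : Type*} [Fintype ι]

/-- The number of codewords of `C` of Hamming weight `w` (`w` rational, so that the value of any
formula can be inserted). -/
noncomputable def weightCount (C : Submodule (ZMod p) (ι → ZMod p)) (w : ℚ) : ℕ :=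
  {c : ι → ZMod p | c ∈ C ∧ (hammingNorm c : ℚ) = w}.ncard

/-- `C` has the weight distribution given by a table of pairs (weight, frequency): the number of
codewords of weight `w` is the sum of the frequencies of the rows with weight `w`. -/
def HasWeightDistribution (C : Submodule (ZMod p) (ι → ZMod p)) (table : List (ℚ × ℚ)) : Prop :=
  ∀ w : ℚ, (weightCount C w : ℚ) =
    ((table.filter fun r => decide (r.1 = w)).map Prod.snd).sum

/-- The number of distinct nonzero weights; `C` is a `t`-weight code if this number is `t`. -/
noncomputable def numWeights (C : Submodule (ZMod p) (ι → ZMod p)) : ℕ :=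
  {w : ℕ | w ≠ 0 ∧ ∃ c ∈ C, hammingNorm c = w}.ncard

end Weights

/-- `p^* = (-1)^{(p-1)/2} p`. -/
def pStar (p : ℕ) : ℤ := (-1) ^ ((p - 1) / 2) * p

/-- `(√p^*)^e` for even `e`, an integer. -/
def sqrtPStarPow (p e : ℕ) : ℤ := pStar p ^ (e / 2)

/-- For even `e`, `sqrtPStarPow p e` is the `e`-th power of either square root of `p^*`. -/
theorem pow_eq_sqrtPStarPow (p e : ℕ) (he : Even e) (s : ℂ) (hs : s ^ 2 = (pStar p : ℂ)) :
    s ^ e = (sqrtPStarPow p e : ℂ) := by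
  obtain ⟨m, rfl⟩ := he.two_dvd
  rw [pow_mul, hs, sqrtPStarPow, Nat.mul_div_cancel_left m two_pos, Int.cast_pow]

section Tables

/-! In what follows `e` is even, `q = p ^ e`, `s = √q = p ^ (e / 2)`, `E = ε (√p^*)^e`,
`Z = p^{e-1} + ε (p-1) (√p^*)^e / p` and `Y = p^{e-1} - ε (√p^*)^e / p`. -/

/-- The length when `ℓ ≡ 1 (mod p)`. -/
def lengthOne (p ℓ k e : ℕ) (ε : ℤ) : ℚ :=
  let q : ℚ := (p : ℚ) ^ e
  let E : ℚ := (ε : ℚ) * sqrtPStarPow p e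
  q ^ 2 / p + E * (q * (p - 1) / p - (ℓ - 1) * (q - 1) / (ℓ : ℚ) ^ k) - 1

/-- The length when `ℓ ≢ 1 (mod p)`. -/
def lengthNotOne (p ℓ k e : ℕ) (ε : ℤ) : ℚ :=
  let q : ℚ := (p : ℚ) ^ e
  let E : ℚ := (ε : ℚ) * sqrtPStarPow p e
  q ^ 2 / p + E * (q * (p - 1) / p - (q - 1) / (ℓ : ℚ) ^ (k - 1)) - 1

/-- The table for `ℓ ≡ 1 (mod p)`, `p ≡ 1 (mod 4)`. -/
def tableOneOne (p ℓ k e : ℕ) (ε : ℤ) : List (ℚ × ℚ) :=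
  let q : ℚ := (p : ℚ) ^ e
  let s : ℚ := (p : ℚ) ^ (e / 2)
  let E : ℚ := (ε : ℚ) * sqrtPStarPow p e
  let Z : ℚ := (p : ℚ) ^ (e - 1) + (p - 1) * E / p
  let Y : ℚ := (p : ℚ) ^ (e - 1) - E / p
  let L : ℚ := (ℓ : ℚ) ^ k
  [(0, 1),
   (q ^ 2 / p ^ 2 * (p - 1), Z - 1),
   (q ^ 2 / p ^ 2 * (p - 1) + E * (q / p ^ 2 * (p - 1) ^ 2 + s * (p - 1) / p
      - (ℓ - 1) * (q + s) * (p - 1) / (p * L)),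
    (q - 1) * (ℓ - 1) / L * Z),
   (q ^ 2 / p ^ 2 * (p - 1) + E * (q / p ^ 2 * (p - 1) ^ 2
      - (ℓ - 1) * (q + s) * (p - 1) / (p * L)),
    (q - 1) * (L - ℓ + 1) / L * Z),
   (q ^ 2 / p ^ 2 * (p - 1) + E * (q / p * (p - 1) - (ℓ - 1) * (q - 1) / (p * L) * (p + 1)),
    (p - 1) / 2 * Y),
   (q ^ 2 / p ^ 2 * (p - 1) + E * (q / p * (p - 1) - (ℓ - 1) * (q - 1) / (p * L) * (p - 1)),
    (p - 1) / 2 * Y),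
   (q ^ 2 / p ^ 2 * (p - 1) + E * (q / p ^ 2 * (p - 1) ^ 2 - 2 * s / p
      - (ℓ - 1) * (s + 1) / (p * L) * (s * (p - 1) - (p + 1))),
    (q - 1) * (ℓ - 1) * (p - 1) / (2 * L) * Y),
   (q ^ 2 / p ^ 2 * (p - 1) + E * (q / p ^ 2 * (p - 1) ^ 2
      - (ℓ - 1) * (s + 1) / (p * L) * (s * (p - 1) - (p + 1))),
    (q - 1) * (L - ℓ + 1) * (p - 1) / (2 * L) * Y),
   (q ^ 2 / p ^ 2 * (p - 1) + E * (q / p ^ 2 * (p - 1) ^ 2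
      - (ℓ - 1) * (q - 1) / (p * L) * (p - 1)),
    (p - 1) * (q - 1) / 2 * Y)]

/-- The table for `ℓ ≡ 1 (mod p)`, `p ≡ 3 (mod 4)`. -/
def tableOneThree (p ℓ k e : ℕ) (ε : ℤ) : List (ℚ × ℚ) :=
  let q : ℚ := (p : ℚ) ^ e
  let s : ℚ := (p : ℚ) ^ (e / 2)
  let E : ℚ := (ε : ℚ) * sqrtPStarPow p e
  let Z : ℚ := (p : ℚ) ^ (e - 1) + (p - 1) * E / p
  let Y : ℚ := (p : ℚ) ^ (e - 1) - E / p
  let L : ℚ := (ℓ : ℚ) ^ k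
  [(0, 1),
   (q ^ 2 / p ^ 2 * (p - 1), Z - 1),
   (q ^ 2 / p ^ 2 * (p - 1) + E * (q / p ^ 2 * (p - 1) ^ 2 + s * (p - 1) / p
      - (ℓ - 1) * (q + s) * (p - 1) / (p * L)),
    (q - 1) * (ℓ - 1) / L * Z),
   (q ^ 2 / p ^ 2 * (p - 1) + E * (q / p ^ 2 * (p - 1) ^ 2
      - (ℓ - 1) * (q + s) * (p - 1) / (p * L)),
    (q - 1) * (L - ℓ + 1) / L * Z),
   (q ^ 2 / p ^ 2 * (p - 1) + E * (q / p * (p - 1) - (ℓ - 1) * (q - 1) / L),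
    (p - 1) * Y),
   (q ^ 2 / p ^ 2 * (p - 1) + E * (q / p ^ 2 * (p - 1) ^ 2 - 2 * s / p
      - (ℓ - 1) * (s + 1) / (p * L) * (s * (p - 1) - p)),
    (q - 1) * (ℓ - 1) * (p - 1) / (2 * L) * Y),
   (q ^ 2 / p ^ 2 * (p - 1) + E * (q / p ^ 2 * (p - 1) ^ 2
      - (ℓ - 1) * (s + 1) / (p * L) * (s * (p - 1) - p)),
    (q - 1) * (2 * L - ℓ + 1) * (p - 1) / (2 * L) * Y)]

/-- The table for `ℓ ≢ 1 (mod p)`, `p ≡ 1 (mod 4)` and `η(t₁) = η(t₂)`; the arguments `h₁`, `h₂`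
stand for `η(t₁)` and `η(t₂)`. -/
def tableNotOneOneEq (p ℓ k e : ℕ) (ε h₁ h₂ : ℤ) : List (ℚ × ℚ) :=
  let q : ℚ := (p : ℚ) ^ e
  let s : ℚ := (p : ℚ) ^ (e / 2)
  let E : ℚ := (ε : ℚ) * sqrtPStarPow p e
  let Z : ℚ := (p : ℚ) ^ (e - 1) + (p - 1) * E / p
  let Y : ℚ := (p : ℚ) ^ (e - 1) - E / p
  let L : ℚ := (ℓ : ℚ) ^ k
  let M : ℚ := (ℓ : ℚ) ^ (k - 1)
  let T : ℚ := h₁ + (ℓ - 1) * h₂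
  [(0, 1),
   (q ^ 2 / p ^ 2 * (p - 1), Z - 1),
   (q ^ 2 / p ^ 2 * (p - 1) + E * (q / p ^ 2 * (p - 1) ^ 2 + s * (p - 1) / p
      - (q + s) * (p - 1) / (p * M)),
    (q - 1) / M * Z),
   (q ^ 2 / p ^ 2 * (p - 1) + E * (q / p ^ 2 * (p - 1) ^ 2 - (q + s) * (p - 1) / (p * M)),
    (q - 1) * (M - 1) / M * Z),
   (q ^ 2 / p ^ 2 * (p - 1) + E * (q / p * (p - 1) - (q - 1) * (p * ℓ + T) / (p * L)),
    (p - 1) / 2 * Y),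
   (q ^ 2 / p ^ 2 * (p - 1) + E * (q / p * (p - 1) - (q - 1) * (p * ℓ - T) / (p * L)),
    (p - 1) / 2 * Y),
   (q ^ 2 / p ^ 2 * (p - 1) + E * (q / p ^ 2 * (p - 1) ^ 2 - 2 * s / p - (q - 1) / M
      + (s + 1) * (ℓ * s + h₁ * T) / (p * L)),
    (q - 1) * (p - 1) / (2 * M) * Y),
   (q ^ 2 / p ^ 2 * (p - 1) + E * (q / p ^ 2 * (p - 1) ^ 2 - (q - 1) / M
      + (s + 1) * (ℓ * s - h₁ * T) / (p * L)),
    (p - 1) * (q - 1) / 2 * Y),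
   (q ^ 2 / p ^ 2 * (p - 1) + E * (q / p ^ 2 * (p - 1) ^ 2 - (q - 1) / M
      + (s + 1) * (ℓ * s + h₁ * T) / (p * L)),
    (p - 1) * (q - 1) * (M - 1) / (2 * M) * Y)]

/-- The table for `ℓ ≢ 1 (mod p)`, `p ≡ 1 (mod 4)` and `η(t₁) = -η(t₂)`; the arguments `h₁`, `h₂`
stand for `η(t₁)` and `η(t₂)`. -/
def tableNotOneOneNeg (p ℓ k e : ℕ) (ε h₁ h₂ : ℤ) : List (ℚ × ℚ) :=
  let q : ℚ := (p : ℚ) ^ e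
  let s : ℚ := (p : ℚ) ^ (e / 2)
  let E : ℚ := (ε : ℚ) * sqrtPStarPow p e
  let Z : ℚ := (p : ℚ) ^ (e - 1) + (p - 1) * E / p
  let Y : ℚ := (p : ℚ) ^ (e - 1) - E / p
  let L : ℚ := (ℓ : ℚ) ^ k
  let M : ℚ := (ℓ : ℚ) ^ (k - 1)
  let T : ℚ := h₁ + (ℓ - 1) * h₂
  [(0, 1),
   (q ^ 2 / p ^ 2 * (p - 1), Z - 1),
   (q ^ 2 / p ^ 2 * (p - 1) + E * (q / p ^ 2 * (p - 1) ^ 2 + s * (p - 1) / p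
      - (q + s) * (p - 1) / (p * M)),
    (q - 1) / M * Z),
   (q ^ 2 / p ^ 2 * (p - 1) + E * (q / p ^ 2 * (p - 1) ^ 2 - (q + s) * (p - 1) / (p * M)),
    (q - 1) * (M - 1) / M * Z),
   (q ^ 2 / p ^ 2 * (p - 1) + E * (q / p * (p - 1) - (q - 1) * (p * ℓ + T) / (p * L)),
    (p - 1) / 2 * Y),
   (q ^ 2 / p ^ 2 * (p - 1) + E * (q / p * (p - 1) - (q - 1) * (p * ℓ - T) / (p * L)),
    (p - 1) / 2 * Y),
   (q ^ 2 / p ^ 2 * (p - 1) + E * (q / p ^ 2 * (p - 1) ^ 2 - 2 * s / p - (q - 1) / M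
      + (s + 1) * (ℓ * s + h₁ * T) / (p * L)),
    (q - 1) * (p - 1) / (2 * L) * Y),
   (q ^ 2 / p ^ 2 * (p - 1) + E * (q / p ^ 2 * (p - 1) ^ 2 - (q - 1) / M
      + (s + 1) * (ℓ * s + h₁ * T) / (p * L)),
    (q - 1) * (p - 1) * (L - 1) / (2 * L) * Y),
   (q ^ 2 / p ^ 2 * (p - 1) + E * (q / p ^ 2 * (p - 1) ^ 2 - 2 * s / p - (q - 1) / M
      + (s + 1) * (ℓ * s - h₁ * T) / (p * L)),
    (q - 1) * (p - 1) * (ℓ - 1) / (2 * L) * Y),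
   (q ^ 2 / p ^ 2 * (p - 1) + E * (q / p ^ 2 * (p - 1) ^ 2 - (q - 1) / M
      + (s + 1) * (ℓ * s - h₁ * T) / (p * L)),
    (q - 1) * (p - 1) * (L - ℓ + 1) / (2 * L) * Y)]

/-- The table for `ℓ ≢ 1 (mod p)`, `p ≡ 3 (mod 4)`. -/
def tableNotOneThree (p ℓ k e : ℕ) (ε : ℤ) : List (ℚ × ℚ) :=
  let q : ℚ := (p : ℚ) ^ e
  let s : ℚ := (p : ℚ) ^ (e / 2)
  let E : ℚ := (ε : ℚ) * sqrtPStarPow p e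
  let Z : ℚ := (p : ℚ) ^ (e - 1) + (p - 1) * E / p
  let Y : ℚ := (p : ℚ) ^ (e - 1) - E / p
  let M : ℚ := (ℓ : ℚ) ^ (k - 1)
  [(0, 1),
   (q ^ 2 / p ^ 2 * (p - 1), Z - 1),
   (q ^ 2 / p ^ 2 * (p - 1) + E * (q / p ^ 2 * (p - 1) ^ 2 + s * (p - 1) / p
      - (q + s) * (p - 1) / (p * M)),
    (q - 1) / M * Z),
   (q ^ 2 / p ^ 2 * (p - 1) + E * (q / p ^ 2 * (p - 1) ^ 2 - (q + s) * (p - 1) / (p * M)),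
    (q - 1) * (M - 1) / M * Z),
   (q ^ 2 / p ^ 2 * (p - 1) + E * (q / p * (p - 1) - (q - 1) / M),
    (p - 1) * Y),
   (q ^ 2 / p ^ 2 * (p - 1) + E * (q / p ^ 2 * (p - 1) ^ 2 - 2 * s / p
      - (s + 1) / (p * M) * (s * (p - 1) - p)),
    (q - 1) * (p - 1) / (2 * M) * Y),
   (q ^ 2 / p ^ 2 * (p - 1) + E * (q / p ^ 2 * (p - 1) ^ 2
      - (s + 1) / (p * M) * (s * (p - 1) - p)),
    (q - 1) * (p - 1) * (2 * M - 1) / (2 * M) * Y)]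

end Tables

end BentCode

/-! Write e = 2m and s = √q = p^m. Two inputs make all character sums explicit.

The first concerns f. Substituting x ↦ c^j x in the Walsh sum and comparing with the Galois
conjugation ζ ↦ ζ^t (`sum_stdAddChar_mul_eq_zero`) forces f to be homogeneous of degree two, like
its dual (`MemRF.map_smul_of_dual`). If -1 is a square mod p, then W_f(0) is real. Otherwise fibre
sizes are constant on square classes and W_f(0) = A + B·G with integers A, B and a Gauss sum G, G² =
-p; then A² + pB² = p^(2m), and descent gives B = 0. So W_f(0) is an integer E = ±s
(`exists_int_eq_sum`). This yields the sign ε, and, E being fixed by Galois, every sum of ζ^(t f(x)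
- Tr(ax)) with t ≠ 0.

The second concerns T(y) = Tr(y^N). Since p is a primitive root, 2ℓ^k divides s + 1
(`two_mul_prime_pow_dvd`). With s + 1 = 2hℓ^k one has N = (s - 1)h, so T is invariant under the
multiplicative group of the subfield of s elements. A nontrivial Fourier coefficient of such a
function needs only its total sum and its values at 0 and at one point b/d, where b^(s-1) = -1
(`sum_invariant_mul_stdAddChar`). The values of T are, up to sign, traces of ℓ^k-th roots of unity
(`trace_root_of_unity`).

Expanding the conditions f(x) + T(y) = 0 and Tr(γx + δy) = 0 in characters shows that p² times the
weight of the word of (γ, δ) ≠ (0, 0) is (p - 1)s⁴ + E·x. The deviation x depends only on whether δ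
= 0, on η(f*(γ)) and, for δ ≠ 0, on η(-T(b/δ)). Counting the values of f* and T gives one table in
two parameters u, v (`IsWeightData.hasWeightDistribution`), and the stated tables are its
specialisations, with rows merged when u = 0, v = 0 or u = v. As |x| < (p - 1)s³ and |E| = s,
nonzero pairs give nonzero words, hence dimension 2e.

For the number of weights it suffices that the deviations differ. Modulo ps those with f*(γ) = 0
vanish and the others are p(pr + σt), where r = u + v, t = u - v and σ = η(f*(γ)). Since 2h is prime
to s, size estimates separate most cases; the remaining ones are settled by parity, by divisibility
by s/p, and by an inequality (`IsSeparated`). -/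

namespace BentCode

open Finset

/-! ### Galois conjugation, degree-two homogeneity of f, and integrality of its character sum -/

section CharacterSums

variable {p : ℕ} [Fact p.Prime] {F : Type*} [Field F] [Fintype F] [Algebra (ZMod p) F]

/-- Conjugating a vanishing integral combination of `p`-th roots of unity by `ζ ↦ ζ ^ t`. -/
theorem sum_stdAddChar_mul_eq_zero {ι : Type*} [Fintype ι] (c : ι → ℤ) (g : ι → ZMod p)
    {t : ZMod p} (ht : t ≠ 0) (h : ∑ i, (c i : ℂ) * ZMod.stdAddChar (g i) = 0) :
    ∑ i, (c i : ℂ) * ZMod.stdAddChar (t * g i) = 0 := by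
  have hp : p.Prime := Fact.out
  have hprim : ∀ u : ZMod p, u ≠ 0 → IsPrimitiveRoot (ZMod.stdAddChar u : ℂ) p := by
    intro u hu
    have h1 : orderOf (ZMod.stdAddChar u : ℂ) = p := by
      apply orderOf_eq_prime
      · rw [← AddChar.map_nsmul_eq_pow]
        simp
      · intro h1
        exact hu (ZMod.injective_stdAddChar (by rw [h1, AddChar.map_zero_eq_one]))
    simpa [h1] using IsPrimitiveRoot.orderOf (ZMod.stdAddChar u : ℂ)
  have hval : ∀ u a : ZMod p, (ZMod.stdAddChar (u * a) : ℂ) = ZMod.stdAddChar u ^ a.val := by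
    intro u a
    rw [← AddChar.map_nsmul_eq_pow, nsmul_eq_mul, ZMod.natCast_zmod_val, mul_comm]
  -- The relation says that this integer polynomial vanishes at ζ, so the p-th cyclotomic polynomial
  -- divides it, and that polynomial kills ζ^t too.
  let P : Polynomial ℤ := ∑ i, Polynomial.C (c i) * Polynomial.X ^ (g i).val
  have hP : ∀ u : ZMod p, Polynomial.aeval (ZMod.stdAddChar u : ℂ) P =
      ∑ i, (c i : ℂ) * ZMod.stdAddChar (u * g i) := by
    intro u
    simp [P, map_sum, hval]
  have h1 : Polynomial.aeval (ZMod.stdAddChar (1 : ZMod p) : ℂ) P = 0 := by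
    rw [hP]; simpa using h
  have hdvd : Polynomial.cyclotomic p ℤ ∣ P := by
    rw [Polynomial.cyclotomic_eq_minpoly (hprim 1 one_ne_zero) hp.pos]
    exact minpoly.isIntegrallyClosed_dvd ((hprim 1 one_ne_zero).isIntegral hp.pos) h1
  obtain ⟨R, hR⟩ := hdvd
  rw [← hP, hR, map_mul]
  have h2 : Polynomial.aeval (ZMod.stdAddChar t : ℂ) (Polynomial.cyclotomic p ℤ) = 0 := by
    rw [Polynomial.cyclotomic_eq_minpoly (hprim t ht) hp.pos, minpoly.aeval]
  rw [h2, zero_mul]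

theorem sum_stdAddChar_mul (a : ZMod p) :
    ∑ z : ZMod p, (ZMod.stdAddChar (z * a) : ℂ) = if a = 0 then (p : ℂ) else 0 := by
  rw [AddChar.sum_mulShift a (ZMod.isPrimitive_stdAddChar p), ZMod.card]
  split_ifs <;> simp

/-- For a ≠ 0 the character is nontrivial because the trace form is nondegenerate. -/
theorem sum_stdAddChar_trace [DecidableEq F] (a : F) :
    ∑ x : F, (ZMod.stdAddChar (Algebra.trace (ZMod p) F (a * x)) : ℂ) =
      if a = 0 then (Fintype.card F : ℂ) else 0 := by
  split_ifs with h
  · simp [h]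
  · let φ : AddChar F ℂ := (ZMod.stdAddChar (N := p)).compAddMonoidHom
      ((Algebra.trace (ZMod p) F).toAddMonoidHom.comp (AddMonoidHom.mulLeft a))
    have hφ : φ ≠ 1 := by
      intro hone
      apply h
      refine (traceForm_nondegenerate (ZMod p) F).1 a fun b => ?_
      have h1 : (ZMod.stdAddChar (Algebra.trace (ZMod p) F (a * b)) : ℂ) = 1 := by
        simpa [φ] using DFunLike.congr_fun hone b
      rw [Algebra.traceForm_apply]
      exact ZMod.injective_stdAddChar (by rw [h1, AddChar.map_zero_eq_one])
    simpa [φ] using AddChar.sum_eq_zero_of_ne_one hφ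

/-- Fourier inversion for the Walsh transform. -/
theorem sum_walsh_mul (f : F → ZMod p) (y : F) :
    ∑ a : F, walsh f a * ZMod.stdAddChar (Algebra.trace (ZMod p) F (a * y)) =
      (Fintype.card F : ℂ) * ZMod.stdAddChar (f y) := by
  classical
  have h : ∀ x : F, ∑ a : F, (ZMod.stdAddChar (f x - Algebra.trace (ZMod p) F (a * x)) : ℂ) *
      ZMod.stdAddChar (Algebra.trace (ZMod p) F (a * y)) =
      if y - x = 0 then (Fintype.card F : ℂ) * ZMod.stdAddChar (f x) else 0 := by
    intro x
    have h1 := sum_stdAddChar_trace (p := p) (y - x)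
    calc _ = ∑ a : F, (ZMod.stdAddChar (f x) : ℂ) *
          ZMod.stdAddChar (Algebra.trace (ZMod p) F ((y - x) * a)) := by
          refine sum_congr rfl fun a _ => ?_
          rw [← AddChar.map_add_eq_mul, ← AddChar.map_add_eq_mul, sub_mul, map_sub,
            mul_comm y, mul_comm x]
          congr 1
          ring
      _ = _ := by
          rw [← mul_sum, h1]
          split_ifs <;> simp [mul_comm]
  simp only [walsh, sum_mul]
  rw [sum_comm]
  simp only [h, sub_eq_zero]
  simp

theorem walsh_zero (f : F → ZMod p) : walsh f 0 = ∑ x : F, (ZMod.stdAddChar (f x) : ℂ) := by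
  simp [walsh]

variable {f fs : F → ZMod p}

/-- Evaluating at 0, where the dual vanishes, identifies u√q with the character sum of f; the unit u
can then be forgotten. -/
theorem IsDual.walsh_eq (hd : IsDual f fs) (h0 : fs 0 = 0) (a : F) :
    walsh f a = (∑ x : F, (ZMod.stdAddChar (f x) : ℂ)) * ZMod.stdAddChar (fs a) := by
  obtain ⟨u, -, hu⟩ := hd
  have h := hu 0
  rw [h0, AddChar.map_zero_eq_one, mul_one, walsh_zero] at h
  rw [hu a, h]

theorem IsDual.sum_stdAddChar_mul (hd : IsDual f fs) (h0 : fs 0 = 0) {t : ZMod p} (ht : t ≠ 0)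
    (a : F) :
    ∑ x : F, (ZMod.stdAddChar (t * (f x - Algebra.trace (ZMod p) F (a * x))) : ℂ) =
      ZMod.stdAddChar (t * fs a) * ∑ x : F, (ZMod.stdAddChar (t * f x) : ℂ) := by
  -- Moved to one side, `walsh_eq` is a vanishing combination of roots of unity with coefficients ±1
  -- indexed by two copies of F.
  have h := sum_stdAddChar_mul_eq_zero (p := p) (ι := F ⊕ F)
    (Sum.elim (fun _ => 1) fun _ => -1)
    (Sum.elim (fun x => f x - Algebra.trace (ZMod p) F (a * x)) fun x => f x + fs a) ht (by
      have h1 := hd.walsh_eq h0 a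
      rw [walsh, sum_mul] at h1
      simp only [Fintype.sum_sum_type, Sum.elim_inl, Sum.elim_inr, AddChar.map_add_eq_mul]
      simp [h1])
  simp only [Fintype.sum_sum_type, Sum.elim_inl, Sum.elim_inr, mul_add, AddChar.map_add_eq_mul]
    at h
  push_cast at h
  simp only [one_mul, neg_mul, sum_neg_distrib, ← sum_mul] at h
  rw [mul_comm]
  exact add_neg_eq_zero.mp h

/-- A zero dual would make the Walsh transform constant, and Fourier inversion at the point 1 would
then return 0 instead of q times a root of unity. -/
theorem IsDual.exists_ne_zero (hd : IsDual f fs) : ∃ a, fs a ≠ 0 := by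
  classical
  by_contra! hz
  have h := sum_walsh_mul f (1 : F)
  have h1 := sum_stdAddChar_trace (p := p) (1 : F)
  simp only [hd.walsh_eq (hz 0), hz, AddChar.map_zero_eq_one, mul_one, ← mul_sum] at h
  simp only [one_mul, one_ne_zero, if_false] at h1
  rw [h1, mul_zero] at h
  have hq : (Fintype.card F : ℂ) ≠ 0 := Nat.cast_ne_zero.mpr Fintype.card_ne_zero
  have hne : (ZMod.stdAddChar (f 1) : ℂ) ≠ 0 := by
    have := AddChar.norm_apply (ZMod.stdAddChar (N := p)) (f 1)
    intro h0
    rw [h0] at this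
    simp at this
  exact mul_ne_zero hq hne h.symm

theorem IsBent.norm_sum_sq (hf : IsBent f) :
    ‖∑ x : F, (ZMod.stdAddChar (f x) : ℂ)‖ ^ 2 = Fintype.card F := by
  rw [← hf 0, walsh_zero]

theorem IsBent.sum_ne_zero (hf : IsBent f) : ∑ x : F, (ZMod.stdAddChar (f x) : ℂ) ≠ 0 := by
  intro h
  have := hf.norm_sum_sq
  rw [h] at this
  simp [eq_comm] at this

theorem sum_smul_eq {M : Type*} [AddCommMonoid M] {c : ZMod p} (hc : c ≠ 0) (g : F → M) :
    ∑ x : F, g (c • x) = ∑ x : F, g x :=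
  Fintype.sum_bijective (fun x : F => c • x) (MulAction.bijective₀ hc) _ _ fun _ => rfl

/-- A bent function in `RF` whose dual is homogeneous of degree two is itself homogeneous of
degree two. -/
theorem MemRF.map_smul_of_dual (hf : MemRF f) (hd : IsDual f fs)
    (hquad : ∀ (c : ZMod p) (x : F), fs (c • x) = c ^ 2 * fs x) (c : ZMod p) (x : F) :
    f (c • x) = c ^ 2 * f x := by
  obtain ⟨⟨hb, -⟩, hf0, kf, hkf, -, hgcd, hhom⟩ := hf
  have h0 : fs 0 = 0 := by simpa using hquad 0 0
  rcases eq_or_ne c 0 with rfl | hc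
  · simp [hf0]
  -- The exponent kf - 1 is prime to the order of c, so it has an inverse j. Then c^(j·kf) =
  -- c^(j+1), and the substitution x ↦ c^j x multiplies f(x) and the trace term of W_f(c b) by the
  -- same scalar.
  obtain ⟨j, hj⟩ : ∃ j : ℕ, c ^ (j * (kf - 1)) = c := by
    have hdvd : orderOf c ∣ p - 1 := orderOf_dvd_of_pow_eq_one (ZMod.pow_card_sub_one_eq_one hc)
    obtain ⟨j, hj⟩ := exists_pow_eq_self_of_coprime (Nat.Coprime.coprime_dvd_right hdvd hgcd)
    exact ⟨j, by rw [mul_comm, pow_mul, hj]⟩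
  obtain ⟨a, ha⟩ := hd.exists_ne_zero
  have hjk : c ^ (j * kf) = c ^ (j + 1) := by
    obtain ⟨m, rfl⟩ : ∃ m, kf = m + 1 := ⟨kf - 1, by omega⟩
    rw [Nat.add_sub_cancel] at hj
    rw [mul_add, mul_one, pow_add, hj, pow_succ']
  have hcj : c ^ j ≠ 0 := pow_ne_zero _ hc
  have hcj1 : c ^ (j + 1) ≠ 0 := pow_ne_zero _ hc
  have key : ∀ b : F, walsh f (c • b) =
      ZMod.stdAddChar (c ^ (j + 1) * fs b) *
        ∑ x : F, (ZMod.stdAddChar (c ^ (j + 1) * f x) : ℂ) := by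
    intro b
    rw [← hd.sum_stdAddChar_mul h0 hcj1, walsh, ← sum_smul_eq hcj]
    refine sum_congr rfl fun x _ => ?_
    rw [hhom _ hcj, ← pow_mul, hjk, smul_mul_smul_comm, map_smul, smul_eq_mul, ← pow_succ',
      mul_sub]
  have hV : ∑ x : F, (ZMod.stdAddChar (c ^ (j + 1) * f x) : ℂ) =
      ∑ x : F, (ZMod.stdAddChar (f x) : ℂ) := by
    have := key 0
    rw [smul_zero, walsh_zero, h0, mul_zero, AddChar.map_zero_eq_one, one_mul] at this
    exact this.symm
  -- Comparing with the homogeneity of the dual where it does not vanish gives c^(j+1) = c², so c^j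
  -- = c and c^kf = c^(j·kf) = c².
  have h1 := key a
  rw [hV, hd.walsh_eq h0, hquad, mul_comm] at h1
  have h2 := ZMod.injective_stdAddChar (mul_right_cancel₀ hb.sum_ne_zero h1)
  have h3 := mul_right_cancel₀ ha h2
  have h4 : c ^ j = c := by
    rw [pow_two, pow_succ] at h3
    exact (mul_right_cancel₀ hc h3).symm
  have h5 : c ^ kf = c ^ 2 := by
    rw [h3, ← hjk, pow_mul, h4]
  rw [hhom c hc, h5]

/-- The representation of `p ^ (2 * m)` by the form `a ^ 2 + p * b ^ 2` is trivial. -/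
theorem eq_zero_of_sq_add_mul_sq {p : ℕ} (hp : p.Prime) (m : ℕ) (a b : ℤ)
    (h : a ^ 2 + p * b ^ 2 = (p : ℤ) ^ (2 * m)) : b = 0 := by
  induction m generalizing a b with
  | zero =>
    by_contra hb
    have h1 : 1 ≤ b ^ 2 := by have := sq_pos_of_ne_zero (a := b) hb; omega
    have h2 : (2 : ℤ) ≤ p := by exact_mod_cast hp.two_le
    simp only [mul_zero, pow_zero] at h
    nlinarith [sq_nonneg a]
  | succ m ih =>
    have hpz : Prime (p : ℤ) := Nat.prime_iff_prime_int.mp hp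
    have hp0 : (p : ℤ) ≠ 0 := hpz.ne_zero
    rw [mul_add, mul_one, pow_add] at h
    -- Descent: p divides a, hence b, and dividing the equation by p² lowers m by one.
    obtain ⟨a', rfl⟩ : (p : ℤ) ∣ a := by
      refine hpz.dvd_of_dvd_pow (n := 2) ⟨(p : ℤ) ^ (2 * m) * p - b ^ 2, ?_⟩
      linear_combination h
    obtain ⟨b', rfl⟩ : (p : ℤ) ∣ b := by
      refine hpz.dvd_of_dvd_pow (n := 2) ⟨(p : ℤ) ^ (2 * m) - a' ^ 2, ?_⟩
      apply mul_left_cancel₀ hp0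
      linear_combination h
    have : b' = 0 := by
      apply ih a' b'
      apply mul_left_cancel₀ (pow_ne_zero 2 hp0)
      linear_combination h
    rw [this, mul_zero]

theorem stdAddChar_neg (a : ZMod p) :
    (ZMod.stdAddChar (-a) : ℂ) = (starRingEnd ℂ) (ZMod.stdAddChar a) :=
  AddChar.map_neg_eq_conj _ a

/-- The fibre is stable under x ↦ -x, whose only fixed point 0 lies over the value 0. -/
theorem even_card_fiber (hp : p ≠ 2) [DecidableEq F] (hneg : ∀ x, f (-x) = f x) (hf0 : f 0 = 0)
    {a : ZMod p} (ha : a ≠ 0) : Even #{x : F | f x = a} := by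
  have hchar : ringChar F ≠ 2 := by
    rw [ringChar.eq_iff.mpr (charP_of_injective_algebraMap (algebraMap (ZMod p) F).injective p)]
    exact hp
  rw [← Nat.not_odd_iff_even, ← ZMod.natCast_eq_one_iff_odd]
  intro h
  have h1 : ∑ x ∈ ({x : F | f x = a} : Finset F), (1 : ZMod 2) = 0 := by
    refine sum_involution (fun x _ => -x) (fun _ _ => by decide) (fun x hx _ hxx => ?_)
      (fun x hx => ?_) (fun _ _ => neg_neg _)
    · have hx0 : x = 0 := by
        have := (Ring.eq_self_iff_eq_zero_of_char_ne_two hchar (a := x)).mp hxx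
        exact this
      rw [mem_filter, hx0, hf0] at hx
      exact ha hx.2.symm
    · rw [mem_filter] at hx ⊢
      exact ⟨mem_univ _, by rw [hneg, hx.2]⟩
  rw [sum_const, nsmul_eq_mul, mul_one, h] at h1
  exact one_ne_zero h1

theorem sum_stdAddChar_eq_sum_card {ι : Type*} [Fintype ι] (f : ι → ZMod p) :
    ∑ x : ι, (ZMod.stdAddChar (f x) : ℂ) =
      ∑ a : ZMod p, (#{x : ι | f x = a} : ℂ) * ZMod.stdAddChar a := by
  rw [← sum_fiberwise univ f]
  refine sum_congr rfl fun a _ => ?_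
  rw [sum_congr rfl (g := fun _ => (ZMod.stdAddChar a : ℂ))
    (fun x hx => by rw [(mem_filter.mp hx).2])]
  simp

/-- Scaling by c matches the two fibres, so fibre sizes over nonzero values depend only on the
square class. -/
theorem card_fiber_mul_sq [DecidableEq F] (hsq : ∀ (c : ZMod p) (x : F), f (c • x) = c ^ 2 * f x)
    {c : ZMod p} (hc : c ≠ 0) (a : ZMod p) :
    #{x : F | f x = c ^ 2 * a} = #{x : F | f x = a} := by
  symm
  refine card_bij (fun x _ => c • x) (fun x hx => ?_) (fun x _ y _ hxy => ?_) fun y hy => ?_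
  · rw [mem_filter] at hx ⊢
    exact ⟨mem_univ _, by rw [hsq, hx.2]⟩
  · exact (MulAction.injective₀ hc) hxy
  · rw [mem_filter] at hy
    refine ⟨c⁻¹ • y, ?_, smul_inv_smul₀ hc y⟩
    rw [mem_filter, hsq, hy.2]
    refine ⟨mem_univ _, ?_⟩
    field_simp

/-- The character sum of a bent function that is homogeneous of degree two, on a field of square
order, is a rational integer. -/
theorem exists_int_eq_sum (hp : p ≠ 2) {m : ℕ} (hF : Fintype.card F = p ^ (2 * m))
    (hb : IsBent f) (hf0 : f 0 = 0)
    (hsq : ∀ (c : ZMod p) (x : F), f (c • x) = c ^ 2 * f x) :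
    ∃ E : ℤ, E ^ 2 = (p : ℤ) ^ (2 * m) ∧ ∑ x : F, (ZMod.stdAddChar (f x) : ℂ) = E := by
  classical
  set V : ℂ := ∑ x : F, (ZMod.stdAddChar (f x) : ℂ) with hVdef
  have hnorm : V * (starRingEnd ℂ) V = (p : ℂ) ^ (2 * m) := by
    rw [Complex.mul_conj, Complex.normSq_eq_norm_sq, hb.norm_sum_sq, hF]
    push_cast
    rfl
  have hconj : (starRingEnd ℂ) V = ∑ x : F, (ZMod.stdAddChar (-f x) : ℂ) := by
    simp only [hVdef, map_sum, stdAddChar_neg]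
  by_cases h3 : IsSquare (-1 : ZMod p)
  -- Scaling x by a square root of -1 turns V into its conjugate, so V is real and V² = p^(2m).
  · obtain ⟨c, hc⟩ := h3
    have hc0 : c ≠ 0 := by
      rintro rfl
      simp at hc
    have hreal : (starRingEnd ℂ) V = V := by
      rw [hconj, hVdef, ← sum_smul_eq hc0]
      refine sum_congr rfl fun x _ => ?_
      rw [hsq, pow_two, ← hc, neg_one_mul, neg_neg]
    rw [hreal, ← pow_two, mul_comm 2 m, pow_mul] at hnorm
    rcases sq_eq_sq_iff_eq_or_eq_neg.mp hnorm with h | h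
    · exact ⟨(p : ℤ) ^ m, by ring, by rw [h]; push_cast; rfl⟩
    · exact ⟨-(p : ℤ) ^ m, by ring, by rw [h]; push_cast; rfl⟩
  · have hchar : ringChar (ZMod p) ≠ 2 := by rwa [ZMod.ringChar_zmod_n]
    set n : ZMod p → ℕ := fun a => #{x : F | f x = a} with hn
    obtain ⟨d, hd⟩ := quadraticChar_exists_neg_one hchar
    have hd0 : d ≠ 0 := by
      rintro rfl
      simp at hd
    have hneg : ∀ x, f (-x) = f x := by
      intro x
      have := hsq (-1) x
      simpa using this
    -- The fibres over squares and nonsquares have 2u and 2v elements; evenness makes the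
    -- coefficients u + v and u - v of 1 and η integers.
    obtain ⟨u, hu⟩ := even_card_fiber hp hneg hf0 (one_ne_zero (α := ZMod p))
    obtain ⟨v, hv⟩ := even_card_fiber hp hneg hf0 hd0
    obtain ⟨n₀, hn₀⟩ : ∃ n₀ : ℤ, (n 0 : ℤ) = n₀ := ⟨_, rfl⟩
    have hval : ∀ a : ZMod p, (n a : ℂ) = (u + v : ℤ) + (u - v : ℤ) * (quadraticChar (ZMod p) a : ℤ)
        + if a = 0 then ((n₀ : ℂ) - (u + v : ℤ)) else 0 := by
      intro a
      rcases eq_or_ne a 0 with rfl | ha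
      · simp [← hn₀]
      rw [if_neg ha, add_zero]
      rcases quadraticChar_dichotomy ha with h1 | h1
      · obtain ⟨c, rfl⟩ := (quadraticChar_one_iff_isSquare ha).mp h1
        have hc : c ≠ 0 := fun h => ha (by rw [h, mul_zero])
        have := card_fiber_mul_sq hsq hc 1
        rw [h1]
        simp only [hn]
        rw [← pow_two, ← mul_one (c ^ 2), this, hu]
        push_cast
        ring
      · have h2 : quadraticChar (ZMod p) (a * d⁻¹) = 1 := by
          have : quadraticChar (ZMod p) (a * d⁻¹) * quadraticChar (ZMod p) d = -1 := by
            rw [← map_mul, inv_mul_cancel_right₀ hd0, h1]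
          rw [hd] at this
          linarith
        obtain ⟨c, hc⟩ := (quadraticChar_one_iff_isSquare
          (mul_ne_zero ha (inv_ne_zero hd0))).mp h2
        have hac : a = c ^ 2 * d := by
          rw [pow_two, ← hc, inv_mul_cancel_right₀ hd0]
        have hc0 : c ≠ 0 := fun h => ha (by rw [hac, h]; ring)
        have := card_fiber_mul_sq hsq hc0 d
        rw [h1]
        simp only [hn]
        rw [hac, this, hv]
        push_cast
        ring
    set χ : MulChar (ZMod p) ℂ := (quadraticChar (ZMod p)).ringHomComp (Int.castRingHom ℂ) with hχ
    set G := gaussSum χ (ZMod.stdAddChar (N := p)) with hG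
    have hneg1 : quadraticChar (ZMod p) (-1) = -1 :=
      quadraticChar_neg_one_iff_not_isSquare.mpr h3
    have hχ1 : χ ≠ 1 := by
      intro h
      have := DFunLike.congr_fun h (-1)
      simp [hχ, hneg1, MulChar.one_apply] at this
      norm_num at this
    have hχ2 : χ.IsQuadratic := (quadraticChar_isQuadratic (ZMod p)).comp _
    have hG2 : G ^ 2 = -(p : ℂ) := by
      rw [hG, gaussSum_sq hχ1 hχ2 (ZMod.isPrimitive_stdAddChar p), ZMod.card]
      simp [hχ, hneg1]
    have hGc : (starRingEnd ℂ) G = -G := by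
      simp only [hG, gaussSum, map_sum, map_mul, ← stdAddChar_neg, ← sum_neg_distrib]
      refine Fintype.sum_bijective (fun a => -a) neg_involutive.bijective _ _ fun a => ?_
      have : quadraticChar (ZMod p) (-a) = - quadraticChar (ZMod p) a := by
        rw [← neg_one_mul, map_mul, hneg1, neg_one_mul]
      simp [hχ, this]
    have hVG : V = (n₀ - (u + v) : ℤ) + (u - v : ℤ) * G := by
      rw [hVdef, sum_stdAddChar_eq_sum_card]
      have hone : ∑ a : ZMod p, (ZMod.stdAddChar a : ℂ) = 0 := by
        have := sum_stdAddChar_mul (1 : ZMod p)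
        simpa using this
      change ∑ a, (n a : ℂ) * _ = _
      simp only [hval, add_mul, sum_add_distrib, ← mul_sum, hone, mul_zero, zero_add, ite_mul,
        zero_mul, sum_ite_eq', mem_univ, if_true, AddChar.map_zero_eq_one, mul_one, mul_assoc]
      rw [add_comm]
      congr 1
      · push_cast; ring
    -- Here -1 is a nonsquare, so G² = -p and conjugation negates G; this is the norm equation |V|²
    -- = p^(2m) for V = A + B·G.
    have hab : (n₀ - (u + v)) ^ 2 + p * ((u : ℤ) - v) ^ 2 = (p : ℤ) ^ (2 * m) := by
      rw [hVG] at hnorm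
      simp only [map_add, map_mul, map_intCast, hGc] at hnorm
      have : (((n₀ - (u + v)) ^ 2 + p * ((u : ℤ) - v) ^ 2 : ℤ) : ℂ) =
          ((p : ℤ) ^ (2 * m) : ℤ) := by
        push_cast at hnorm ⊢
        linear_combination hnorm + ((u : ℂ) - v) ^ 2 * hG2
      exact_mod_cast this
    have hb0 := eq_zero_of_sq_add_mul_sq Fact.out m _ _ hab
    rw [hb0] at hab hVG
    exact ⟨_, by simpa using hab, by simpa using hVG⟩

end CharacterSums

/-! ### Conjugates of an integral character sum and the distribution of the dual -/

section DualSums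

variable {p : ℕ} [Fact p.Prime] {F : Type*} [Field F] [Fintype F] [Algebra (ZMod p) F]

theorem sum_stdAddChar_mul_eq_intCast {ι : Type*} [Fintype ι] {g : ι → ZMod p} {E : ℤ}
    (h : ∑ i, (ZMod.stdAddChar (g i) : ℂ) = E) {t : ZMod p} (ht : t ≠ 0) :
    ∑ i, (ZMod.stdAddChar (t * g i) : ℂ) = E := by
  -- Conjugation fixes integers: the extra index `none` carries -E at the exponent 0.
  have h1 := sum_stdAddChar_mul_eq_zero (p := p) (ι := Option ι)
    (fun o => o.elim (-E) fun _ => 1) (fun o => o.elim 0 g) ht (by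
      rw [Fintype.sum_option]
      simp [h])
  rw [Fintype.sum_option] at h1
  simp only [Option.elim_none, Option.elim_some, mul_zero, AddChar.map_zero_eq_one] at h1
  push_cast at h1
  simp only [one_mul] at h1
  linear_combination h1

/-- Fibre sizes of a function all of whose nontrivial character sums equal the integer `E`. -/
theorem card_fiber_of_sum_eq {ι : Type*} [Fintype ι] {g : ι → ZMod p} {E : ℤ}
    (h : ∑ i, (ZMod.stdAddChar (g i) : ℂ) = E) (a : ZMod p) :
    (p : ℤ) * #{i | g i = a} = Fintype.card ι - E + if a = 0 then p * E else 0 := by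
  -- At t = 0 the sum is the cardinality instead of E, which the first term corrects.
  have h1 : ∀ t : ZMod p, ∑ i, (ZMod.stdAddChar (t * (g i - a)) : ℂ) =
      (if t = 0 then (Fintype.card ι : ℂ) - E else 0) + E * ZMod.stdAddChar (t * (0 - a)) := by
    intro t
    rcases eq_or_ne t 0 with rfl | ht
    · simp
    · rw [if_neg ht, zero_add, ← sum_stdAddChar_mul_eq_intCast h ht, sum_mul]
      refine sum_congr rfl fun i _ => ?_
      rw [← AddChar.map_add_eq_mul]
      congr 1
      ring
  have h2 : ∑ t : ZMod p, ∑ i, (ZMod.stdAddChar (t * (g i - a)) : ℂ) = (p : ℂ) * #{i | g i = a} := by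
    rw [sum_comm]
    simp only [sum_stdAddChar_mul, sub_eq_zero, ← sum_filter, sum_const, nsmul_eq_mul, mul_comm]
  simp only [h1, sum_add_distrib, ← mul_sum, sum_stdAddChar_mul] at h2
  have h3 : (((p : ℤ) * #{i | g i = a} : ℤ) : ℂ) =
      ((Fintype.card ι - E + if a = 0 then p * E else 0 : ℤ) : ℂ) := by
    push_cast
    rw [← h2]
    rcases eq_or_ne a 0 with rfl | ha
    · simp [mul_comm]
    · simp [ha]
  exact_mod_cast h3

variable {f fs : F → ZMod p} {E : ℤ}

/-- The exponent is t(f(x) - Tr(t⁻¹a x)), and t·f*(t⁻¹a) = t⁻¹f*(a) by homogeneity. -/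
theorem IsDual.sum_stdAddChar_sub_trace (hd : IsDual f fs)
    (hquad : ∀ (c : ZMod p) (x : F), fs (c • x) = c ^ 2 * fs x)
    (hE : ∑ x : F, (ZMod.stdAddChar (f x) : ℂ) = E) {t : ZMod p} (ht : t ≠ 0) (a : F) :
    ∑ x : F, (ZMod.stdAddChar (t * f x - Algebra.trace (ZMod p) F (a * x)) : ℂ) =
      E * ZMod.stdAddChar (t⁻¹ * fs a) := by
  have h := hd.sum_stdAddChar_mul (by simpa using hquad 0 0) ht (t⁻¹ • a)
  rw [sum_stdAddChar_mul_eq_intCast hE ht, hquad] at h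
  rw [mul_comm (E : ℂ)]
  convert h using 3 with x
  · rw [smul_mul_assoc, map_smul, smul_eq_mul]
    field_simp
  · field_simp

/-- Fourier inversion at 0 reads E·Σ ζ^(f*) = q = E². -/
theorem IsDual.sum_dual (hd : IsDual f fs) (hf0 : f 0 = 0)
    (hquad : ∀ (c : ZMod p) (x : F), fs (c • x) = c ^ 2 * fs x)
    (hE : ∑ x : F, (ZMod.stdAddChar (f x) : ℂ) = E) (hEsq : E ^ 2 = Fintype.card F) :
    ∑ x : F, (ZMod.stdAddChar (fs x) : ℂ) = E := by
  have h := sum_walsh_mul f 0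
  simp only [hd.walsh_eq (by simpa using hquad 0 0), hE, mul_zero, map_zero, hf0,
    AddChar.map_zero_eq_one, mul_one, ← mul_sum] at h
  have h1 : (E : ℂ) ^ 2 = Fintype.card F := by exact_mod_cast hEsq
  have h2 : (E : ℂ) ≠ 0 := by
    intro h0
    rw [h0] at h1
    simp [eq_comm] at h1
  apply mul_left_cancel₀ h2
  rw [h, ← h1, pow_two]

end DualSums

/-! ### Counting solutions of y^n = ±1 -/

section PowerRoots

variable {F : Type*} [Field F] [Fintype F] [DecidableEq F]

theorem card_pow_eq_one {n : ℕ} (hn : n ∣ Fintype.card F - 1) : #{y : F | y ^ n = 1} = n := by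
  obtain ⟨g, hg⟩ := IsCyclic.exists_ofOrder_eq_natCard (α := Fˣ)
  rw [Nat.card_eq_fintype_card, Fintype.card_units] at hg
  have hpos : 0 < Fintype.card F - 1 := Nat.sub_pos_of_lt Fintype.one_lt_card
  have hn0 : 0 < n := Nat.pos_of_dvd_of_pos hn hpos
  obtain ⟨c, hc⟩ := hn
  have h1 : IsPrimitiveRoot (g ^ c) n :=
    IsPrimitiveRoot.pow hpos (hg ▸ IsPrimitiveRoot.orderOf g) (by rw [hc, mul_comm])
  have h2 : IsPrimitiveRoot ((g ^ c : Fˣ) : F) n := IsPrimitiveRoot.coe_units_iff.mpr h1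
  have h3 : ({y : F | y ^ n = 1} : Finset F) = Polynomial.nthRootsFinset n 1 := by
    ext y
    simp [Polynomial.mem_nthRootsFinset hn0]
  rw [h3, h2.card_nthRootsFinset]

/-- The 2n solutions of y^(2n) = 1 split into those of y^n = 1 and those of y^n = -1. -/
theorem card_pow_eq_neg_one (hF : (1 : F) ≠ -1) {n : ℕ} (hn : 2 * n ∣ Fintype.card F - 1) :
    #{y : F | y ^ n = -1} = n := by
  have h1 := card_pow_eq_one hn
  have h2 := card_pow_eq_one ((Dvd.intro_left 2 rfl).trans hn)
  have h3 : ({y : F | y ^ (2 * n) = 1} : Finset F) =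
      ({y : F | y ^ n = 1} : Finset F) ∪ ({y : F | y ^ n = -1} : Finset F) := by
    ext y
    simp only [mem_filter, mem_univ, true_and, mem_union]
    rw [mul_comm, pow_mul, sq_eq_one_iff]
  rw [h3, card_union_of_disjoint, h2] at h1
  · omega
  · rw [disjoint_filter]
    intro y _ h h'
    exact hF (h.symm.trans h')

end PowerRoots

/-! ### Exponential sums of functions invariant under the units of the subfield of index two -/

section Semiprimitive

variable {p : ℕ} [Fact p.Prime] {F : Type*} [Field F] [Fintype F] [Algebra (ZMod p) F]

theorem trace_pow_prime_pow (m : ℕ) (x : F) :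
    Algebra.trace (ZMod p) F (x ^ p ^ m) = Algebra.trace (ZMod p) F x := by
  induction m with
  | zero => simp
  | succ m ih =>
    rw [pow_succ, pow_mul, ← ih]
    have := Algebra.trace_eq_of_algEquiv
      (FiniteField.frobeniusAlgEquivOfAlgebraic (ZMod p) F) (x ^ p ^ m)
    rwa [FiniteField.coe_frobeniusAlgEquivOfAlgebraic, ZMod.card] at this

theorem one_ne_neg_one_of_algebra {F : Type*} [Field F] [Algebra (ZMod p) F] (hp : p ≠ 2) :
    (1 : F) ≠ -1 := by
  have hchar : ringChar F ≠ 2 := by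
    rw [ringChar.eq_iff.mpr (charP_of_injective_algebraMap (algebraMap (ZMod p) F).injective p)]
    exact hp
  exact (Ring.neg_one_ne_one_of_char_ne_two hchar).symm

variable [DecidableEq F] {m : ℕ}

theorem pow_eq_self_iff {F : Type*} [Field F] {n : ℕ} (hn : 1 ≤ n) (y c : F) :
    y ^ n = c * y ↔ y = 0 ∨ y ^ (n - 1) = c := by
  obtain ⟨n, rfl⟩ := Nat.exists_eq_add_of_le' hn
  rw [Nat.add_sub_cancel, pow_succ, mul_eq_mul_right_iff, or_comm]

/-- With n = s the index set on the left is the subfield of s elements for c = 1 and its annihilator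
under the trace form for c = -1; this passes to their nonzero elements. -/
theorem sum_pow_eq_mul_self {M : Type*} [AddCommGroup M] {n : ℕ} (hn : 2 ≤ n) {c : F} (hc : c ≠ 0)
    (g : F → M) :
    ∑ y : F with y ^ n = c * y, g y = g 0 + ∑ y : F with y ^ (n - 1) = c, g y := by
  have h : ({y : F | y ^ n = c * y} : Finset F) = insert 0 ({y : F | y ^ (n - 1) = c} : Finset F) := by
    ext y
    simp [pow_eq_self_iff (by omega : 1 ≤ n)]
  rw [h, sum_insert]
  simp [zero_pow (by omega : n - 1 ≠ 0), hc.symm]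

/-- In a field of `s ^ 2` elements, the sum of the canonical character over `c` times the subfield
of `s` elements. -/
theorem sum_subfield_stdAddChar (hp : p ≠ 2) (hm : 1 ≤ m) (hF : Fintype.card F = (p ^ m) ^ 2)
    (c : F) :
    ∑ u : F with u ^ p ^ m = 1 * u, (ZMod.stdAddChar (Algebra.trace (ZMod p) F (c * u)) : ℂ) =
      if c ^ p ^ m = -1 * c then ((p ^ m : ℕ) : ℂ) else 0 := by
  have hprime : p.Prime := Fact.out
  have : CharP F p := charP_of_injective_algebraMap (algebraMap (ZMod p) F).injective p
  set s := p ^ m with hs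
  set K : Finset F := {u : F | u ^ s = 1 * u} with hK
  have hs3 : 3 ≤ s := by
    have h1 : 3 ≤ p := by have := hprime.two_le; omega
    exact h1.trans (Nat.le_self_pow (by omega) p)
  have hodd : Odd s := (hprime.odd_of_ne_two hp).pow
  have hfac : Fintype.card F - 1 = (s + 1) * (s - 1) := by
    rw [hF, ← Nat.sq_sub_sq, one_pow]
  have hcardK : #K = s := by
    have h1 := sum_pow_eq_mul_self (by omega : 2 ≤ s) (one_ne_zero (α := F)) fun _ => (1 : ℤ)
    rw [sum_const, sum_const, card_pow_eq_one (by rw [hfac]; exact Dvd.intro_left _ rfl)] at h1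
    simp only [nsmul_eq_mul, mul_one] at h1
    zify
    rw [h1]
    push_cast [show 1 ≤ s by omega]
    ring
  have hcardL : #{c : F | c ^ s = -1 * c} = s := by
    have h1 := sum_pow_eq_mul_self (by omega : 2 ≤ s) (neg_ne_zero.mpr (one_ne_zero (α := F)))
      fun _ => (1 : ℤ)
    rw [sum_const, sum_const, card_pow_eq_neg_one (one_ne_neg_one_of_algebra hp) (by
      rw [hfac]
      exact Nat.mul_dvd_mul (even_iff_two_dvd.mp hodd.add_one) dvd_rfl)] at h1
    simp only [nsmul_eq_mul, mul_one] at h1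
    zify
    rw [h1]
    push_cast [show 1 ≤ s by omega]
    ring
  have hadd : ∀ u v : F, u ∈ K → v ∈ K → u + v ∈ K := by
    intro u v hu hv
    simp only [hK, mem_filter, mem_univ, true_and, one_mul] at hu hv ⊢
    rw [hs, add_pow_char_pow, ← hs, hu, hv]
  have hneg : ∀ u : F, u ∈ K → -u ∈ K := by
    intro u hu
    simp only [hK, mem_filter, mem_univ, true_and, one_mul] at hu ⊢
    rw [hodd.neg_pow, hu]
  -- L is the annihilator of the subfield K. The sum over K is s on L and 0 off it.
  set L : Finset F := {c : F | ∀ u ∈ K, Algebra.trace (ZMod p) F (c * u) = 0} with hL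
  have hsum : ∀ c : F, ∑ u ∈ K, (ZMod.stdAddChar (Algebra.trace (ZMod p) F (c * u)) : ℂ) =
      if c ∈ L then (s : ℂ) else 0 := by
    intro c
    split_ifs with h
    · simp only [hL, mem_filter, mem_univ, true_and] at h
      rw [sum_congr rfl fun u hu => by rw [h u hu, AddChar.map_zero_eq_one], sum_const, hcardK]
      simp
    · simp only [hL, mem_filter, mem_univ, true_and, not_forall] at h
      obtain ⟨v, hv, hne⟩ := h
      set A := ∑ u ∈ K, (ZMod.stdAddChar (Algebra.trace (ZMod p) F (c * u)) : ℂ) with hA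
      have h1 : ZMod.stdAddChar (Algebra.trace (ZMod p) F (c * v)) * A = A := by
        rw [hA, mul_sum]
        refine sum_bij (fun u _ => v + u) (fun u hu => hadd _ _ hv hu)
          (fun _ _ _ _ h => add_left_cancel h)
          (fun u hu => ⟨-v + u, hadd _ _ (hneg _ hv) hu, by ring⟩) fun u _ => ?_
        rw [← AddChar.map_add_eq_mul, ← map_add, mul_add]
      have h2 : (ZMod.stdAddChar (Algebra.trace (ZMod p) F (c * v)) : ℂ) ≠ 1 := fun h =>
        hne (ZMod.injective_stdAddChar (by rw [h, AddChar.map_zero_eq_one]))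
      by_contra hA0
      exact h2 (mul_right_cancel₀ hA0 (by rw [h1, one_mul]))
  -- Summing over all c in both orders gives |L|·s = q = s².
  have hcardLK : #L = s := by
    have h1 : ∑ c : F, ∑ u ∈ K, (ZMod.stdAddChar (Algebra.trace (ZMod p) F (c * u)) : ℂ) =
        (s : ℂ) ^ 2 := by
      rw [sum_comm]
      simp only [mul_comm _ (_ : F), sum_stdAddChar_trace]
      rw [sum_ite_eq' K 0, if_pos, hF]
      · push_cast; rfl
      · simp [hK, zero_pow (by omega : s ≠ 0)]
    simp only [hsum] at h1
    rw [← sum_filter, sum_const, filter_mem_eq_inter, univ_inter, nsmul_eq_mul, pow_two] at h1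
    have hs0 : (s : ℂ) ≠ 0 := Nat.cast_ne_zero.mpr (by omega)
    exact_mod_cast mul_right_cancel₀ hs0 h1
  -- Frobenius invariance: Tr(cu) = Tr((cu)^s) = -Tr(cu). Equality of the two sets then follows from
  -- their cardinalities.
  have hsub : ({c : F | c ^ s = -1 * c} : Finset F) ⊆ L := by
    intro c hc
    simp only [hL, mem_filter, mem_univ, true_and] at hc ⊢
    intro u hu
    simp only [hK, mem_filter, mem_univ, true_and, one_mul] at hu
    have h1 := trace_pow_prime_pow (p := p) m (c * u)
    rw [← hs, mul_pow, hc, hu, neg_one_mul, neg_mul, map_neg] at h1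
    have hchar : ringChar (ZMod p) ≠ 2 := by rwa [ZMod.ringChar_zmod_n]
    exact (Ring.eq_self_iff_eq_zero_of_char_ne_two hchar).mp h1
  have heq : ({c : F | c ^ s = -1 * c} : Finset F) = L :=
    eq_of_subset_of_card_le hsub (by rw [hcardL, hcardLK])
  rw [hsum, ← heq]
  simp

/-- Exponential sums of functions invariant under the multiplicative group of the subfield of
`s` elements, in a field of `s ^ 2` elements. -/
theorem sum_invariant_mul_stdAddChar (hp : p ≠ 2) (hm : 1 ≤ m)
    (hF : Fintype.card F = (p ^ m) ^ 2) (g : F → ℂ)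
    (hg : ∀ u y : F, u ^ (p ^ m - 1) = 1 → g (u * y) = g y) {b : F} (hb : b ^ (p ^ m - 1) = -1)
    {d : F} (hd : d ≠ 0) :
    ((p : ℂ) ^ m - 1) * ∑ y : F, g y * ZMod.stdAddChar (Algebra.trace (ZMod p) F (d * y)) =
      (p : ℂ) ^ m * g 0 + (p : ℂ) ^ m * ((p : ℂ) ^ m - 1) * g (b / d) - ∑ y : F, g y := by
  have hprime : p.Prime := Fact.out
  set s := p ^ m with hs
  have hs3 : 3 ≤ s := by
    have h1 : 3 ≤ p := by have := hprime.two_le; omega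
    exact h1.trans (Nat.le_self_pow (by omega) p)
  have hsC : (p : ℂ) ^ m = (s : ℂ) := by rw [hs]; push_cast; rfl
  have hodd : Odd s := (hprime.odd_of_ne_two hp).pow
  have hfac : Fintype.card F - 1 = (s + 1) * (s - 1) := by
    rw [hF, ← Nat.sq_sub_sq, one_pow]
  have hcardU : #{u : F | u ^ (s - 1) = 1} = s - 1 :=
    card_pow_eq_one (by rw [hfac]; exact Dvd.intro_left _ rfl)
  have hcardV : #{u : F | u ^ (s - 1) = -1} = s - 1 :=
    card_pow_eq_neg_one (one_ne_neg_one_of_algebra hp) (by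
      rw [hfac]
      exact Nat.mul_dvd_mul (even_iff_two_dvd.mp hodd.add_one) dvd_rfl)
  have hs1 : ((s - 1 : ℕ) : ℂ) = (s : ℂ) - 1 := by push_cast [show 1 ≤ s by omega]; rfl
  have hpow0 : (0 : F) ^ (s - 1) = 0 := zero_pow (by omega)
  have hb0 : b ≠ 0 := by
    rintro rfl
    rw [hpow0] at hb
    exact neg_ne_zero.mpr one_ne_zero hb.symm
  -- Invariance of g permits averaging the character over the unit group of the subfield.
  have hU : ∀ u : F, u ^ (s - 1) = 1 →
      ∑ y : F, g y * ZMod.stdAddChar (Algebra.trace (ZMod p) F (d * y)) =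
      ∑ y : F, g y * ZMod.stdAddChar (Algebra.trace (ZMod p) F (d * y * u)) := by
    intro u hu
    have hu0 : u ≠ 0 := by
      rintro rfl
      rw [hpow0] at hu
      exact zero_ne_one hu
    symm
    refine Fintype.sum_bijective (fun y => u * y) (mulLeft_bijective₀ u hu0) _ _ fun y => ?_
    rw [hg u y hu, mul_left_comm, mul_comm u]
  have hinner : ∀ c : F,
      ∑ u : F with u ^ (s - 1) = 1, (ZMod.stdAddChar (Algebra.trace (ZMod p) F (c * u)) : ℂ) =
        (if c ^ s = -1 * c then (s : ℂ) else 0) - 1 := by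
    intro c
    rw [← sum_subfield_stdAddChar hp hm hF c, ← hs,
      sum_pow_eq_mul_self (by omega : 2 ≤ s) one_ne_zero]
    simp
  have h1 : ((s : ℂ) - 1) * ∑ y : F, g y * ZMod.stdAddChar (Algebra.trace (ZMod p) F (d * y)) =
      ∑ y : F, g y * ((if (d * y) ^ s = -1 * (d * y) then (s : ℂ) else 0) - 1) := by
    simp only [← hinner, mul_sum (s := filter _ _)]
    rw [sum_comm, sum_congr rfl fun u hu => (hU u (mem_filter.mp hu).2).symm, sum_const, hcardU,
      nsmul_eq_mul, hs1]
  -- The points with (dy)^s = -dy are 0 and the s - 1 elements of the coset of b/d, on which g is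
  -- constant.
  have h2 : ∑ y : F, g y * (if (d * y) ^ s = -1 * (d * y) then (s : ℂ) else 0) =
      s * g 0 + s * (s - 1) * g (b / d) := by
    have h3 : ∑ y : F, g y * (if (d * y) ^ s = -1 * (d * y) then (s : ℂ) else 0) =
        ∑ y : F with y ^ s = -1 * y, s * g (y / d) := by
      rw [sum_filter]
      refine Fintype.sum_bijective (fun y => d * y) (mulLeft_bijective₀ d hd) _ _ fun y => ?_
      rw [mul_div_cancel_left₀ y hd, mul_ite, mul_zero, mul_comm (g y)]
    rw [h3, sum_pow_eq_mul_self (by omega : 2 ≤ s) (neg_ne_zero.mpr one_ne_zero), zero_div]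
    congr 1
    rw [sum_congr rfl (g := fun _ => s * g (b / d)) (fun y hy => ?_), sum_const, hcardV,
      nsmul_eq_mul, hs1]
    · ring
    · have hy1 : y ^ (s - 1) = -1 := (mem_filter.mp hy).2
      have h4 : (y / b) ^ (s - 1) = 1 := by rw [div_pow, hy1, hb, neg_div_neg_eq, div_one]
      rw [← hg (y / b) (b / d) h4]
      congr 2
      field_simp
  rw [hsC, h1]
  simp only [mul_sub, mul_one, sum_sub_distrib, h2]

end Semiprimitive

/-! ### Arithmetic of the primitive root p modulo ℓ^k -/

section PrimitiveRoot

/-- All powers of the odd p are 1 modulo 2, so the modulus 2 does not affect the order. -/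
theorem orderOf_natCast_prime_pow {p ℓ k : ℕ} (hp : Odd p) (hℓ : Odd ℓ)
    (hprim : orderOf (p : ZMod (2 * ℓ ^ k)) = Nat.totient (ℓ ^ k)) :
    orderOf (p : ZMod (ℓ ^ k)) = Nat.totient (ℓ ^ k) := by
  have hiff : ∀ n : ℕ, (p : ZMod (ℓ ^ k)) ^ n = 1 ↔ (p : ZMod (2 * ℓ ^ k)) ^ n = 1 := by
    intro n
    have hcop : Nat.Coprime 2 (ℓ ^ k) := (Nat.coprime_two_left.mpr hℓ).pow_right k
    have h2 : p ^ n ≡ 1 [MOD 2] := Nat.odd_iff.mp hp.pow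
    have h1 : ∀ r : ℕ, (p : ZMod r) ^ n = 1 ↔ p ^ n ≡ 1 [MOD r] := by
      intro r
      rw [← ZMod.natCast_eq_natCast_iff]
      push_cast
      rfl
    rw [h1, h1, ← Nat.modEq_and_modEq_iff_modEq_mul hcop]
    exact ⟨fun h => ⟨h2, h⟩, fun h => h.2⟩
  rw [← hprim]
  exact orderOf_eq_orderOf_iff.mpr hiff

theorem even_totient_prime_pow {ℓ k : ℕ} (hℓ : ℓ.Prime) (hℓ2 : ℓ ≠ 2) (hk : 1 ≤ k) :
    Even (Nat.totient (ℓ ^ k)) := by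
  apply Nat.totient_even
  have h1 := hℓ.two_le
  have h2 : ℓ ≤ ℓ ^ k := Nat.le_self_pow (by omega) ℓ
  omega

/-- With m half the order of p, ℓ^k divides (p^m - 1)(p^m + 1). The odd prime ℓ cannot divide both
factors, and ℓ^k does not divide the first by the definition of the order. -/
theorem two_mul_prime_pow_dvd {p ℓ k : ℕ} (hp : Odd p) (hℓ : ℓ.Prime) (hℓ2 : ℓ ≠ 2) (hk : 1 ≤ k)
    (hord : orderOf (p : ZMod (ℓ ^ k)) = Nat.totient (ℓ ^ k)) :
    2 * ℓ ^ k ∣ p ^ (Nat.totient (ℓ ^ k) / 2) + 1 := by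
  obtain ⟨m, hm⟩ := (even_totient_prime_pow hℓ hℓ2 hk).two_dvd
  have hpos : 0 < Nat.totient (ℓ ^ k) := Nat.totient_pos.mpr (pow_pos hℓ.pos _)
  rw [hm, Nat.mul_div_cancel_left m two_pos]
  have hs : Odd (p ^ m) := hp.pow
  have hcop : Nat.Coprime 2 (ℓ ^ k) :=
    ((Nat.coprime_primes Nat.prime_two hℓ).mpr hℓ2.symm).pow_right k
  refine hcop.mul_dvd_of_dvd_of_dvd (even_iff_two_dvd.mp hs.add_one) ?_
  have hℓz : Prime (ℓ : ℤ) := Nat.prime_iff_prime_int.mp hℓ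
  have h1 : ((ℓ : ℤ) ^ k) ∣ ((p : ℤ) ^ m - 1) * ((p : ℤ) ^ m + 1) := by
    have h2 : (p : ZMod (ℓ ^ k)) ^ (2 * m) = 1 := by
      rw [← hm, ← hord, pow_orderOf_eq_one]
    have h3 : (((p : ℤ) ^ (2 * m) - 1 : ℤ) : ZMod (ℓ ^ k)) = 0 := by
      push_cast
      rw [h2, sub_self]
    rw [ZMod.intCast_zmod_eq_zero_iff_dvd] at h3
    have h4 : ((p : ℤ) ^ m - 1) * ((p : ℤ) ^ m + 1) = (p : ℤ) ^ (2 * m) - 1 := by ring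
    rw [h4]
    exact_mod_cast h3
  have hnot : ¬ (ℓ : ℤ) ^ k ∣ (p : ℤ) ^ m - 1 := by
    intro h
    have h2 : (p : ZMod (ℓ ^ k)) ^ m = 1 := by
      have h3 : (((p : ℤ) ^ m - 1 : ℤ) : ZMod (ℓ ^ k)) = 0 := by
        rw [ZMod.intCast_zmod_eq_zero_iff_dvd]
        exact_mod_cast h
      push_cast at h3
      exact sub_eq_zero.mp h3
    have h3 := Nat.le_of_dvd (by omega) (orderOf_dvd_of_pow_eq_one h2)
    omega
  have h5 : (ℓ : ℤ) ^ k ∣ (p : ℤ) ^ m + 1 := by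
    by_cases h6 : (ℓ : ℤ) ∣ (p : ℤ) ^ m - 1
    · have h7 : ¬ (ℓ : ℤ) ∣ (p : ℤ) ^ m + 1 := by
        intro h8
        have h9 : (ℓ : ℤ) ∣ 2 := by
          have := dvd_sub h8 h6
          ring_nf at this
          exact this
        have h10 : ℓ ∣ 2 := by exact_mod_cast h9
        exact hℓ2 ((Nat.prime_dvd_prime_iff_eq hℓ Nat.prime_two).mp h10)
      exact absurd (hℓz.pow_dvd_of_dvd_mul_right k h7 h1) hnot
    · exact hℓz.pow_dvd_of_dvd_mul_left k h6 h1
  exact_mod_cast h5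

/-- The powers below the order are distinct units, and there are as many as units. -/
theorem image_pow_mod {p ℓ k : ℕ} (hℓ : ℓ.Prime) (hpℓ : Nat.Coprime p ℓ)
    (hord : orderOf (p : ZMod (ℓ ^ k)) = Nat.totient (ℓ ^ k)) :
    (range (Nat.totient (ℓ ^ k))).image (fun i => p ^ i % ℓ ^ k) =
      {j ∈ range (ℓ ^ k) | (ℓ ^ k).Coprime j} := by
  refine eq_of_subset_of_card_le (fun j hj => ?_) ?_
  · obtain ⟨i, -, rfl⟩ := mem_image.mp hj
    rw [mem_filter, mem_range]
    refine ⟨Nat.mod_lt _ (pow_pos hℓ.pos _), ?_⟩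
    rw [Nat.coprime_comm, Nat.Coprime, ← Nat.gcd_rec, Nat.gcd_comm]
    exact (hpℓ.pow i k)
  · rw [card_image_of_injOn, card_range]
    · exact le_of_eq rfl
    · intro i hi j hj hij
      rw [mem_coe, mem_range, ← hord] at hi hj
      have h1 : (p : ZMod (ℓ ^ k)) ^ i = (p : ZMod (ℓ ^ k)) ^ j := by
        have := (ZMod.natCast_eq_natCast_iff _ _ _).mpr hij
        exact_mod_cast this
      exact pow_injOn_Iio_orderOf hi hj h1

theorem filter_coprime_prime_pow {ℓ k : ℕ} (hℓ : ℓ.Prime) (hk : 1 ≤ k) {M : Type*} [AddCommGroup M]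
    (g : ℕ → M) :
    ∑ j ∈ range (ℓ ^ k) with (ℓ ^ k).Coprime j, g j =
      ∑ j ∈ range (ℓ ^ k), g j - ∑ j ∈ range (ℓ ^ (k - 1)), g (ℓ * j) := by
  have h1 := sum_filter_add_sum_filter_not (range (ℓ ^ k)) (fun j => (ℓ ^ k).Coprime j) g
  rw [eq_sub_iff_add_eq, ← h1]
  congr 1
  have hpow : ℓ ^ k = ℓ * ℓ ^ (k - 1) := by rw [← pow_succ', Nat.sub_add_cancel hk]
  refine sum_bij (fun j _ => ℓ * j) (fun j hj => ?_) (fun i _ j _ h => ?_) (fun j hj => ?_)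
    fun _ _ => rfl
  · rw [mem_range] at hj
    rw [mem_filter, mem_range, Nat.coprime_pow_left_iff (by omega), hℓ.coprime_iff_not_dvd]
    exact ⟨by rw [hpow]; exact Nat.mul_lt_mul_of_pos_left hj hℓ.pos, by simp⟩
  · exact Nat.eq_of_mul_eq_mul_left hℓ.pos h
  · rw [mem_filter, mem_range, Nat.coprime_pow_left_iff (by omega), hℓ.coprime_iff_not_dvd,
      not_not] at hj
    obtain ⟨hj1, i, rfl⟩ := hj
    exact ⟨i, mem_range.mpr (by rw [hpow] at hj1; exact Nat.lt_of_mul_lt_mul_left hj1), rfl⟩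

end PrimitiveRoot

/-! ### Values of Tr(y^N) -/

section Trace

variable {p ℓ k : ℕ} [Fact p.Prime] {F : Type*} [Field F] [Fintype F] [Algebra (ZMod p) F]

theorem finrank_eq_of_card {e : ℕ} (hF : Fintype.card F = p ^ e) :
    Module.finrank (ZMod p) F = e := by
  have h := Module.card_eq_pow_finrank (K := ZMod p) (V := F)
  rw [ZMod.card, hF] at h
  exact (Nat.pow_right_injective (Fact.out : p.Prime).two_le h).symm

/-- The trace of a nontrivial `ℓ ^ k`-th root of unity. -/
theorem trace_root_of_unity [DecidableEq F] (hℓ : ℓ.Prime) (hk : 1 ≤ k) (hpℓ : p ≠ ℓ)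
    (hord : orderOf (p : ZMod (ℓ ^ k)) = Nat.totient (ℓ ^ k))
    (hF : Fintype.card F = p ^ Nat.totient (ℓ ^ k)) {w : F} (hw : w ^ ℓ ^ k = 1) (hw1 : w ≠ 1) :
    Algebra.trace (ZMod p) F w = if w ^ ℓ = 1 then -(ℓ : ZMod p) ^ (k - 1) else 0 := by
  have hprime : p.Prime := Fact.out
  have hcop : Nat.Coprime p ℓ := (Nat.coprime_primes hprime hℓ).mpr hpℓ
  have hgeom : ∀ (v : F) (n : ℕ), v ^ n = 1 → v ≠ 1 → ∑ j ∈ range n, v ^ j = 0 := by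
    intro v n hv hv1
    rw [geom_sum_eq hv1, hv, sub_self, zero_div]
  apply (algebraMap (ZMod p) F).injective
  rw [FiniteField.algebraMap_trace_eq_sum_pow, finrank_eq_of_card hF, Nat.card_zmod]
  -- The Frobenius conjugates of w are its powers with exponent prime to ℓ, so the trace is a
  -- Ramanujan sum: all exponents minus the multiples of ℓ.
  have h1 : ∑ i ∈ range (Nat.totient (ℓ ^ k)), w ^ p ^ i =
      ∑ j ∈ range (ℓ ^ k) with (ℓ ^ k).Coprime j, w ^ j := by
    rw [← image_pow_mod hℓ hcop hord, sum_image]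
    · refine sum_congr rfl fun i _ => ?_
      conv_lhs => rw [← Nat.mod_add_div (p ^ i) (ℓ ^ k)]
      rw [pow_add, pow_mul, hw, one_pow, mul_one]
    · intro i hi j hj hij
      rw [mem_coe, mem_range, ← hord] at hi hj
      have h1 : (p : ZMod (ℓ ^ k)) ^ i = (p : ZMod (ℓ ^ k)) ^ j := by
        have := (ZMod.natCast_eq_natCast_iff _ _ _).mpr hij
        exact_mod_cast this
      exact pow_injOn_Iio_orderOf hi hj h1
  rw [h1, filter_coprime_prime_pow hℓ hk, hgeom w _ hw hw1, zero_sub]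
  simp only [pow_mul]
  split_ifs with h
  · simp [h]
  · rw [hgeom _ _ _ h, neg_zero, map_zero]
    rw [← pow_mul, ← pow_succ', Nat.sub_add_cancel hk, hw]

/-- The sum over `y ≠ 0` of a function of `Tr (y ^ N)`, where `N = (q - 1) / (2 ℓ ^ k)`. -/
theorem sum_trace_pow [DecidableEq F] (hp : p ≠ 2) (hℓ : ℓ.Prime) (hℓ2 : ℓ ≠ 2) (hk : 1 ≤ k)
    (hpℓ : p ≠ ℓ) (hord : orderOf (p : ZMod (ℓ ^ k)) = Nat.totient (ℓ ^ k))
    (hF : Fintype.card F = p ^ Nat.totient (ℓ ^ k)) {N : ℕ}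
    (hN : Fintype.card F - 1 = N * (2 * ℓ ^ k)) (g : ZMod p → ℤ) :
    ∑ y : F with y ≠ 0, g (Algebra.trace (ZMod p) F (y ^ N)) =
      N * (g (Nat.totient (ℓ ^ k)) + g (-Nat.totient (ℓ ^ k)) +
        (ℓ - 1) * (g ((ℓ : ZMod p) ^ (k - 1)) + g (-(ℓ : ZMod p) ^ (k - 1))) +
        (2 * ℓ ^ k - 2 * ℓ) * g 0) := by
  have hprime : p.Prime := Fact.out
  have h1F : (1 : F) ≠ -1 := one_ne_neg_one_of_algebra hp
  have hℓodd : Odd ℓ := hℓ.odd_of_ne_two hℓ2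
  have hcardpos : 0 < Fintype.card F - 1 := Nat.sub_pos_of_lt Fintype.one_lt_card
  have hN0 : N ≠ 0 := by
    rintro rfl
    omega
  have hpow : ℓ ^ k = ℓ * ℓ ^ (k - 1) := by rw [← pow_succ', Nat.sub_add_cancel hk]
  set tr : F → ZMod p := fun y => Algebra.trace (ZMod p) F y with htr
  have hone : tr 1 = Nat.totient (ℓ ^ k) := by
    have := Algebra.trace_algebraMap (R := ZMod p) (S := F) 1
    rw [map_one, finrank_eq_of_card hF] at this
    simpa using this
  have htrneg : ∀ y, tr (-y) = -tr y := fun y => map_neg _ y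
  -- Subtracting g 0 leaves a function supported on (y^N)^ℓ = ±1, since the traces of all other
  -- values y^N vanish.
  set h : F → ℤ := fun y => g (tr (y ^ N)) - g 0 with hh
  have hA : ∀ y : F, y ^ N = 1 → h y = g (Nat.totient (ℓ ^ k)) - g 0 := by
    intro y hy
    simp only [hh, hy, hone]
  have hA' : ∀ y : F, y ^ N = -1 → h y = g (-Nat.totient (ℓ ^ k)) - g 0 := by
    intro y hy
    simp only [hh, hy, htrneg, hone]
  have hBtr : ∀ w : F, w ^ ℓ = 1 → w ≠ 1 → tr w = -(ℓ : ZMod p) ^ (k - 1) := by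
    intro w hw hw1
    have := trace_root_of_unity hℓ hk hpℓ hord hF (w := w) (by rw [hpow, pow_mul, hw, one_pow]) hw1
    rwa [if_pos hw] at this
  have hB : ∀ y : F, y ^ (N * ℓ) = 1 → y ^ N ≠ 1 → h y = g (-(ℓ : ZMod p) ^ (k - 1)) - g 0 := by
    intro y hy hy1
    simp only [hh]
    rw [hBtr _ (by rw [← pow_mul, hy]) hy1]
  have hB' : ∀ y : F, y ^ (N * ℓ) = -1 → y ^ N ≠ -1 → h y = g ((ℓ : ZMod p) ^ (k - 1)) - g 0 := by
    intro y hy hy1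
    simp only [hh]
    have := hBtr (-y ^ N) (by rw [hℓodd.neg_pow, ← pow_mul, hy, neg_neg])
      (fun h => hy1 (by rw [← h, neg_neg]))
    rw [htrneg, neg_inj] at this
    rw [this]
  have hC : ∀ y : F, y ≠ 0 → y ^ (N * ℓ) ≠ 1 → y ^ (N * ℓ) ≠ -1 → h y = 0 := by
    intro y hy hy1 hy2
    simp only [hh]
    rw [sub_eq_zero]
    congr 1
    have h2 : (y ^ N) ^ ℓ ^ k = 1 ∨ (y ^ N) ^ ℓ ^ k = -1 := by
      rw [← sq_eq_one_iff, ← pow_mul, ← pow_mul, mul_comm (ℓ ^ k), mul_comm N, mul_assoc,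
        mul_comm _ N, mul_left_comm, ← hN]
      exact FiniteField.pow_card_sub_one_eq_one y hy
    rcases h2 with h2 | h2
    · have h3 := trace_root_of_unity hℓ hk hpℓ hord hF h2
        (fun h3 => hy1 (by rw [pow_mul, h3, one_pow]))
      rwa [if_neg (by rwa [← pow_mul])] at h3
    · have h3 := trace_root_of_unity hℓ hk hpℓ hord hF (w := -y ^ N)
        (by rw [(hℓodd.pow).neg_pow, h2, neg_neg])
        (fun h3 => hy2 (by rw [pow_mul, neg_eq_iff_eq_neg.mp h3, hℓodd.neg_one_pow]))
      rw [if_neg (by rwa [hℓodd.neg_pow, ← pow_mul, neg_eq_iff_eq_neg])] at h3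
      exact neg_eq_zero.mp ((htrneg _).symm.trans h3)
  have hdvd1 : N ∣ Fintype.card F - 1 := by rw [hN]; exact Dvd.intro _ rfl
  have hdvd2 : 2 * N ∣ Fintype.card F - 1 := by
    rw [hN, mul_comm 2]; exact Nat.mul_dvd_mul dvd_rfl (Dvd.intro _ rfl)
  have hdvd3 : 2 * (N * ℓ) ∣ Fintype.card F - 1 := by
    rw [hN, hpow]; exact ⟨ℓ ^ (k - 1), by ring⟩
  have hdvd4 : N * ℓ ∣ Fintype.card F - 1 := (Dvd.intro_left 2 rfl).trans hdvd3
  -- For c = ±1, N of the Nℓ solutions have y^N = c; for the others y^N is c times a primitive ℓ-th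
  -- root of unity.
  have hcount : ∀ (c : F) (a b : ℤ), #{y : F | y ^ (N * ℓ) = c} = N * ℓ →
      #{y : F | y ^ N = c} = N → (∀ y : F, y ^ N = c → y ^ (N * ℓ) = c) →
      (∀ y : F, y ^ N = c → h y = a) → (∀ y : F, y ^ (N * ℓ) = c → y ^ N ≠ c → h y = b) →
      ∑ y : F with y ^ (N * ℓ) = c, h y = N * a + (N * ℓ - N) * b := by
    intro c a b hc1 hc2 himp ha hb
    rw [← sum_filter_add_sum_filter_not _ (fun y : F => y ^ N = c)]
    have e1 : ({y ∈ ({y : F | y ^ (N * ℓ) = c} : Finset F) | y ^ N = c} : Finset F) =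
        ({y : F | y ^ N = c} : Finset F) := by
      ext y
      simp only [mem_filter, mem_univ, true_and, and_iff_right_iff_imp]
      exact himp y
    have e2 : #{y ∈ ({y : F | y ^ (N * ℓ) = c} : Finset F) | ¬ y ^ N = c} + N = N * ℓ := by
      have := card_filter_add_card_filter_not (s := ({y : F | y ^ (N * ℓ) = c} : Finset F))
        (fun y : F => y ^ N = c)
      rw [e1, hc1, hc2] at this
      omega
    rw [e1, sum_congr rfl fun y hy => ha y (mem_filter.mp hy).2, sum_const, hc2,
      sum_congr rfl (g := fun _ => b) fun y hy => hb y (mem_filter.mp (mem_filter.mp hy).1).2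
        (mem_filter.mp hy).2, sum_const]
    zify at e2
    rw [nsmul_eq_mul, nsmul_eq_mul, ← e2]
    ring
  have hsum : ∑ y : F with y ≠ 0, h y =
      ∑ y : F with y ^ (N * ℓ) = 1, h y + ∑ y : F with y ^ (N * ℓ) = -1, h y := by
    rw [← sum_union]
    · symm
      refine sum_subset (fun y hy => ?_) fun y hy hy' => ?_
      · have hNℓ : N * ℓ ≠ 0 := mul_ne_zero hN0 hℓ.ne_zero
        simp only [mem_union, mem_filter, mem_univ, true_and] at hy ⊢
        rintro rfl
        rw [zero_pow hNℓ] at hy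
        simp at hy
      · simp only [mem_union, mem_filter, mem_univ, true_and, not_or] at hy hy'
        exact hC y hy hy'.1 hy'.2
    · rw [disjoint_filter]
      intro y _ h h'
      exact h1F (h.symm.trans h')
  have hcard : #{y : F | y ≠ 0} = N * (2 * ℓ ^ k) := by
    rw [filter_ne', card_erase_of_mem (mem_univ _), card_univ, hN]
  have htotal : ∑ y : F with y ≠ 0, g (tr (y ^ N)) =
      ∑ y : F with y ≠ 0, h y + N * (2 * ℓ ^ k) * g 0 := by
    simp only [hh, sum_sub_distrib, sum_const, hcard, nsmul_eq_mul]
    push_cast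
    ring
  rw [htotal, hsum,
    hcount 1 _ _ (card_pow_eq_one hdvd4) (card_pow_eq_one hdvd1)
      (fun y hy => by rw [pow_mul, hy, one_pow]) hA hB,
    hcount (-1) _ _ (card_pow_eq_neg_one h1F hdvd3)
      (card_pow_eq_neg_one h1F hdvd2)
      (fun y hy => by rw [pow_mul, hy, hℓodd.neg_one_pow]) hA' hB']
  ring

end Trace

/-! ### Zeros of f(x) + T(y), on the whole plane and on hyperplanes -/

section Counting

variable {p : ℕ} [Fact p.Prime]

/-- The value of `∑ z ≠ 0, ζ_p ^ (z t)`. -/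
def ramanujanSum {p : ℕ} (t : ZMod p) : ℤ := if t = 0 then (p : ℤ) - 1 else -1

/-- The value of `∑ z ≠ 0, ∑ w, ζ_p ^ (w ^ 2 a / z + z t)`. -/
noncomputable def quadraticSum (a t : ZMod p) : ℤ :=
  if a = 0 then p * ramanujanSum t else p * quadraticChar (ZMod p) (-(a * t))

theorem sum_ne_zero_stdAddChar (t : ZMod p) :
    ∑ z : ZMod p with z ≠ 0, (ZMod.stdAddChar (z * t) : ℂ) = ramanujanSum t := by
  rw [filter_ne', ← add_left_inj (ZMod.stdAddChar ((0 : ZMod p) * t) : ℂ),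
    sum_erase_add _ _ (mem_univ _), sum_stdAddChar_mul, ramanujanSum]
  split_ifs <;> simp

/-- For a ≠ 0 the equation w²a = -t has 1 + η(-at) solutions. -/
theorem sum_ramanujanSum_quadratic (hp : p ≠ 2) (a t : ZMod p) :
    ∑ w : ZMod p, ramanujanSum (w ^ 2 * a + t) = quadraticSum a t := by
  have h1 : ∀ u : ZMod p, ramanujanSum u = (if u = 0 then (p : ℤ) else 0) - 1 := by
    intro u
    rw [ramanujanSum]
    split_ifs <;> simp
  rcases eq_or_ne a 0 with rfl | ha
  · simp [quadraticSum, ZMod.card]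
  rw [quadraticSum, if_neg ha]
  simp only [h1, sum_sub_distrib, ← sum_filter, sum_const, card_univ, ZMod.card]
  have hchar : ringChar (ZMod p) ≠ 2 := by rwa [ZMod.ringChar_zmod_n]
  have h2 := quadraticChar_card_sqrts hchar (-(a * t) * a⁻¹ ^ 2)
  have h3 : quadraticChar (ZMod p) (-(a * t) * a⁻¹ ^ 2) = quadraticChar (ZMod p) (-(a * t)) := by
    rw [map_mul, quadraticChar_sq_one' (inv_ne_zero ha), mul_one]
  have h4 : ({w : ZMod p | w ^ 2 * a + t = 0} : Finset (ZMod p)) =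
      {x : ZMod p | x ^ 2 = -(a * t) * a⁻¹ ^ 2}.toFinset := by
    ext w
    simp only [mem_filter, mem_univ, true_and, Set.mem_toFinset, Set.mem_ofPred_eq]
    have h5 : -(a * t) * a⁻¹ ^ 2 = -t / a := by field_simp
    rw [h5, eq_div_iff ha, eq_neg_iff_add_eq_zero]
  rw [h4, nsmul_eq_mul, h2, h3]
  simp only [nsmul_eq_mul, mul_one]
  ring

/-- Replacing w by zw turns z⁻¹w²a into zw²a, so the sum over z becomes a Ramanujan sum at w²a + t.
-/
theorem sum_quadraticSum (hp : p ≠ 2) (a t : ZMod p) :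
    ∑ z : ZMod p with z ≠ 0, ∑ w : ZMod p, (ZMod.stdAddChar (z⁻¹ * (w ^ 2 * a) + z * t) : ℂ) =
      quadraticSum a t := by
  rw [← sum_ramanujanSum_quadratic hp]
  push_cast
  simp only [← sum_ne_zero_stdAddChar]
  rw [sum_comm (s := univ)]
  refine sum_congr rfl fun z hz => ?_
  have hz0 : z ≠ 0 := (mem_filter.mp hz).2
  symm
  refine Fintype.sum_bijective (fun w => z * w) (mulLeft_bijective₀ z hz0) _ _ fun w => ?_
  congr 1
  field_simp

variable {F : Type*} [Field F] [Fintype F] [Algebra (ZMod p) F] {f fs T : F → ZMod p} {E : ℤ}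

/-- The number of zeros of `f x + T y`. -/
theorem card_zeros
    (hW : ∀ t : ZMod p, t ≠ 0 → ∀ a : F,
      ∑ x : F, (ZMod.stdAddChar (t * f x - Algebra.trace (ZMod p) F (a * x)) : ℂ) =
        E * ZMod.stdAddChar (t⁻¹ * fs a)) (h0 : fs 0 = 0) :
    (p : ℤ) * #{z : F × F | f z.1 + T z.2 = 0} =
      Fintype.card F ^ 2 + E * ∑ y, ramanujanSum (T y) := by
  have h1 : ∀ t : ZMod p, t ≠ 0 → ∑ z : F × F, (ZMod.stdAddChar (t * (f z.1 + T z.2)) : ℂ) =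
      E * ∑ y, ZMod.stdAddChar (t * T y) := by
    intro t ht
    have h2 := hW t ht 0
    simp only [zero_mul, map_zero, sub_zero, h0, mul_zero, AddChar.map_zero_eq_one, mul_one] at h2
    rw [← h2, sum_mul_sum, Fintype.sum_prod_type]
    simp only [mul_add, AddChar.map_add_eq_mul]
  have h3 : ∑ t : ZMod p, ∑ z : F × F, (ZMod.stdAddChar (t * (f z.1 + T z.2)) : ℂ) =
      (p : ℂ) * #{z : F × F | f z.1 + T z.2 = 0} := by
    rw [sum_comm]
    simp only [sum_stdAddChar_mul, ← sum_filter, sum_const, nsmul_eq_mul, mul_comm]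
  rw [← sum_erase_add _ _ (mem_univ (0 : ZMod p)), ← filter_ne',
    sum_congr rfl fun t ht => h1 t (mem_filter.mp ht).2, ← mul_sum, sum_comm] at h3
  simp only [sum_ne_zero_stdAddChar, zero_mul, AddChar.map_zero_eq_one, sum_const, card_univ,
    Fintype.card_prod, nsmul_eq_mul, mul_one] at h3
  have h4 : (((p : ℤ) * #{z : F × F | f z.1 + T z.2 = 0} : ℤ) : ℂ) =
      (Fintype.card F ^ 2 + E * ∑ y, ramanujanSum (T y) : ℤ) := by
    push_cast at h3 ⊢
    rw [← h3]
    ring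
  exact_mod_cast h4

variable [DecidableEq F]

theorem sum_trace_pair (g : F × F) :
    ∑ z : F × F, (ZMod.stdAddChar (-Algebra.trace (ZMod p) F (g.1 * z.1 + g.2 * z.2)) : ℂ) =
      if g = 0 then (Fintype.card F : ℂ) ^ 2 else 0 := by
  have h1 : ∀ z : F × F,
      (ZMod.stdAddChar (-Algebra.trace (ZMod p) F (g.1 * z.1 + g.2 * z.2)) : ℂ) =
      ZMod.stdAddChar (Algebra.trace (ZMod p) F (-g.1 * z.1)) *
        ZMod.stdAddChar (Algebra.trace (ZMod p) F (-g.2 * z.2)) := by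
    intro z
    rw [← AddChar.map_add_eq_mul, ← map_add, ← map_neg]
    congr 2
    ring
  simp only [h1]
  rw [Fintype.sum_prod_type]
  simp only [← mul_sum, ← sum_mul, sum_stdAddChar_trace, neg_eq_zero, Prod.ext_iff, Prod.fst_zero,
    Prod.snd_zero]
  split_ifs <;> simp_all [pow_two]

/-- The number of zeros of `f x + T y` on a hyperplane, as a sum of one-variable sums. -/
theorem card_zeros_hyperplane_complex
    (hW : ∀ t : ZMod p, t ≠ 0 → ∀ a : F,
      ∑ x : F, (ZMod.stdAddChar (t * f x - Algebra.trace (ZMod p) F (a * x)) : ℂ) =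
        E * ZMod.stdAddChar (t⁻¹ * fs a))
    (hquad : ∀ (c : ZMod p) (x : F), fs (c • x) = c ^ 2 * fs x) {g : F × F} (hg : g ≠ 0) :
    (p : ℂ) ^ 2 * #{z : F × F | f z.1 + T z.2 = 0 ∧
        Algebra.trace (ZMod p) F (g.1 * z.1 + g.2 * z.2) = 0} =
      Fintype.card F ^ 2 + E * ∑ t : ZMod p with t ≠ 0, ∑ w : ZMod p,
        ZMod.stdAddChar (t⁻¹ * (w ^ 2 * fs g.1)) *
        ∑ y, ZMod.stdAddChar (t * T y - Algebra.trace (ZMod p) F (w • g.2 * y)) := by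
  have h1 : ∀ z : F × F, ∑ t : ZMod p, ∑ w : ZMod p,
      (ZMod.stdAddChar (t * (f z.1 + T z.2)) : ℂ) *
        ZMod.stdAddChar (w * -Algebra.trace (ZMod p) F (g.1 * z.1 + g.2 * z.2)) =
      if f z.1 + T z.2 = 0 ∧ Algebra.trace (ZMod p) F (g.1 * z.1 + g.2 * z.2) = 0
      then (p : ℂ) ^ 2 else 0 := by
    intro z
    rw [← sum_mul_sum, sum_stdAddChar_mul, sum_stdAddChar_mul]
    simp only [neg_eq_zero]
    split_ifs <;> simp_all [pow_two]
  have h2 : (p : ℂ) ^ 2 * #{z : F × F | f z.1 + T z.2 = 0 ∧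
        Algebra.trace (ZMod p) F (g.1 * z.1 + g.2 * z.2) = 0} =
      ∑ t : ZMod p, ∑ w : ZMod p, ∑ z : F × F, (ZMod.stdAddChar (t * (f z.1 + T z.2)) : ℂ) *
        ZMod.stdAddChar (w * -Algebra.trace (ZMod p) F (g.1 * z.1 + g.2 * z.2)) := by
    simp only [sum_comm (t := (univ : Finset (F × F)))]
    simp only [h1, ← sum_filter, sum_const, nsmul_eq_mul, mul_comm]
  rw [h2, ← sum_erase_add _ _ (mem_univ (0 : ZMod p)), ← filter_ne', add_comm]
  congr 1
  -- For t = 0 only w = 0 contributes, because the pair g is nonzero.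
  · rw [sum_eq_single (0 : ZMod p)]
    · simp [pow_two]
    · intro w _ hw
      have h3 := sum_trace_pair (p := p) (w • g)
      rw [if_neg (smul_ne_zero hw hg)] at h3
      rw [← h3]
      refine sum_congr rfl fun z _ => ?_
      simp only [zero_mul, AddChar.map_zero_eq_one, one_mul, Prod.smul_fst, Prod.smul_snd,
        smul_mul_assoc, ← smul_add, map_smul, smul_eq_mul, mul_neg]
    · simp
  · rw [mul_sum]
    refine sum_congr rfl fun t ht => ?_
    rw [mul_sum]
    refine sum_congr rfl fun w _ => ?_
    -- The sum over x is a Walsh value at w times the first coordinate of g, and the dual is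
    -- quadratic in w.
    rw [← mul_assoc, ← hquad, ← hW t (mem_filter.mp ht).2, sum_mul_sum, Fintype.sum_prod_type]
    refine sum_congr rfl fun x _ => sum_congr rfl fun y _ => ?_
    rw [← AddChar.map_add_eq_mul, ← AddChar.map_add_eq_mul]
    simp only [smul_mul_assoc, map_smul, smul_eq_mul, map_add]
    congr 1
    ring

/-- For δ = 0 the sum over y does not involve w, so t and w can be summed first for each y. -/
theorem card_zeros_hyperplane_of_snd_eq_zero (hp : p ≠ 2)
    (hW : ∀ t : ZMod p, t ≠ 0 → ∀ a : F,
      ∑ x : F, (ZMod.stdAddChar (t * f x - Algebra.trace (ZMod p) F (a * x)) : ℂ) =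
        E * ZMod.stdAddChar (t⁻¹ * fs a))
    (hquad : ∀ (c : ZMod p) (x : F), fs (c • x) = c ^ 2 * fs x) {c d : F} (hc : c ≠ 0)
    (hd : d = 0) :
    (p : ℤ) ^ 2 * #{z : F × F | f z.1 + T z.2 = 0 ∧
        Algebra.trace (ZMod p) F (c * z.1 + d * z.2) = 0} =
      Fintype.card F ^ 2 + E * ∑ y, quadraticSum (fs c) (T y) := by
  have h := card_zeros_hyperplane_complex (T := T) hW hquad (g := (c, d))
    (fun h => hc (Prod.ext_iff.mp h).1)
  simp only [hd, smul_zero, zero_mul, map_zero, sub_zero, mul_sum, ← AddChar.map_add_eq_mul] at h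
  have h1 : ∑ t : ZMod p with t ≠ 0, ∑ w : ZMod p, ∑ y : F,
      (E : ℂ) * ZMod.stdAddChar (t⁻¹ * (w ^ 2 * fs c) + t * T y) =
      E * ∑ y, (quadraticSum (fs c) (T y) : ℂ) := by
    simp only [← sum_quadraticSum hp, mul_sum, sum_comm (t := (univ : Finset F))]
  rw [h1] at h
  have h4 : (((p : ℤ) ^ 2 * #{z : F × F | f z.1 + T z.2 = 0 ∧
        Algebra.trace (ZMod p) F (c * z.1 + d * z.2) = 0} : ℤ) : ℂ) =
      (Fintype.card F ^ 2 + E * ∑ y, quadraticSum (fs c) (T y) : ℤ) := by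
    push_cast
    rw [← h, hd]
    simp only [zero_mul]
  exact_mod_cast h4

/-- The factor p^m - 1 clears the denominator in `sum_invariant_mul_stdAddChar`, which evaluates the
sum over y when w ≠ 0. The Ramanujan sums correct the term w = 0. -/
theorem card_zeros_hyperplane_of_snd_ne_zero (hp : p ≠ 2) {m : ℕ} (hm : 1 ≤ m)
    (hF : Fintype.card F = (p ^ m) ^ 2)
    (hW : ∀ t : ZMod p, t ≠ 0 → ∀ a : F,
      ∑ x : F, (ZMod.stdAddChar (t * f x - Algebra.trace (ZMod p) F (a * x)) : ℂ) =
        E * ZMod.stdAddChar (t⁻¹ * fs a))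
    (hquad : ∀ (c : ZMod p) (x : F), fs (c • x) = c ^ 2 * fs x)
    (hT : ∀ u y : F, u ^ (p ^ m - 1) = 1 → T (u * y) = T y) (hT0 : T 0 = 0)
    {b : F} (hb : b ^ (p ^ m - 1) = -1) {c d : F} (hd : d ≠ 0) :
    ((p : ℤ) ^ m - 1) * ((p : ℤ) ^ 2 * #{z : F × F | f z.1 + T z.2 = 0 ∧
        Algebra.trace (ZMod p) F (c * z.1 + d * z.2) = 0}) =
      ((p : ℤ) ^ m - 1) * Fintype.card F ^ 2 + E * (p ^ m * quadraticSum (fs c) 0 +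
        p ^ m * (p ^ m - 1) * quadraticSum (fs c) (T (b / d)) - ∑ y, quadraticSum (fs c) (T y) +
        p ^ m * ∑ y, ramanujanSum (T y) - p ^ m * ramanujanSum (0 : ZMod p) -
        p ^ m * (p ^ m - 1) * ramanujanSum (T (b / d))) := by
  set τ := T (b / d) with hτ
  -- Nonzero scalars of the prime field lie in the invariance group of T, so the value at b/(-wd)
  -- does not depend on w.
  have hpm : (p - 1) ∣ p ^ m - 1 := by simpa using Nat.sub_dvd_pow_sub_pow p 1 m
  have hR : ∀ t w : ZMod p, ((p : ℂ) ^ m - 1) *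
      ∑ y, ZMod.stdAddChar (t * T y - Algebra.trace (ZMod p) F (w • d * y)) =
      (p ^ m * ZMod.stdAddChar (t * 0) + p ^ m * (p ^ m - 1) * ZMod.stdAddChar (t * τ) -
        ∑ y, ZMod.stdAddChar (t * T y)) + if w = 0 then
        (p ^ m * ∑ y, ZMod.stdAddChar (t * T y) - p ^ m * ZMod.stdAddChar (t * 0) -
          p ^ m * (p ^ m - 1) * ZMod.stdAddChar (t * τ)) else 0 := by
    intro t w
    split_ifs with hw
    · simp only [hw, zero_smul, zero_mul, map_zero, sub_zero]
      ring
    · have h1 := sum_invariant_mul_stdAddChar hp hm hF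
        (fun y => (ZMod.stdAddChar (t * T y) : ℂ)) (fun u y hu => by simp only [hT u y hu]) hb
        (neg_ne_zero.mpr (smul_ne_zero hw hd))
      have h2 : T (b / -(w • d)) = τ := by
        have h3 : b / -(w • d) = algebraMap (ZMod p) F (-w)⁻¹ * (b / d) := by
          have hw' : algebraMap (ZMod p) F w ≠ 0 := by simpa using hw
          rw [Algebra.smul_def, map_inv₀, map_neg]
          field_simp
        rw [h3, hT]
        obtain ⟨r, hr⟩ := hpm
        rw [← map_pow, hr, pow_mul, ZMod.pow_card_sub_one_eq_one (inv_ne_zero (neg_ne_zero.mpr hw)),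
          one_pow, map_one]
      rw [h2, hT0] at h1
      rw [add_zero, ← h1]
      congr 1
      refine sum_congr rfl fun y _ => ?_
      rw [← AddChar.map_add_eq_mul, neg_mul, map_neg, sub_eq_add_neg]
  have h := card_zeros_hyperplane_complex (T := T) hW hquad (g := (c, d))
    (fun h => hd (Prod.ext_iff.mp h).2)
  simp only at h
  have h1 : ((p : ℂ) ^ m - 1) * ∑ t : ZMod p with t ≠ 0, ∑ w : ZMod p,
        ZMod.stdAddChar (t⁻¹ * (w ^ 2 * fs c)) *
        ∑ y, ZMod.stdAddChar (t * T y - Algebra.trace (ZMod p) F (w • d * y)) =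
      p ^ m * quadraticSum (fs c) 0 +
        p ^ m * (p ^ m - 1) * quadraticSum (fs c) τ - ∑ y, (quadraticSum (fs c) (T y) : ℂ) +
        p ^ m * ∑ y, (ramanujanSum (T y) : ℂ) - p ^ m * ramanujanSum (0 : ZMod p) -
        p ^ m * (p ^ m - 1) * ramanujanSum τ := by
    obtain ⟨A, hA⟩ : ∃ A : ZMod p → ℂ, ∀ t,
        A t = ∑ w : ZMod p, (ZMod.stdAddChar (t⁻¹ * (w ^ 2 * fs c)) : ℂ) := ⟨_, fun _ => rfl⟩
    obtain ⟨B, hB⟩ : ∃ B : ZMod p → ℂ, ∀ t, B t = ∑ y : F, (ZMod.stdAddChar (t * T y) : ℂ) :=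
      ⟨_, fun _ => rfl⟩
    have hQ : ∀ v : ZMod p, (quadraticSum (fs c) v : ℂ) =
        ∑ t : ZMod p with t ≠ 0, A t * ZMod.stdAddChar (t * v) := by
      intro v
      rw [← sum_quadraticSum hp]
      simp only [hA, sum_mul, AddChar.map_add_eq_mul]
    have hQy : ∑ y, (quadraticSum (fs c) (T y) : ℂ) = ∑ t : ZMod p with t ≠ 0, A t * B t := by
      simp only [hQ, hB, mul_sum]
      rw [sum_comm]
    have hRy : ∑ y, (ramanujanSum (T y) : ℂ) = ∑ t : ZMod p with t ≠ 0, B t := by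
      simp only [← sum_ne_zero_stdAddChar, hB]
      rw [sum_comm]
    simp only [← hB] at hR
    rw [hQy, hRy, hQ, hQ, ← sum_ne_zero_stdAddChar, ← sum_ne_zero_stdAddChar]
    simp only [mul_sum (ι := ZMod p), ← sum_add_distrib, ← sum_sub_distrib]
    refine sum_congr rfl fun t _ => ?_
    simp only [mul_left_comm ((p : ℂ) ^ m - 1), hR, mul_add, sum_add_distrib, ← sum_mul, ← hA,
      mul_ite, mul_zero, sum_ite_eq', mem_univ, if_true]
    simp only [ne_eq, OfNat.ofNat_ne_zero, not_false_eq_true, zero_pow, zero_mul, mul_zero,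
      AddChar.map_zero_eq_one]
    ring
  have h4 : ((((p : ℤ) ^ m - 1) * ((p : ℤ) ^ 2 * #{z : F × F | f z.1 + T z.2 = 0 ∧
        Algebra.trace (ZMod p) F (c * z.1 + d * z.2) = 0}) : ℤ) : ℂ) =
      (((p : ℤ) ^ m - 1) * Fintype.card F ^ 2 + E * (p ^ m * quadraticSum (fs c) 0 +
        p ^ m * (p ^ m - 1) * quadraticSum (fs c) (T (b / d)) - ∑ y, quadraticSum (fs c) (T y) +
        p ^ m * ∑ y, ramanujanSum (T y) - p ^ m * ramanujanSum (0 : ZMod p) -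
        p ^ m * (p ^ m - 1) * ramanujanSum (T (b / d))) : ℤ) := by
    push_cast
    rw [h, ← hτ, ← h1]
    ring
  exact_mod_cast h4

end Counting

/-! ### Deviations of the weights and their size -/

/-- The deviation of `p ^ 2` times the weight of `(γ, 0)` from `(p - 1) q ^ 2`, as a multiple of
`E`, when `η(f^*(γ)) = σ ≠ 0`. -/
def devLine (p s r t σ : ℤ) : ℤ := p * ((p - 1) * s ^ 2 - (s - 1) * (p * r + σ * t))

/-- The analogous deviation for `(γ, δ)` with `δ ≠ 0`, `f^*(γ) = 0` and trace zero at `b / δ`. -/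
def devNull (p s r : ℤ) : ℤ := (p - 1) * s * ((p - 1) * s - p * r)

/-- The analogous deviation for `(γ, δ)` with `δ ≠ 0`, `η(f^*(γ)) = σ ≠ 0` and trace zero at
`b / δ`. -/
def devPlane (p s r t σ : ℤ) : ℤ :=
  (p - 1) ^ 2 * s ^ 2 - p * r * ((p - 1) * (s - 1) - 1) + p * σ * t

/-- The deviation for `(γ, δ)` with `δ ≠ 0`, depending on `σ = η(f^*(γ))` and
`ν = η(-T(b / δ))`. -/
def dev (p s r t σ ν : ℤ) : ℤ :=
  if σ = 0 then devNull p s r + (if ν = 0 then 0 else p * (p - 1) * s)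
  else devPlane p s r t σ - if ν = σ then 2 * p * s else 0

section Bounds

variable {p s r t : ℤ}

/-- This bound and the next two serve positivity: as |E| = s, a deviation below (p - 1)s³ cannot
cancel the main term (p - 1)s⁴. -/
theorem abs_devLine_lt (hp : 3 ≤ p) (hs : p ≤ s) (hr : 1 ≤ r) (hrs : r ≤ s + 1) (ht : |t| ≤ r)
    {σ : ℤ} (hσ : σ = 1 ∨ σ = -1) : |devLine p s r t σ| < (p - 1) * s ^ 3 := by
  obtain ⟨ht1, ht2⟩ := abs_le.mp ht
  obtain ⟨x, hx⟩ : ∃ x, x = p * r + σ * t := ⟨_, rfl⟩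
  have hx1 : 1 ≤ x := by rcases hσ with rfl | rfl <;> nlinarith
  have hx2 : x ≤ (p + 1) * (s + 1) := by
    have : x ≤ (p + 1) * r := by rcases hσ with rfl | rfl <;> nlinarith
    nlinarith
  have h1 : p * s ^ 2 ≤ s ^ 3 := by nlinarith [sq_nonneg s]
  have h2 : (p - 1) * (p * s ^ 2) ≤ (p - 1) * s ^ 3 :=
    mul_le_mul_of_nonneg_left h1 (by linarith)
  have h3 : 1 ≤ (s - 1) * x := by nlinarith
  have h4 : (s - 1) * x ≤ (s - 1) * ((p + 1) * (s + 1)) :=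
    mul_le_mul_of_nonneg_left hx2 (by linarith)
  have h5 : 2 * (p * s ^ 2) ≤ (p - 1) * (p * s ^ 2) :=
    mul_le_mul_of_nonneg_right (by linarith) (by positivity)
  rw [devLine, ← hx, abs_lt]
  constructor <;> nlinarith

theorem abs_devNull_lt (hp : 3 ≤ p) (hs : p ≤ s) (hr : 1 ≤ r) (hrs : r ≤ s + 1) :
    |devNull p s r| < (p - 1) * s ^ 3 ∧ |devNull p s r + p * (p - 1) * s| < (p - 1) * s ^ 3 := by
  have h0 : 0 < (p - 1) * s := by nlinarith
  have h1 : (p - 1) * s - p * r + p < s ^ 2 := by nlinarith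
  have h2 : -s ^ 2 < (p - 1) * s - p * r := by nlinarith
  have e1 : (p - 1) * s ^ 3 = (p - 1) * s * s ^ 2 := by ring
  have e2 : devNull p s r + p * (p - 1) * s = (p - 1) * s * ((p - 1) * s - p * r + p) := by
    rw [devNull]; ring
  rw [e2, e1, devNull, abs_lt, abs_lt]
  refine ⟨⟨?_, ?_⟩, ?_, ?_⟩
  · rw [← mul_neg]; exact mul_lt_mul_of_pos_left h2 h0
  · exact mul_lt_mul_of_pos_left (by linarith) h0
  · rw [← mul_neg]; exact mul_lt_mul_of_pos_left (by linarith) h0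
  · exact mul_lt_mul_of_pos_left h1 h0

theorem abs_devPlane_lt (hp : 3 ≤ p) (hs : p ≤ s) (hr : 1 ≤ r) (hrs : r ≤ s + 1) (ht : |t| ≤ r)
    {σ : ℤ} (hσ : σ = 1 ∨ σ = -1) :
    |devPlane p s r t σ| < (p - 1) * s ^ 3 ∧
      |devPlane p s r t σ - 2 * p * s| < (p - 1) * s ^ 3 := by
  obtain ⟨ht1, ht2⟩ := abs_le.mp ht
  obtain ⟨x, hx⟩ : ∃ x, x = σ * t := ⟨_, rfl⟩
  have hx1 : x ≤ r := by rcases hσ with rfl | rfl <;> linarith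
  have hx2 : -r ≤ x := by rcases hσ with rfl | rfl <;> linarith
  have hA : 2 ≤ (p - 1) * (s - 1) - 1 := by nlinarith
  have hs0 : 0 < s := by linarith
  have h1 : 0 ≤ r * ((p - 1) * (s - 1) - 1) - x := by nlinarith
  have h2 : r * ((p - 1) * (s - 1) - 1) - x ≤ (s + 1) * ((p - 1) * (s - 1)) := by
    have : r * ((p - 1) * (s - 1)) ≤ (s + 1) * ((p - 1) * (s - 1)) :=
      mul_le_mul_of_nonneg_right hrs (by linarith)
    linarith
  have h3 : p * (r * ((p - 1) * (s - 1) - 1) - x) ≤ p * ((s + 1) * ((p - 1) * (s - 1))) :=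
    mul_le_mul_of_nonneg_left h2 (by linarith)
  have h4 : 0 ≤ p * (r * ((p - 1) * (s - 1) - 1) - x) := mul_nonneg (by linarith) h1
  have h5 : (p - 1) * s < s ^ 2 := by nlinarith
  have h6 : (p - 1) * s * ((p - 1) * s) < (p - 1) * s * s ^ 2 :=
    mul_lt_mul_of_pos_left h5 (by nlinarith)
  have e : devPlane p s r t σ =
      (p - 1) ^ 2 * s ^ 2 - p * (r * ((p - 1) * (s - 1) - 1) - x) := by
    rw [devPlane, hx]; ring
  have h7 : 2 * p < (p - 1) * s * (s - 1) := by
    have : 3 * 2 ≤ s * (s - 1) := by nlinarith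
    nlinarith
  have h8 : s * (2 * p) < s * ((p - 1) * s * (s - 1)) := mul_lt_mul_of_pos_left h7 hs0
  have h9 : 0 < 2 * p * s := by positivity
  have h10 : 0 ≤ p * (p - 1) := by nlinarith
  rw [e, abs_lt, abs_lt]
  refine ⟨⟨?_, ?_⟩, ?_, ?_⟩ <;> nlinarith

end Bounds

/-! ### Weights in terms of abstract data -/

/-- The hypotheses under which the weights are computed: `f` is bent with dual `fs` and integral
Walsh factor `E`, and `T` is invariant under the multiplicative group of the subfield of `p ^ m`
elements, with prescribed numbers of square and nonsquare values. -/
structure IsWeightData {p : ℕ} [Fact p.Prime] {F : Type*} [Field F] [Fintype F] [DecidableEq F]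
    [Algebra (ZMod p) F] (f fs T : F → ZMod p) (E : ℤ) (m : ℕ) (b : F) (u v : ℤ) : Prop where
  ne_two : p ≠ 2
  one_le : 1 ≤ m
  card_eq : Fintype.card F = (p ^ m) ^ 2
  sum_eq : ∀ t : ZMod p, t ≠ 0 → ∀ a : F,
    ∑ x : F, (ZMod.stdAddChar (t * f x - Algebra.trace (ZMod p) F (a * x)) : ℂ) =
      E * ZMod.stdAddChar (t⁻¹ * fs a)
  dual_smul : ∀ (c : ZMod p) (x : F), fs (c • x) = c ^ 2 * fs x
  sum_dual : ∑ x : F, (ZMod.stdAddChar (fs x) : ℂ) = E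
  sq_eq : E ^ 2 = ((p : ℤ) ^ m) ^ 2
  map_zero : f 0 = 0
  trace_zero : T 0 = 0
  trace_mul : ∀ u y : F, u ^ (p ^ m - 1) = 1 → T (u * y) = T y
  pow_eq : b ^ (p ^ m - 1) = -1
  nonneg_pos : 0 ≤ u
  nonneg_neg : 0 ≤ v
  pos_add : 1 ≤ u + v
  card_pos : (#{y : F | y ≠ 0 ∧ quadraticChar (ZMod p) (-T y) = 1} : ℤ) = ((p : ℤ) ^ m - 1) * u
  card_neg : (#{y : F | y ≠ 0 ∧ quadraticChar (ZMod p) (-T y) = -1} : ℤ) = ((p : ℤ) ^ m - 1) * v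

namespace IsWeightData

variable {p : ℕ} [Fact p.Prime] {F : Type*} [Field F] [Fintype F] [DecidableEq F]
  [Algebra (ZMod p) F] {f fs T : F → ZMod p} {E : ℤ} {m : ℕ} {b : F} {u v : ℤ}

theorem dual_zero (h : IsWeightData f fs T E m b u v) : fs 0 = 0 := by
  simpa using h.dual_smul 0 0

theorem three_le (h : IsWeightData f fs T E m b u v) : (3 : ℤ) ≤ p := by
  have h1 : p.Prime := Fact.out
  have h2 := h1.two_le
  have h3 := h.ne_two
  exact_mod_cast (by omega : 3 ≤ p)

theorem le_pow (h : IsWeightData f fs T E m b u v) : (p : ℤ) ≤ (p : ℤ) ^ m := by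
  exact_mod_cast Nat.le_self_pow (by have := h.one_le; omega) p

/-- Sums over `y ≠ 0` of functions of `η(-T y)`. -/
theorem sum_trace (h : IsWeightData f fs T E m b u v) (g : ℤ → ℤ) :
    ∑ y : F with y ≠ 0, g (quadraticChar (ZMod p) (-T y)) =
      ((p : ℤ) ^ m - 1) * ((p ^ m + 1 - u - v) * g 0 + u * g 1 + v * g (-1)) := by
  have hval : ∀ y : F, g (quadraticChar (ZMod p) (-T y)) = g 0 +
      (if quadraticChar (ZMod p) (-T y) = 1 then g 1 - g 0 else 0) +
      (if quadraticChar (ZMod p) (-T y) = -1 then g (-1) - g 0 else 0) := by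
    intro y
    rcases eq_or_ne (-T y) 0 with h0 | h0
    · simp [h0]
    · rcases quadraticChar_dichotomy h0 with h1 | h1 <;> simp [h1]
  have hcard : (#{y : F | y ≠ 0} : ℤ) = ((p : ℤ) ^ m) ^ 2 - 1 := by
    rw [filter_ne', card_erase_of_mem (mem_univ _), card_univ, h.card_eq]
    have : 1 ≤ (p ^ m) ^ 2 := Nat.one_le_pow _ _ (pow_pos (Fact.out : p.Prime).pos _)
    push_cast [this]
    rfl
  rw [sum_congr rfl fun y _ => hval y, sum_add_distrib, sum_add_distrib, ← sum_filter,
    ← sum_filter, filter_filter, filter_filter, sum_const, sum_const, sum_const, nsmul_eq_mul,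
    nsmul_eq_mul, nsmul_eq_mul, hcard, h.card_pos, h.card_neg]
  ring

/-- The number (s - 1)(s + 1 - u - v) of y ≠ 0 with T y = 0 is nonnegative. -/
theorem add_le (h : IsWeightData f fs T E m b u v) : u + v ≤ (p : ℤ) ^ m + 1 := by
  have h1 := h.sum_trace (fun x => if x = 0 then 1 else 0)
  have h2 : (0 : ℤ) ≤ ∑ y : F with y ≠ 0,
      if quadraticChar (ZMod p) (-T y) = 0 then (1 : ℤ) else 0 :=
    sum_nonneg fun _ _ => by split_ifs <;> simp
  rw [h1] at h2
  norm_num at h2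
  have h3 := h.three_le
  have h4 := h.le_pow
  by_contra hc
  nlinarith

theorem sum_ramanujanSum (h : IsWeightData f fs T E m b u v) :
    ∑ y, ramanujanSum (T y) =
      (p - 1) + ((p : ℤ) ^ m - 1) * (p * (p ^ m + 1 - u - v) - (p ^ m + 1)) := by
  have h1 := h.sum_trace (fun x => if x = 0 then (p : ℤ) - 1 else -1)
  rw [← add_sum_erase _ _ (mem_univ (0 : F)), ← filter_ne', h.trace_zero]
  have h2 : ∀ y : F, ramanujanSum (T y) =
      if quadraticChar (ZMod p) (-T y) = 0 then (p : ℤ) - 1 else -1 := by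
    intro y
    simp only [ramanujanSum, quadraticChar_eq_zero_iff, neg_eq_zero]
  have h3 : ramanujanSum (0 : ZMod p) = (p : ℤ) - 1 := by simp [ramanujanSum]
  simp only [h3, h2, h1, if_true, one_ne_zero, neg_eq_zero, if_false]
  ring

theorem sum_quadraticSum (h : IsWeightData f fs T E m b u v) {a : ZMod p} (ha : a ≠ 0) :
    ∑ y, quadraticSum a (T y) =
      p * quadraticChar (ZMod p) a * (((p : ℤ) ^ m - 1) * (u - v)) := by
  have h1 := h.sum_trace (fun x => x)
  rw [← add_sum_erase _ _ (mem_univ (0 : F)), ← filter_ne', h.trace_zero]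
  have h2 : ∀ t : ZMod p, quadraticSum a t =
      p * quadraticChar (ZMod p) a * quadraticChar (ZMod p) (-t) := by
    intro t
    rw [quadraticSum, if_neg ha, ← mul_neg, map_mul, mul_assoc]
  simp only [h2, ← mul_sum, h1, neg_zero, quadraticChar_zero]
  ring

theorem quadraticSum_zero (t : ZMod p) : quadraticSum 0 t = p * ramanujanSum t := by
  simp [quadraticSum]

theorem card_eq_int (h : IsWeightData f fs T E m b u v) :
    (Fintype.card F : ℤ) = ((p : ℤ) ^ m) ^ 2 := by
  rw [h.card_eq]
  push_cast
  rfl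

/-- `p ^ 2` times the number of zeros of `f x + T y` off the hyperplane `(γ, 0)`. -/
theorem weight_of_snd_eq_zero (h : IsWeightData f fs T E m b u v) {c : F} (hc : c ≠ 0) :
    (p : ℤ) ^ 2 * (#{z : F × F | f z.1 + T z.2 = 0} - #{z : F × F | f z.1 + T z.2 = 0 ∧
        Algebra.trace (ZMod p) F (c * z.1 + 0 * z.2) = 0}) =
      (p - 1) * ((p : ℤ) ^ m) ^ 4 + E * if quadraticChar (ZMod p) (fs c) = 0 then 0 else
        devLine p (p ^ m) (u + v) (u - v) (quadraticChar (ZMod p) (fs c)) := by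
  have h1 := card_zeros (T := T) h.sum_eq h.dual_zero
  have h2 := card_zeros_hyperplane_of_snd_eq_zero (T := T) h.ne_two h.sum_eq h.dual_smul hc rfl
  rw [h.card_eq_int, h.sum_ramanujanSum] at h1
  rw [h.card_eq_int] at h2
  rw [mul_sub, h2, pow_two (p : ℤ), mul_assoc, h1]
  by_cases ha : fs c = 0
  · simp only [ha, quadraticSum_zero, ← mul_sum, h.sum_ramanujanSum, quadraticChar_zero, if_true]
    ring
  · rw [h.sum_quadraticSum ha, if_neg (by rwa [quadraticChar_eq_zero_iff]), devLine]
    ring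

theorem weight_of_snd_ne_zero (h : IsWeightData f fs T E m b u v) (c : F) {d : F} (hd : d ≠ 0) :
    (p : ℤ) ^ 2 * (#{z : F × F | f z.1 + T z.2 = 0} - #{z : F × F | f z.1 + T z.2 = 0 ∧
        Algebra.trace (ZMod p) F (c * z.1 + d * z.2) = 0}) =
      (p - 1) * ((p : ℤ) ^ m) ^ 4 + E * dev p (p ^ m) (u + v) (u - v)
        (quadraticChar (ZMod p) (fs c)) (quadraticChar (ZMod p) (-T (b / d))) := by
  have h1 := card_zeros (T := T) h.sum_eq h.dual_zero
  have h2 := card_zeros_hyperplane_of_snd_ne_zero (T := T) h.ne_two h.one_le h.card_eq h.sum_eq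
    h.dual_smul h.trace_mul h.trace_zero h.pow_eq (c := c) hd
  rw [h.card_eq_int, h.sum_ramanujanSum] at h1
  rw [h.card_eq_int, h.sum_ramanujanSum] at h2
  have hs : (p : ℤ) ^ m - 1 ≠ 0 := by
    have h3 := h.three_le
    have h4 := h.le_pow
    omega
  apply mul_left_cancel₀ hs
  rw [mul_sub, mul_sub, h2, pow_two (p : ℤ), mul_assoc (p : ℤ) p, h1, dev]
  have hτ : ramanujanSum (T (b / d)) =
      if quadraticChar (ZMod p) (-T (b / d)) = 0 then (p : ℤ) - 1 else -1 := by
    simp only [ramanujanSum, quadraticChar_eq_zero_iff, neg_eq_zero]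
  have hτ0 : ramanujanSum (0 : ZMod p) = (p : ℤ) - 1 := by simp [ramanujanSum]
  by_cases ha : fs c = 0
  · simp only [ha, quadraticSum_zero, ← mul_sum, h.sum_ramanujanSum, quadraticChar_zero, if_true,
      hτ, hτ0, devNull]
    split_ifs <;> ring
  · have hq : ∀ t : ZMod p, quadraticSum (fs c) t =
        p * quadraticChar (ZMod p) (fs c) * quadraticChar (ZMod p) (-t) := by
      intro t
      rw [quadraticSum, if_neg ha, ← mul_neg, map_mul, mul_assoc]
    rw [h.sum_quadraticSum ha, if_neg (by rwa [quadraticChar_eq_zero_iff]), devPlane, hq, hq, hτ,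
      hτ0, neg_zero, quadraticChar_zero]
    rcases quadraticChar_dichotomy ha with h3 | h3 <;>
    rcases eq_or_ne (-T (b / d)) 0 with h4 | h4
    · simp [h3, h4]; ring
    · rcases quadraticChar_dichotomy h4 with h5 | h5 <;> norm_num [h3, h5] <;> ring
    · simp [h3, h4]; ring
    · rcases quadraticChar_dichotomy h4 with h5 | h5 <;> norm_num [h3, h5] <;> ring

end IsWeightData

/-! ### The general table, dimension and weight distribution -/

/-- The weight with deviation `x`. -/
def weightOf (p s E x : ℤ) : ℚ := ((p - 1) * s ^ 4 + E * x) / p ^ 2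

/-- The weight distribution for arbitrary `E`, `u`, `v`, before rows are merged. -/
def generalTable (p s E u v : ℤ) : List (ℚ × ℚ) :=
  let Z : ℚ := ((s : ℚ) ^ 2 + (p - 1) * E) / p
  let Y : ℚ := ((s : ℚ) ^ 2 - E) / p
  [(0, 1),
   (weightOf p s E 0, Z - 1),
   (weightOf p s E (devNull p s (u + v) + p * (p - 1) * s), (s - 1) * (u + v) * Z),
   (weightOf p s E (devNull p s (u + v)), (s - 1) * (s + 1 - u - v) * Z),
   (weightOf p s E (devLine p s (u + v) (u - v) 1), (p - 1) / 2 * Y),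
   (weightOf p s E (devLine p s (u + v) (u - v) (-1)), (p - 1) / 2 * Y),
   (weightOf p s E (devPlane p s (u + v) (u - v) 1 - 2 * p * s),
    (s - 1) * u * ((p - 1) / 2 * Y)),
   (weightOf p s E (devPlane p s (u + v) (u - v) 1), (s - 1) * (s + 1 - u) * ((p - 1) / 2 * Y)),
   (weightOf p s E (devPlane p s (u + v) (u - v) (-1) - 2 * p * s),
    (s - 1) * v * ((p - 1) / 2 * Y)),
   (weightOf p s E (devPlane p s (u + v) (u - v) (-1)),
    (s - 1) * (s + 1 - v) * ((p - 1) / 2 * Y))]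

/-- The sum of the frequencies of the rows of weight `w`. -/
def rowSum (w : ℚ) (table : List (ℚ × ℚ)) : ℚ :=
  (table.map fun r => r.2 * if r.1 = w then 1 else 0).sum

theorem sum_filter_eq_rowSum (w : ℚ) (table : List (ℚ × ℚ)) :
    ((table.filter fun r => decide (r.1 = w)).map Prod.snd).sum = rowSum w table := by
  unfold rowSum
  induction table with
  | nil => simp
  | cons a l ih => by_cases h : a.1 = w <;> simp [h, ih]

/-- The excluded point (0, 0) lies on every hyperplane, so its omission does not change the weight.
-/
theorem hammingNorm_codeword {p : ℕ} [Fact p.Prime] {F : Type*} [Field F] [Fintype F]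
    [Algebra (ZMod p) F] {f T : F → ZMod p} {D : Finset (F × F)}
    (hD : ∀ z, z ∈ D ↔ z ≠ 0 ∧ f z.1 + T z.2 = 0) (g : F × F) :
    (hammingNorm (codeword p D g) : ℤ) =
      #{z : F × F | f z.1 + T z.2 = 0} - #{z : F × F | f z.1 + T z.2 = 0 ∧
        Algebra.trace (ZMod p) F (g.1 * z.1 + g.2 * z.2) = 0} := by
  have h1 : hammingNorm (codeword p D g) =
      #{z ∈ D | ¬ Algebra.trace (ZMod p) F (g.1 * z.1 + g.2 * z.2) = 0} := by
    rw [hammingNorm, card_filter, card_filter]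
    exact sum_coe_sort D fun z : F × F =>
      if ¬ Algebra.trace (ZMod p) F (g.1 * z.1 + g.2 * z.2) = 0 then 1 else 0
  have h2 : ({z ∈ D | ¬ Algebra.trace (ZMod p) F (g.1 * z.1 + g.2 * z.2) = 0} : Finset (F × F)) =
      {z ∈ ({z : F × F | f z.1 + T z.2 = 0} : Finset (F × F)) |
        ¬ Algebra.trace (ZMod p) F (g.1 * z.1 + g.2 * z.2) = 0} := by
    ext z
    simp only [mem_filter, hD, mem_univ, true_and]
    refine and_congr_left fun hz => and_iff_right ?_
    rintro rfl
    simp at hz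
  have h3 := card_filter_add_card_filter_not
    (s := ({z : F × F | f z.1 + T z.2 = 0} : Finset (F × F)))
    (fun z => Algebra.trace (ZMod p) F (g.1 * z.1 + g.2 * z.2) = 0)
  rw [h1, h2, ← h3]
  simp only [filter_filter]
  push_cast
  ring

namespace IsWeightData

variable {p : ℕ} [Fact p.Prime] {F : Type*} [Field F] [Fintype F] [DecidableEq F]
  [Algebra (ZMod p) F] {f fs T : F → ZMod p} {E : ℤ} {m : ℕ} {b : F} {u v : ℤ}
  {D : Finset (F × F)}

theorem card_add_one (h : IsWeightData f fs T E m b u v)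
    (hD : ∀ z, z ∈ D ↔ z ≠ 0 ∧ f z.1 + T z.2 = 0) :
    #D + 1 = #{z : F × F | f z.1 + T z.2 = 0} := by
  have h1 : D = ({z : F × F | f z.1 + T z.2 = 0} : Finset (F × F)).erase 0 := by
    ext z
    rw [hD, mem_erase, mem_filter]
    simp
  rw [h1]
  exact card_erase_add_one (by simp [h.map_zero, h.trace_zero])

theorem card_eq_length (h : IsWeightData f fs T E m b u v)
    (hD : ∀ z, z ∈ D ↔ z ≠ 0 ∧ f z.1 + T z.2 = 0) :
    (p : ℤ) * (#D + 1) = ((p : ℤ) ^ m) ^ 4 +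
      E * ((p - 1) + ((p : ℤ) ^ m - 1) * (p * (p ^ m + 1 - u - v) - (p ^ m + 1))) := by
  have h1 := card_zeros (T := T) h.sum_eq h.dual_zero
  rw [← h.card_add_one hD, h.card_eq_int, h.sum_ramanujanSum] at h1
  push_cast at h1
  rw [h1]
  ring

theorem hammingNorm_of_snd_eq_zero (h : IsWeightData f fs T E m b u v)
    (hD : ∀ z, z ∈ D ↔ z ≠ 0 ∧ f z.1 + T z.2 = 0) {c : F} (hc : c ≠ 0) :
    (p : ℤ) ^ 2 * hammingNorm (codeword p D (c, 0)) =
      (p - 1) * ((p : ℤ) ^ m) ^ 4 + E * if quadraticChar (ZMod p) (fs c) = 0 then 0 else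
        devLine p (p ^ m) (u + v) (u - v) (quadraticChar (ZMod p) (fs c)) := by
  rw [hammingNorm_codeword hD, ← h.weight_of_snd_eq_zero hc]

theorem hammingNorm_of_snd_ne_zero (h : IsWeightData f fs T E m b u v)
    (hD : ∀ z, z ∈ D ↔ z ≠ 0 ∧ f z.1 + T z.2 = 0) (c : F) {d : F} (hd : d ≠ 0) :
    (p : ℤ) ^ 2 * hammingNorm (codeword p D (c, d)) =
      (p - 1) * ((p : ℤ) ^ m) ^ 4 + E * dev p (p ^ m) (u + v) (u - v)
        (quadraticChar (ZMod p) (fs c)) (quadraticChar (ZMod p) (-T (b / d))) := by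
  rw [hammingNorm_codeword hD, ← h.weight_of_snd_ne_zero c hd]

theorem abs_sub_le (h : IsWeightData f fs T E m b u v) : |u - v| ≤ u + v := by
  have h1 := h.nonneg_pos
  have h2 := h.nonneg_neg
  rw [abs_le]
  constructor <;> linarith

theorem pos_of_abs_lt (h : IsWeightData f fs T E m b u v) {x : ℤ}
    (hx : |x| < (p - 1) * ((p : ℤ) ^ m) ^ 3) : 0 < (p - 1) * ((p : ℤ) ^ m) ^ 4 + E * x := by
  have h3 := h.three_le
  have h4 := h.le_pow
  have hE : |E| = (p : ℤ) ^ m := by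
    have := (sq_eq_sq_iff_abs_eq_abs E ((p : ℤ) ^ m)).mp h.sq_eq
    rwa [abs_of_pos (by linarith : (0 : ℤ) < (p : ℤ) ^ m)] at this
  have h5 : |E * x| < (p : ℤ) ^ m * ((p - 1) * ((p : ℤ) ^ m) ^ 3) := by
    rw [abs_mul, hE]
    exact mul_lt_mul_of_pos_left hx (by linarith)
  have h6 := (abs_lt.mp h5).1
  linarith [show (p : ℤ) ^ m * ((p - 1) * ((p : ℤ) ^ m) ^ 3) = (p - 1) * ((p : ℤ) ^ m) ^ 4 by ring]

/-- Positivity makes (γ, δ) ↦ word injective. This gives the dimension and turns counting words into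
counting pairs. -/
theorem hammingNorm_pos (h : IsWeightData f fs T E m b u v)
    (hD : ∀ z, z ∈ D ↔ z ≠ 0 ∧ f z.1 + T z.2 = 0) {g : F × F} (hg : g ≠ 0) :
    0 < hammingNorm (codeword p D g) := by
  have h3 := h.three_le
  have h4 := h.le_pow
  have hr := h.pos_add
  have hrs := h.add_le
  have ht := h.abs_sub_le
  have hp2 : (0 : ℤ) < (p : ℤ) ^ 2 := by positivity
  have hX0 : |(0 : ℤ)| < (p - 1) * ((p : ℤ) ^ m) ^ 3 := by
    rw [abs_zero]
    have : (0 : ℤ) < (p : ℤ) ^ m := by linarith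
    have : (0 : ℤ) < p - 1 := by linarith
    positivity
  have key : (0 : ℤ) < (p : ℤ) ^ 2 * hammingNorm (codeword p D g) := by
    obtain ⟨c, d⟩ := g
    by_cases hd : d = 0
    · subst hd
      have hc : c ≠ 0 := fun hc => hg (by rw [hc]; rfl)
      rw [h.hammingNorm_of_snd_eq_zero hD hc]
      apply h.pos_of_abs_lt
      split_ifs with h0
      · exact hX0
      · rw [quadraticChar_eq_zero_iff] at h0
        exact abs_devLine_lt h3 h4 hr hrs ht (quadraticChar_dichotomy h0)
    · rw [h.hammingNorm_of_snd_ne_zero hD c hd]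
      apply h.pos_of_abs_lt
      rw [dev]
      split_ifs with h0 h1 h1
      · rw [add_zero]; exact (abs_devNull_lt h3 h4 hr hrs).1
      · exact (abs_devNull_lt h3 h4 hr hrs).2
      · rw [quadraticChar_eq_zero_iff] at h0
        exact (abs_devPlane_lt h3 h4 hr hrs ht (quadraticChar_dichotomy h0)).2
      · rw [quadraticChar_eq_zero_iff] at h0
        rw [sub_zero]
        exact (abs_devPlane_lt h3 h4 hr hrs ht (quadraticChar_dichotomy h0)).1
  exact_mod_cast pos_of_mul_pos_right key hp2.le

theorem codeword_injective (h : IsWeightData f fs T E m b u v)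
    (hD : ∀ z, z ∈ D ↔ z ≠ 0 ∧ f z.1 + T z.2 = 0) : Function.Injective (codeword p D) := by
  rw [injective_iff_map_eq_zero]
  intro g hg
  by_contra h0
  have := h.hammingNorm_pos hD h0
  rw [hg, hammingNorm_zero] at this
  exact lt_irrefl _ this

theorem finrank_code (h : IsWeightData f fs T E m b u v)
    (hD : ∀ z, z ∈ D ↔ z ≠ 0 ∧ f z.1 + T z.2 = 0) :
    Module.finrank (ZMod p) (code p D) = 2 * (2 * m) := by
  rw [code, LinearMap.finrank_range_of_inj (h.codeword_injective hD), Module.finrank_prod,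
    finrank_eq_of_card (e := 2 * m) (by rw [h.card_eq]; ring)]
  ring

/-- Sums of functions of `η(f^*(γ))`. -/
theorem sum_dual_quadraticChar (h : IsWeightData f fs T E m b u v) (g : ℤ → ℚ) :
    ∑ c : F, g (quadraticChar (ZMod p) (fs c)) =
      ((((p : ℤ) ^ m : ℤ) : ℚ) ^ 2 + (p - 1) * E) / p * g 0 +
        (p - 1) / 2 * (((((p : ℤ) ^ m : ℤ) : ℚ) ^ 2 - E) / p) * (g 1 + g (-1)) := by
  have hp0 : (p : ℚ) ≠ 0 := by
    have := (Fact.out : p.Prime).ne_zero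
    exact_mod_cast this
  have hchar : ringChar (ZMod p) ≠ 2 := by rw [ZMod.ringChar_zmod_n]; exact h.ne_two
  -- All nonzero values of the dual are equally frequent; 0 is taken E more times.
  have hfib : ∀ a : ZMod p, (#{c : F | fs c = a} : ℚ) =
      ((((p : ℤ) ^ m : ℤ) : ℚ) ^ 2 - E) / p + if a = 0 then (E : ℚ) else 0 := by
    intro a
    have h1 := card_fiber_of_sum_eq h.sum_dual a
    rw [h.card_eq_int] at h1
    have h2 : ((p : ℚ)) * #{c : F | fs c = a} =
        (((p : ℤ) ^ m : ℤ) : ℚ) ^ 2 - E + if a = 0 then (p : ℚ) * E else 0 := by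
      exact_mod_cast h1
    split_ifs at h2 ⊢
    · field_simp
      linarith
    · field_simp
      linarith
  have hval : ∀ a : ZMod p, g (quadraticChar (ZMod p) a) = (g 1 + g (-1)) / 2 +
      (g 1 - g (-1)) / 2 * (quadraticChar (ZMod p) a : ℤ) +
      if a = 0 then g 0 - (g 1 + g (-1)) / 2 else 0 := by
    intro a
    rcases eq_or_ne a 0 with rfl | ha
    · simp
    · rcases quadraticChar_dichotomy ha with h1 | h1 <;> rw [h1, if_neg ha] <;> push_cast <;> ring
  have hsum0 : ∑ a : ZMod p, ((quadraticChar (ZMod p) a : ℤ) : ℚ) = 0 := by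
    rw [← Int.cast_sum, quadraticChar_sum_zero hchar, Int.cast_zero]
  have hsum : ∑ a : ZMod p, g (quadraticChar (ZMod p) a) =
      p * ((g 1 + g (-1)) / 2) + (g 0 - (g 1 + g (-1)) / 2) := by
    simp only [hval, sum_add_distrib, ← mul_sum, hsum0, sum_ite_eq', mem_univ, if_true, sum_const,
      card_univ, ZMod.card, nsmul_eq_mul]
    ring
  have hfw : ∑ c : F, g (quadraticChar (ZMod p) (fs c)) =
      ∑ a : ZMod p, (#{c : F | fs c = a} : ℚ) * g (quadraticChar (ZMod p) a) := by
    rw [← sum_fiberwise univ fs]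
    refine sum_congr rfl fun a _ => ?_
    rw [sum_congr rfl (g := fun _ => g (quadraticChar (ZMod p) a))
      (fun x hx => by rw [(mem_filter.mp hx).2])]
    simp
  rw [hfw]
  simp only [hfib, add_mul, sum_add_distrib, ← mul_sum, hsum, ite_mul, zero_mul, sum_ite_eq',
    mem_univ, if_true, quadraticChar_zero]
  field_simp
  ring

/-- Sums over `δ ≠ 0` of functions of `η(-T(b / δ))`. -/
theorem sum_trace_div (h : IsWeightData f fs T E m b u v) (g : ℤ → ℤ) :
    ∑ d : F with d ≠ 0, g (quadraticChar (ZMod p) (-T (b / d))) =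
      ((p : ℤ) ^ m - 1) * ((p ^ m + 1 - u - v) * g 0 + u * g 1 + v * g (-1)) := by
  rw [← h.sum_trace]
  have hb : b ≠ 0 := by
    rintro rfl
    have h1 := h.pow_eq
    have h2 := h.three_le
    have h3 := h.le_pow
    have h4 : 3 ≤ p ^ m := by exact_mod_cast h2.trans h3
    rw [zero_pow (by omega)] at h1
    exact neg_ne_zero.mpr one_ne_zero h1.symm
  have hmem : ∀ d ∈ ({d : F | d ≠ 0} : Finset F), b / d ∈ ({d : F | d ≠ 0} : Finset F) := by
    intro d hd
    simp only [mem_filter, mem_univ, true_and] at hd ⊢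
    exact div_ne_zero hb hd
  refine sum_bij' (fun d _ => b / d) (fun d _ => b / d) hmem hmem ?_ ?_ fun _ _ => rfl
  all_goals
    intro d hd
    exact div_div_cancel₀ hb

theorem weightCount_code (h : IsWeightData f fs T E m b u v)
    (hD : ∀ z, z ∈ D ↔ z ≠ 0 ∧ f z.1 + T z.2 = 0) (w : ℚ) :
    (weightCount (code p D) w : ℤ) =
      ∑ c : F, ∑ d : F, if (hammingNorm (codeword p D (c, d)) : ℚ) = w then 1 else 0 := by
  have h1 : {c | c ∈ code p D ∧ (hammingNorm c : ℚ) = w} =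
      (({g : F × F | (hammingNorm (codeword p D g) : ℚ) = w} : Finset (F × F)).image
        (codeword p D) : Finset (D → ZMod p)) := by
    ext c
    simp only [code, Set.mem_ofPred_eq, LinearMap.mem_range, coe_image, Set.mem_image, mem_coe,
      mem_filter, mem_univ, true_and]
    constructor
    · rintro ⟨⟨g, rfl⟩, hg⟩
      exact ⟨g, hg, rfl⟩
    · rintro ⟨g, hg, rfl⟩
      exact ⟨⟨g, rfl⟩, hg⟩
  rw [weightCount, h1, Set.ncard_coe_finset, card_image_of_injective _ (h.codeword_injective hD),
    card_filter, Fintype.sum_prod_type]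
  push_cast
  rfl

theorem hasWeightDistribution (h : IsWeightData f fs T E m b u v)
    (hD : ∀ z, z ∈ D ↔ z ≠ 0 ∧ f z.1 + T z.2 = 0) :
    HasWeightDistribution (code p D) (generalTable p (p ^ m) E u v) := by
  intro w
  have hp0 : (p : ℚ) ≠ 0 := by
    have := (Fact.out : p.Prime).ne_zero
    exact_mod_cast this
  set I : ℤ → ℤ := fun x => if weightOf p (p ^ m) E x = w then 1 else 0 with hI
  have hIx : ∀ (g : F × F) (x : ℤ), (p : ℤ) ^ 2 * hammingNorm (codeword p D g) =
      (p - 1) * ((p : ℤ) ^ m) ^ 4 + E * x →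
      (if (hammingNorm (codeword p D g) : ℚ) = w then (1 : ℤ) else 0) = I x := by
    intro g x hx
    have h1 : (p : ℚ) ^ 2 * hammingNorm (codeword p D g) =
      (p - 1) * ((p : ℚ) ^ m) ^ 4 + E * x := by exact_mod_cast hx
    have h2 : weightOf p (p ^ m) E x = hammingNorm (codeword p D g) := by
      rw [weightOf]
      push_cast
      rw [← h1]
      field_simp
    simp only [hI, h2]
  -- The pair (0, 0) has weight 0, but the sum over c counts it with deviation 0 since the dual
  -- vanishes at 0. The first two terms correct this; hence the frequency Z - 1.
  have hsplit : (weightCount (code p D) w : ℤ) =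
      (if 0 = w then 1 else 0) - I 0 +
      ∑ c : F, I (if quadraticChar (ZMod p) (fs c) = 0 then 0 else
        devLine p (p ^ m) (u + v) (u - v) (quadraticChar (ZMod p) (fs c))) +
      ∑ c : F, ∑ d : F with d ≠ 0, I (dev p (p ^ m) (u + v) (u - v)
        (quadraticChar (ZMod p) (fs c)) (quadraticChar (ZMod p) (-T (b / d)))) := by
    rw [h.weightCount_code hD]
    have h1 : ∀ c : F,
        ∑ d : F, (if (hammingNorm (codeword p D (c, d)) : ℚ) = w then (1 : ℤ) else 0) =
        (if (hammingNorm (codeword p D (c, 0)) : ℚ) = w then (1 : ℤ) else 0) +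
        ∑ d : F with d ≠ 0, I (dev p (p ^ m) (u + v) (u - v)
          (quadraticChar (ZMod p) (fs c)) (quadraticChar (ZMod p) (-T (b / d)))) := by
      intro c
      rw [← add_sum_erase _ _ (mem_univ (0 : F)), ← filter_ne']
      congr 1
      exact sum_congr rfl fun d hd =>
        hIx _ _ (h.hammingNorm_of_snd_ne_zero hD c (mem_filter.mp hd).2)
    simp only [h1, sum_add_distrib]
    congr 1
    rw [← add_sum_erase _ _ (mem_univ (0 : F)), ← add_sum_erase _ (fun c : F => I _)
      (mem_univ (0 : F)), ← filter_ne', sum_congr rfl fun c hc =>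
        hIx _ _ (h.hammingNorm_of_snd_eq_zero hD (mem_filter.mp hc).2)]
    have h2 : codeword p D ((0, 0) : F × F) = 0 := (codeword p D).map_zero
    simp only [h2, hammingNorm_zero, h.dual_zero, quadraticChar_zero, if_true, Nat.cast_zero]
    ring
  have hinner : ∀ σ : ℤ, ∑ d : F with d ≠ 0, I (dev p (p ^ m) (u + v) (u - v) σ
      (quadraticChar (ZMod p) (-T (b / d)))) =
      ((p : ℤ) ^ m - 1) * ((p ^ m + 1 - u - v) * I (dev p (p ^ m) (u + v) (u - v) σ 0) +
        u * I (dev p (p ^ m) (u + v) (u - v) σ 1) +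
        v * I (dev p (p ^ m) (u + v) (u - v) σ (-1))) :=
    fun σ => h.sum_trace_div fun x => I (dev p (p ^ m) (u + v) (u - v) σ x)
  simp only [hinner] at hsplit
  have hA := h.sum_dual_quadraticChar fun σ => (I (if σ = 0 then 0 else
    devLine p (p ^ m) (u + v) (u - v) σ) : ℚ)
  have hB := h.sum_dual_quadraticChar fun σ => ((((p : ℤ) ^ m - 1) *
    ((p ^ m + 1 - u - v) * I (dev p (p ^ m) (u + v) (u - v) σ 0) +
      u * I (dev p (p ^ m) (u + v) (u - v) σ 1) +
      v * I (dev p (p ^ m) (u + v) (u - v) σ (-1))) : ℤ) : ℚ)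
  have hcast : (weightCount (code p D) w : ℚ) = ((weightCount (code p D) w : ℤ) : ℚ) := by
    push_cast
    rfl
  rw [sum_filter_eq_rowSum, hcast, hsplit, Int.cast_add, Int.cast_add, Int.cast_sum, Int.cast_sum,
    hA, hB]
  simp only [dev, if_true, one_ne_zero, neg_eq_zero, if_false, zero_ne_one,
    show (0 : ℤ) ≠ -1 by norm_num, show (1 : ℤ) ≠ -1 by norm_num, show (-1 : ℤ) ≠ 1 by norm_num,
    add_zero, sub_zero]
  have hIr : ∀ x, (if weightOf p (p ^ m) E x = w then (1 : ℚ) else 0) = I x := by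
    intro x
    simp only [hI]
    split_ifs <;> simp
  simp only [rowSum, generalTable, List.map_cons, List.map_nil, List.sum_cons, List.sum_nil, hIr]
  push_cast
  ring

end IsWeightData

/-! ### Separating the deviations -/

section Distinct

variable {p s' h L a T : ℤ}

theorem weightOf_injective {p s E : ℤ} (hp : p ≠ 0) (hE : E ≠ 0) :
    Function.Injective (weightOf p s E) := by
  intro x y hxy
  have hp' : (p : ℚ) ≠ 0 := by exact_mod_cast hp
  have hE' : (E : ℚ) ≠ 0 := by exact_mod_cast hE
  rw [weightOf, weightOf, div_left_inj' (pow_ne_zero 2 hp'), add_right_inj] at hxy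
  exact_mod_cast mul_left_cancel₀ hE' hxy

/-- The parameters for which the weights are shown to be distinct: the square root of the order of
the field is `s = p s'`, and `s + 1 = 2 h L`. -/
structure IsSeparated (p s' h L a T : ℤ) : Prop where
  three_le : 3 ≤ p
  odd : Odd p
  pos : 0 < s'
  eq : p * s' + 1 = 2 * h * L
  pos_a : 0 < a
  abs_le : |T| ≤ a
  abs_lt : a + |T| < s'
  ne : ∀ σ : ℤ, σ = 1 ∨ σ = -1 → (s' * (p - 1) + 2) * L ≠ (p * s' + 1) * (a + σ * T)

namespace IsSeparated

/-- Here 2h divides s + 1, hence is prime to s = p s'. -/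
theorem isCoprime (H : IsSeparated p s' h L a T) : IsCoprime (p * s') (2 * h) :=
  ⟨-1, L, by linear_combination -H.eq⟩

theorem isCoprime' (H : IsSeparated p s' h L a T) : IsCoprime s' (2 * h) :=
  (IsCoprime.mul_left_iff.mp H.isCoprime).2

theorem s_pos (H : IsSeparated p s' h L a T) : 0 < p * s' :=
  mul_pos (by linarith [H.three_le]) H.pos

theorem abs_bounds {σ : ℤ} (hσ : σ = 1 ∨ σ = -1) :
    -|T| ≤ σ * T ∧ σ * T ≤ |T| := by
  have h1 := neg_abs_le T
  have h2 := le_abs_self T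
  rcases hσ with rfl | rfl <;> constructor <;> linarith

/-- Parity: the critical factor (p - 1)s' + 1 - 2ha is odd because p is odd. -/
theorem dev_zero_ne (H : IsSeparated p s' h L a T) :
    devNull p (p * s') (2 * h * a) + p * (p - 1) * (p * s') ≠ 0 := by
  intro h0
  have h1 := H.s_pos
  have h3 := H.three_le
  have h2 : ((p - 1) * (p * s') * p) * ((p - 1) * s' + 1 - 2 * h * a) = 0 := by
    rw [← h0, devNull]; ring
  rcases mul_eq_zero.mp h2 with h4 | h4
  · have : 0 < (p - 1) * (p * s') * p := by
      apply mul_pos (mul_pos _ h1) <;> linarith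
    omega
  · obtain ⟨n, hn⟩ := H.odd
    have : 2 * (n * s' - h * a) + 1 = 0 := by
      rw [← h4, hn]; ring
    omega

theorem dvd_small (H : IsSeparated p s' h L a T) {x : ℤ} (hx0 : 0 ≤ x) (hx : x < s')
    (hd : s' ∣ 2 * h * x) : x = 0 := by
  have h1 := H.isCoprime'.dvd_of_dvd_mul_left hd
  exact Int.eq_zero_of_dvd_of_nonneg_of_lt hx0 hx h1

/-- A zero would make s' divide 2ha, hence a, although 0 < a < s'. -/
theorem devNull_ne_zero (H : IsSeparated p s' h L a T) : devNull p (p * s') (2 * h * a) ≠ 0 := by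
  intro h0
  have h1 := H.s_pos
  have h3 := H.three_le
  have h2 : ((p - 1) * (p * s') * p) * ((p - 1) * s' - 2 * h * a) = 0 := by
    rw [← h0, devNull]; ring
  rcases mul_eq_zero.mp h2 with h4 | h4
  · have : 0 < (p - 1) * (p * s') * p := by
      apply mul_pos (mul_pos _ h1) <;> linarith
    omega
  · have h5 := H.dvd_small H.pos_a.le (by linarith [H.abs_lt, abs_nonneg T])
      ⟨p - 1, by linarith⟩
    exact H.pos_a.ne' h5

/-- Modulo `p s`, the deviation of every word with `f^*(γ) ≠ 0` is `p (p r + σ t)`. -/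
theorem ne_of_modEq (H : IsSeparated p s' h L a T) {σ x y : ℤ} (hσ : σ = 1 ∨ σ = -1)
    (hx : p * (p * s') ∣ x - p * (p * (2 * h * a) + σ * (2 * h * T))) (hy : p * (p * s') ∣ y) :
    x ≠ y := by
  rintro rfl
  have hp : p ≠ 0 := by linarith [H.three_le]
  have h1 : p * (p * s') ∣ p * (2 * h * (p * a + σ * T)) := by
    have e : p * (2 * h * (p * a + σ * T)) =
        x - (x - p * (p * (2 * h * a) + σ * (2 * h * T))) := by ring
    rw [e]
    exact dvd_sub hy hx
  have h2 := H.isCoprime.dvd_of_dvd_mul_left ((mul_dvd_mul_iff_left hp).mp h1)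
  obtain ⟨hb1, hb2⟩ := abs_bounds (T := T) hσ
  have h3 := H.three_le
  have h4 := H.abs_le
  have h5 := H.abs_lt
  have h6 := H.pos_a
  have h7 := abs_nonneg T
  have h8 : 0 < p * a + σ * T := by nlinarith
  have h9 : p * a + σ * T < p * s' := by nlinarith
  exact h8.ne' (Int.eq_zero_of_dvd_of_nonneg_of_lt h8.le h9 h2)

/-- Equality would force s to divide 2T after cancelling p and 2h, but 0 < 2|T| < s. -/
theorem ne_of_sign (H : IsSeparated p s' h L a T) (hT : T ≠ 0) {x y : ℤ}
    (hx : p * (p * s') ∣ x - p * (p * (2 * h * a) + 1 * (2 * h * T)))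
    (hy : p * (p * s') ∣ y - p * (p * (2 * h * a) + -1 * (2 * h * T))) : x ≠ y := by
  rintro rfl
  have hp : p ≠ 0 := by linarith [H.three_le]
  have h1 : p * (p * s') ∣ p * (2 * h * (2 * T)) := by
    have e : p * (2 * h * (2 * T)) = x - p * (p * (2 * h * a) + -1 * (2 * h * T)) -
        (x - p * (p * (2 * h * a) + 1 * (2 * h * T))) := by ring
    rw [e]
    exact dvd_sub hy hx
  have h2 := H.isCoprime.dvd_of_dvd_mul_left ((mul_dvd_mul_iff_left hp).mp h1)
  have h3 := H.three_le
  have h4 := H.abs_le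
  have h5 := H.abs_lt
  have h6 := H.pos
  have h8 := (abs_dvd_abs _ _).mpr h2
  rw [abs_of_pos H.s_pos, abs_mul] at h8
  have h9 := Int.eq_zero_of_dvd_of_nonneg_of_lt (by positivity)
    (by norm_num; nlinarith) h8
  norm_num at h9
  exact hT h9

theorem devNull_dvd : p * (p * s') ∣ devNull p (p * s') (2 * h * a) :=
  ⟨(p - 1) * ((p - 1) * s' - 2 * h * a), by rw [devNull]; ring⟩

theorem devNull_add_dvd :
    p * (p * s') ∣ devNull p (p * s') (2 * h * a) + p * (p - 1) * (p * s') :=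
  dvd_add devNull_dvd ⟨p - 1, by ring⟩

theorem devLine_dvd (σ : ℤ) : p * (p * s') ∣ devLine p (p * s') (2 * h * a) (2 * h * T) σ -
    p * (p * (2 * h * a) + σ * (2 * h * T)) :=
  ⟨(p - 1) * (p * s') - (p * (2 * h * a) + σ * (2 * h * T)), by rw [devLine]; ring⟩

theorem devPlane_dvd (σ : ℤ) : p * (p * s') ∣ devPlane p (p * s') (2 * h * a) (2 * h * T) σ -
    p * (p * (2 * h * a) + σ * (2 * h * T)) :=
  ⟨(p - 1) ^ 2 * s' - 2 * h * a * (p - 1), by rw [devPlane]; ring⟩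

theorem devPlane_sub_dvd (σ : ℤ) : p * (p * s') ∣
    devPlane p (p * s') (2 * h * a) (2 * h * T) σ - 2 * p * (p * s') -
    p * (p * (2 * h * a) + σ * (2 * h * T)) := by
  rw [sub_right_comm]
  exact dvd_sub (devPlane_dvd σ) ⟨2, by ring⟩

/-- For equal signs the congruence modulo ps gives nothing. The exact difference is ps(s'(p - 1) -
2h(a + σT)); its vanishing makes s' divide a + σT, so a + σT = 0, and then s'(p - 1) = 0. -/
theorem devLine_ne_devPlane (H : IsSeparated p s' h L a T) {σ : ℤ} (hσ : σ = 1 ∨ σ = -1) :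
    devLine p (p * s') (2 * h * a) (2 * h * T) σ ≠
      devPlane p (p * s') (2 * h * a) (2 * h * T) σ := by
  intro h0
  have h1 := H.s_pos
  have h3 := H.three_le
  have h2 : (p * (p * s')) * (s' * (p - 1) - 2 * h * (a + σ * T)) = 0 := by
    rw [devLine, devPlane] at h0
    linear_combination h0
  rcases mul_eq_zero.mp h2 with h4 | h4
  · have : 0 < p * (p * s') := mul_pos (by linarith) h1
    omega
  · obtain ⟨hb1, hb2⟩ := abs_bounds (T := T) hσ
    have h5 := H.dvd_small (x := a + σ * T) (by linarith [H.abs_le]) (by linarith [H.abs_lt])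
      ⟨p - 1, by linarith⟩
    rw [h5, mul_zero, sub_zero] at h4
    have := mul_pos H.pos (by linarith : 0 < p - 1)
    omega

/-- The difference has the factor s'(p - 1) + 2 - 2h(a + σT). Multiplying its vanishing by L and
using s + 1 = 2hL gives exactly the equation excluded by the field `ne`. -/
theorem devLine_ne_devPlane_sub (H : IsSeparated p s' h L a T) {σ : ℤ} (hσ : σ = 1 ∨ σ = -1) :
    devLine p (p * s') (2 * h * a) (2 * h * T) σ ≠
      devPlane p (p * s') (2 * h * a) (2 * h * T) σ - 2 * p * (p * s') := by
  intro h0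
  have h1 := H.s_pos
  have h3 := H.three_le
  have h2 : (p * (p * s')) * (s' * (p - 1) + 2 - 2 * h * (a + σ * T)) = 0 := by
    rw [devLine, devPlane] at h0
    linear_combination h0
  rcases mul_eq_zero.mp h2 with h4 | h4
  · have : 0 < p * (p * s') := mul_pos (by linarith) h1
    omega
  · refine H.ne σ hσ ?_
    linear_combination L * h4 - (a + σ * T) * H.eq

end IsSeparated

end Distinct

/-! ### From tables to the number of weights -/

theorem rowSum_cons (w : ℚ) (r : ℚ × ℚ) (l : List (ℚ × ℚ)) :
    rowSum w (r :: l) = (r.2 * if r.1 = w then 1 else 0) + rowSum w l := by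
  simp [rowSum]

theorem rowSum_nonneg (w : ℚ) (l : List (ℚ × ℚ)) (hl : ∀ r ∈ l, 0 < r.2) : 0 ≤ rowSum w l := by
  refine List.sum_nonneg fun x hx => ?_
  obtain ⟨r, hr, rfl⟩ := List.mem_map.mp hx
  have := hl r hr
  positivity

theorem rowSum_pos_iff (w : ℚ) (l : List (ℚ × ℚ)) (hl : ∀ r ∈ l, 0 < r.2) :
    0 < rowSum w l ↔ w ∈ l.map Prod.fst := by
  induction l with
  | nil => simp [rowSum]
  | cons r l ih =>
    have h1 := ih fun r hr => hl r (List.mem_cons_of_mem _ hr)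
    have h2 := rowSum_nonneg w l fun r hr => hl r (List.mem_cons_of_mem _ hr)
    have h3 := hl r List.mem_cons_self
    rw [rowSum_cons, List.map_cons, List.mem_cons, ← h1]
    by_cases h : r.1 = w
    · rw [if_pos h, mul_one]
      exact ⟨fun _ => Or.inl h.symm, fun _ => by linarith⟩
    · rw [if_neg h, mul_zero, zero_add]
      exact ⟨Or.inr, fun h' => h'.resolve_left fun h'' => h h''.symm⟩

/-- A table with distinct weights and positive frequencies determines the number of weights. -/
theorem HasWeightDistribution.numWeights_eq {p : ℕ} [Fact p.Prime] {ι : Type*} [Fintype ι]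
    {C : Submodule (ZMod p) (ι → ZMod p)} {l : List (ℚ × ℚ)}
    (hC : HasWeightDistribution C ((0, 1) :: l)) (hl : ∀ r ∈ l, 0 < r.2)
    (hnodup : (l.map Prod.fst).Nodup) : numWeights C = l.length := by
  have hpos : ∀ w : ℚ, 0 < weightCount C w ↔ ∃ c ∈ C, (hammingNorm c : ℚ) = w := by
    intro w
    rw [weightCount, Set.ncard_pos]
    rfl
  -- Only the zero word has weight 0, and the row (0, 1) already accounts for it.
  have hzero : (0 : ℚ) ∉ l.map Prod.fst := by
    intro h
    have h1 := hC 0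
    rw [sum_filter_eq_rowSum, rowSum_cons] at h1
    have h2 := (rowSum_pos_iff 0 l hl).mpr h
    have h3 : weightCount C 0 ≤ 1 := by
      rw [weightCount, Set.ncard_le_one]
      rintro c ⟨-, hc⟩ d ⟨-, hd⟩
      rw [Nat.cast_eq_zero, hammingNorm_eq_zero] at hc hd
      rw [hc, hd]
    have h4 : (weightCount C 0 : ℚ) ≤ 1 := by exact_mod_cast h3
    norm_num at h1
    linarith
  have hset : (fun n : ℕ => (n : ℚ)) '' {w : ℕ | w ≠ 0 ∧ ∃ c ∈ C, hammingNorm c = w} =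
      ((l.map Prod.fst).toFinset : Finset ℚ) := by
    ext w
    simp only [Set.mem_image, Set.mem_ofPred_eq, mem_coe, List.mem_toFinset]
    have key : w ≠ 0 → (w ∈ l.map Prod.fst ↔ ∃ c ∈ C, (hammingNorm c : ℚ) = w) := by
      intro hw
      rw [← hpos, ← rowSum_pos_iff w l hl]
      have h1 := hC w
      rw [sum_filter_eq_rowSum, rowSum_cons, if_neg (Ne.symm hw), mul_zero, zero_add] at h1
      rw [← h1, Nat.cast_pos]
    constructor
    · rintro ⟨n, ⟨hn, c, hc, rfl⟩, rfl⟩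
      exact (key (Nat.cast_ne_zero.mpr hn)).mpr ⟨c, hc, rfl⟩
    · intro hw
      have hw0 : w ≠ 0 := fun h => hzero (h ▸ hw)
      obtain ⟨c, hc, rfl⟩ := (key hw0).mp hw
      exact ⟨_, ⟨Nat.cast_ne_zero.mp hw0, c, hc, rfl⟩, rfl⟩
  rw [numWeights, ← Set.ncard_image_of_injective _ (Nat.cast_injective (R := ℚ)), hset,
    Set.ncard_coe_finset, List.toFinset_card_of_nodup hnodup, List.length_map]

/-- The form of `generalTable` when one of `u`, `v` is zero and the other is `r`. -/
def tableEq (p s E r σ : ℤ) : List (ℚ × ℚ) :=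
  let Z : ℚ := ((s : ℚ) ^ 2 + (p - 1) * E) / p
  let Y : ℚ := ((s : ℚ) ^ 2 - E) / p
  [(0, 1),
   (weightOf p s E 0, Z - 1),
   (weightOf p s E (devNull p s r + p * (p - 1) * s), (s - 1) * r * Z),
   (weightOf p s E (devNull p s r), (s - 1) * (s + 1 - r) * Z),
   (weightOf p s E (devLine p s r (σ * r) 1), (p - 1) / 2 * Y),
   (weightOf p s E (devLine p s r (σ * r) (-1)), (p - 1) / 2 * Y),
   (weightOf p s E (devPlane p s r (σ * r) σ - 2 * p * s), (s - 1) * r * ((p - 1) / 2 * Y)),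
   (weightOf p s E (devPlane p s r (σ * r) (-σ)), (s - 1) * (s + 1) * ((p - 1) / 2 * Y)),
   (weightOf p s E (devPlane p s r (σ * r) σ), (s - 1) * (s + 1 - r) * ((p - 1) / 2 * Y))]

/-- The form of `generalTable` when `u = v = r / 2`. -/
def tableHalf (p s E r : ℤ) : List (ℚ × ℚ) :=
  let Z : ℚ := ((s : ℚ) ^ 2 + (p - 1) * E) / p
  let Y : ℚ := ((s : ℚ) ^ 2 - E) / p
  [(0, 1),
   (weightOf p s E 0, Z - 1),
   (weightOf p s E (devNull p s r + p * (p - 1) * s), (s - 1) * r * Z),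
   (weightOf p s E (devNull p s r), (s - 1) * (s + 1 - r) * Z),
   (weightOf p s E (devLine p s r 0 1), (p - 1) * Y),
   (weightOf p s E (devPlane p s r 0 1 - 2 * p * s), (s - 1) * r * ((p - 1) / 2 * Y)),
   (weightOf p s E (devPlane p s r 0 1), (s - 1) * (2 * (s + 1) - r) * ((p - 1) / 2 * Y))]

/-! ### Merging rows of the general table -/

section Merge

variable (p s E r w' : ℤ) (w : ℚ)

/-- With v = 0 one row has frequency zero and drops out; the remaining rows agree. -/
theorem rowSum_generalTable_left :
    rowSum w (generalTable p s E r 0) = rowSum w (tableEq p s E r 1) := by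
  simp only [rowSum, generalTable, tableEq, List.map_cons, List.map_nil, List.sum_cons,
    List.sum_nil, add_zero, sub_zero, one_mul]
  push_cast
  ring

theorem rowSum_generalTable_right :
    rowSum w (generalTable p s E 0 r) = rowSum w (tableEq p s E r (-1)) := by
  simp only [rowSum, generalTable, tableEq, List.map_cons, List.map_nil, List.sum_cons,
    List.sum_nil, zero_add, zero_sub, neg_one_mul, neg_neg]
  push_cast
  ring

/-- With u = v the term in σt vanishes, so rows for the two signs have equal weights. -/
theorem rowSum_generalTable_half :
    rowSum w (generalTable p s E r r) = rowSum w (tableHalf p s E (2 * r)) := by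
  have h1 : devLine p s (2 * r) 0 (-1) = devLine p s (2 * r) 0 1 := by simp [devLine]
  have h2 : devPlane p s (2 * r) 0 (-1) = devPlane p s (2 * r) 0 1 := by simp [devPlane]
  simp only [rowSum, generalTable, tableHalf, List.map_cons, List.map_nil, List.sum_cons,
    List.sum_nil, sub_self, ← two_mul, h1, h2]
  push_cast
  ring

end Merge

/-! ### Identifying the explicit tables -/

section Tables

variable {p ℓ k m : ℕ} {ε h : ℤ}

theorem natCast_pow_sub_one (hp : p ≠ 0) (hm : 1 ≤ m) :
    (p : ℚ) ^ (2 * m - 1) = ((p : ℚ) ^ m) ^ 2 / p := by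
  have hp' : (p : ℚ) ≠ 0 := by exact_mod_cast hp
  rw [eq_div_iff hp', ← pow_succ, ← pow_mul]
  congr 1
  omega

/-- Eliminating h by h = (s + 1)/(2ℓ^k) turns each entry into an identity of rational functions; the
other table identifications work the same way. -/
theorem tableOneThree_eq (hp : p ≠ 0) (hℓ : ℓ ≠ 0) (hm : 1 ≤ m)
    (hh : (p : ℤ) ^ m + 1 = 2 * h * (ℓ : ℤ) ^ k) :
    tableOneThree p ℓ k (2 * m) ε =
      tableHalf p (p ^ m) (ε * sqrtPStarPow p (2 * m)) (2 * h * (ℓ - 1)) := by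
  have hp' : (p : ℚ) ≠ 0 := by exact_mod_cast hp
  have hL' : ((ℓ : ℚ) ^ k) ≠ 0 := by exact_mod_cast pow_ne_zero k hℓ
  have hh' : (p : ℚ) ^ m + 1 = 2 * h * (ℓ : ℚ) ^ k := by exact_mod_cast hh
  simp only [tableOneThree, tableHalf, weightOf, devNull, devLine, devPlane,
    natCast_pow_sub_one hp hm, pow_mul', Nat.mul_div_cancel_left m two_pos, List.cons.injEq,
    Prod.mk.injEq, true_and, and_true]
  push_cast
  generalize (p : ℚ) ^ m = s at *
  generalize (ℓ : ℚ) ^ k = L at *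
  generalize ((sqrtPStarPow p (2 * m) : ℤ) : ℚ) = x
  have hh2 : (h : ℚ) = (s + 1) / (2 * L) := by field_simp; linarith
  rw [hh2]
  refine ⟨⟨?_, ?_⟩, ⟨?_, ?_⟩, ⟨?_, ?_⟩, ⟨?_, ?_⟩, ⟨?_, ?_⟩, ?_, ?_⟩ <;>
    field_simp <;> ring

theorem tableNotOneThree_eq (hp : p ≠ 0) (hℓ : ℓ ≠ 0) (hk : 1 ≤ k) (hm : 1 ≤ m)
    (hh : (p : ℤ) ^ m + 1 = 2 * h * (ℓ : ℤ) ^ k) :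
    tableNotOneThree p ℓ k (2 * m) ε =
      tableHalf p (p ^ m) (ε * sqrtPStarPow p (2 * m)) (2 * h * ℓ) := by
  have hp' : (p : ℚ) ≠ 0 := by exact_mod_cast hp
  have hℓ' : (ℓ : ℚ) ≠ 0 := by exact_mod_cast hℓ
  have hM' : ((ℓ : ℚ) ^ (k - 1)) ≠ 0 := pow_ne_zero _ hℓ'
  have hL' : (ℓ : ℚ) ^ k = ℓ * (ℓ : ℚ) ^ (k - 1) := by rw [← pow_succ', Nat.sub_add_cancel hk]
  have hh' : (p : ℚ) ^ m + 1 = 2 * h * (ℓ : ℚ) ^ k := by exact_mod_cast hh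
  simp only [tableNotOneThree, tableHalf, weightOf, devNull, devLine, devPlane,
    natCast_pow_sub_one hp hm, pow_mul', Nat.mul_div_cancel_left m two_pos, List.cons.injEq,
    Prod.mk.injEq, true_and, and_true]
  push_cast
  rw [hL'] at *
  generalize (p : ℚ) ^ m = s at *
  generalize (ℓ : ℚ) ^ (k - 1) = M at *
  generalize ((sqrtPStarPow p (2 * m) : ℤ) : ℚ) = x
  have hh2 : (h : ℚ) = (s + 1) / (2 * (ℓ * M)) := by field_simp; linarith
  rw [hh2]
  refine ⟨⟨?_, ?_⟩, ⟨?_, ?_⟩, ⟨?_, ?_⟩, ⟨?_, ?_⟩, ⟨?_, ?_⟩, ?_, ?_⟩ <;>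
    field_simp <;> ring

theorem tableNotOneOneEq_eq (hp : p ≠ 0) (hℓ : ℓ ≠ 0) (hk : 1 ≤ k) (hm : 1 ≤ m)
    (hh : (p : ℤ) ^ m + 1 = 2 * h * (ℓ : ℤ) ^ k) {σ : ℤ}
    (hσ : σ = 1 ∨ σ = -1) :
    tableNotOneOneEq p ℓ k (2 * m) ε σ σ =
      tableEq p (p ^ m) (ε * sqrtPStarPow p (2 * m)) (2 * h * ℓ) σ := by
  have hp' : (p : ℚ) ≠ 0 := by exact_mod_cast hp
  have hℓ' : (ℓ : ℚ) ≠ 0 := by exact_mod_cast hℓ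
  have hM' : ((ℓ : ℚ) ^ (k - 1)) ≠ 0 := pow_ne_zero _ hℓ'
  have hL' : (ℓ : ℚ) ^ k = ℓ * (ℓ : ℚ) ^ (k - 1) := by rw [← pow_succ', Nat.sub_add_cancel hk]
  have hh' : (p : ℚ) ^ m + 1 = 2 * h * (ℓ : ℚ) ^ k := by exact_mod_cast hh
  simp only [tableNotOneOneEq, tableEq, weightOf, devNull, devLine, devPlane,
    natCast_pow_sub_one hp hm, pow_mul', Nat.mul_div_cancel_left m two_pos, List.cons.injEq,
    Prod.mk.injEq, true_and, and_true]
  push_cast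
  rw [hL'] at *
  generalize (p : ℚ) ^ m = s at *
  generalize (ℓ : ℚ) ^ (k - 1) = M at *
  generalize ((sqrtPStarPow p (2 * m) : ℤ) : ℚ) = x
  have hh2 : (h : ℚ) = (s + 1) / (2 * (ℓ * M)) := by field_simp; linarith
  rw [hh2]
  have hσ2 : (σ : ℚ) * σ = 1 := by rcases hσ with rfl | rfl <;> norm_num
  have e1 : (σ : ℚ) * (σ + (ℓ - 1) * σ) = ℓ := by linear_combination (ℓ : ℚ) * hσ2
  have e2 : ∀ y : ℚ, (p : ℚ) * σ * (σ * y) = p * y := fun y => by linear_combination p * y * hσ2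
  have e3 : ∀ y : ℚ, (p : ℚ) * -σ * (σ * y) = -(p * y) := fun y => by
    linear_combination -p * y * hσ2
  simp only [e1, e2, e3]
  refine ⟨⟨?_, ?_⟩, ⟨?_, ?_⟩, ⟨?_, ?_⟩, ⟨?_, ?_⟩, ⟨?_, ?_⟩, ⟨?_, ?_⟩, ⟨?_, ?_⟩, ?_, ?_⟩ <;>
    field_simp <;> ring

theorem rowSum_tableOneOne (hp : p ≠ 0) (hℓ : ℓ ≠ 0) (hm : 1 ≤ m)
    (hh : (p : ℤ) ^ m + 1 = 2 * h * (ℓ : ℤ) ^ k) (w : ℚ) :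
    rowSum w (tableOneOne p ℓ k (2 * m) ε) =
      rowSum w (tableEq p (p ^ m) (ε * sqrtPStarPow p (2 * m)) (2 * h * (ℓ - 1)) 1) := by
  -- The two tables have the same rows with the last two interchanged.
  obtain ⟨a₀, a₁, a₂, a₃, a₄, a₅, a₆, a₇, a₈, h₁, h₂⟩ : ∃ a₀ a₁ a₂ a₃ a₄ a₅ a₆ a₇ a₈,
      tableOneOne p ℓ k (2 * m) ε = [a₀, a₁, a₂, a₃, a₄, a₅, a₆, a₇, a₈] ∧
      tableEq p (p ^ m) (ε * sqrtPStarPow p (2 * m)) (2 * h * (ℓ - 1)) 1 =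
        [a₀, a₁, a₂, a₃, a₄, a₅, a₆, a₈, a₇] := by
    refine ⟨_, _, _, _, _, _, _, _, _, rfl, ?_⟩
    symm
    have hp' : (p : ℚ) ≠ 0 := by exact_mod_cast hp
    have hL' : ((ℓ : ℚ) ^ k) ≠ 0 := by exact_mod_cast pow_ne_zero k hℓ
    have hh' : (p : ℚ) ^ m + 1 = 2 * h * (ℓ : ℚ) ^ k := by exact_mod_cast hh
    simp only [tableEq, weightOf, devNull, devLine, devPlane,
      natCast_pow_sub_one hp hm, pow_mul', Nat.mul_div_cancel_left m two_pos, List.cons.injEq,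
      Prod.mk.injEq, true_and, and_true]
    push_cast
    generalize (p : ℚ) ^ m = s at *
    generalize (ℓ : ℚ) ^ k = L at *
    generalize ((sqrtPStarPow p (2 * m) : ℤ) : ℚ) = x
    have hh2 : (h : ℚ) = (s + 1) / (2 * L) := by field_simp; linarith
    rw [hh2]
    refine ⟨⟨?_, ?_⟩, ⟨?_, ?_⟩, ⟨?_, ?_⟩, ⟨?_, ?_⟩, ⟨?_, ?_⟩, ⟨?_, ?_⟩, ⟨?_, ?_⟩, ?_, ?_⟩ <;>
    field_simp <;> ring
  rw [h₁, h₂]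
  simp only [rowSum_cons]
  ring

theorem tableNotOneOneNeg_eq (hp : p ≠ 0) (hℓ : ℓ ≠ 0) (hk : 1 ≤ k) (hm : 1 ≤ m)
    (hh : (p : ℤ) ^ m + 1 = 2 * h * (ℓ : ℤ) ^ k) :
    tableNotOneOneNeg p ℓ k (2 * m) ε 1 (-1) =
      generalTable p (p ^ m) (ε * sqrtPStarPow p (2 * m)) (2 * h) (2 * h * (ℓ - 1)) := by
  have hp' : (p : ℚ) ≠ 0 := by exact_mod_cast hp
  have hℓ' : (ℓ : ℚ) ≠ 0 := by exact_mod_cast hℓ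
  have hM' : ((ℓ : ℚ) ^ (k - 1)) ≠ 0 := pow_ne_zero _ hℓ'
  have hL' : (ℓ : ℚ) ^ k = ℓ * (ℓ : ℚ) ^ (k - 1) := by rw [← pow_succ', Nat.sub_add_cancel hk]
  have hh' : (p : ℚ) ^ m + 1 = 2 * h * (ℓ : ℚ) ^ k := by exact_mod_cast hh
  simp only [tableNotOneOneNeg, generalTable, weightOf, devNull, devLine, devPlane,
    natCast_pow_sub_one hp hm, pow_mul', Nat.mul_div_cancel_left m two_pos, List.cons.injEq,
    Prod.mk.injEq, true_and, and_true]
  push_cast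
  rw [hL'] at *
  generalize (p : ℚ) ^ m = s at *
  generalize (ℓ : ℚ) ^ (k - 1) = M at *
  generalize ((sqrtPStarPow p (2 * m) : ℤ) : ℚ) = x
  have hh2 : (h : ℚ) = (s + 1) / (2 * (ℓ * M)) := by field_simp; linarith
  rw [hh2]
  refine ⟨⟨?_, ?_⟩, ⟨?_, ?_⟩, ⟨?_, ?_⟩, ⟨?_, ?_⟩, ⟨?_, ?_⟩, ⟨?_, ?_⟩, ⟨?_, ?_⟩, ⟨?_, ?_⟩, ?_, ?_⟩ <;>
    field_simp <;> ring

theorem rowSum_tableNotOneOneNeg (hp : p ≠ 0) (hℓ : ℓ ≠ 0) (hk : 1 ≤ k) (hm : 1 ≤ m)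
    (hh : (p : ℤ) ^ m + 1 = 2 * h * (ℓ : ℤ) ^ k) (w : ℚ) :
    rowSum w (tableNotOneOneNeg p ℓ k (2 * m) ε (-1) 1) =
      rowSum w (generalTable p (p ^ m) (ε * sqrtPStarPow p (2 * m)) (2 * h * (ℓ - 1)) (2 * h)) := by
  -- Exchanging u and v negates t, which the sign σ absorbs; only the order of rows changes.
  have hswap : ∀ a b c d : ℤ, rowSum w (generalTable a b c d (2 * h)) =
      rowSum w (generalTable a b c (2 * h) d) := by
    intro a b c d
    have e1 : ∀ x y z : ℤ, devLine a b x (-y) z = devLine a b x y (-z) := by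
      intro x y z; simp [devLine]
    have e2 : ∀ x y z : ℤ, devPlane a b x (-y) z = devPlane a b x y (-z) := by
      intro x y z; simp [devPlane]
    rw [generalTable, add_comm d, ← neg_sub (2 * h) d]
    simp only [rowSum, generalTable, List.map_cons, List.map_nil, List.sum_cons, List.sum_nil, e1,
      e2, neg_neg]
    ring
  rw [hswap, ← tableNotOneOneNeg_eq hp hℓ hk hm hh]
  simp only [rowSum, tableNotOneOneNeg, List.map_cons, List.map_nil, List.sum_cons, List.sum_nil]
  push_cast
  have e : (-1 : ℚ) + (ℓ - 1) * 1 = -(1 + (ℓ - 1) * -1) := by ring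
  simp only [e, mul_neg, sub_neg_eq_add, ← sub_eq_add_neg]
  ring_nf

end Tables

/-- The two selections are the deviations occurring in `tableEq` for σ = 1 and σ = -1. -/
theorem nodup_of_nodup_nine {α : Type*} {x₁ x₂ x₃ x₄ x₅ x₆ x₇ x₈ x₉ : α}
    (h : [x₁, x₂, x₃, x₄, x₅, x₆, x₇, x₈, x₉].Nodup) :
    [x₁, x₂, x₃, x₄, x₅, x₆, x₉, x₇].Nodup ∧ [x₁, x₂, x₃, x₄, x₅, x₈, x₇, x₉].Nodup := by
  simp only [List.nodup_cons, List.mem_cons, List.not_mem_nil, or_false, not_or,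
    not_false_eq_true, List.nodup_nil, and_true] at h ⊢
  grind

/-! ### Positive frequencies and the exact number of weights -/

section Count

variable {p s' h L a T E : ℤ}

namespace IsSeparated

theorem one_lt_zeroCount (H : IsSeparated p s' h L a T) (hE : E ^ 2 = (p * s') ^ 2) :
    1 < (((p * s' : ℤ) : ℚ) ^ 2 + (p - 1) * E) / p := by
  have h1 := H.three_le
  have h2 : 2 ≤ s' := by linarith [H.abs_lt, H.pos_a, abs_nonneg T]
  have hp : (0 : ℚ) < p := by exact_mod_cast (by linarith : 0 < p)
  rw [one_lt_div hp]
  have h3 : -(p * s') ≤ E := (abs_le_of_sq_le_sq' hE.le H.s_pos.le).1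
  have h5 : 2 * p ≤ p * s' := by nlinarith
  have h6 : (p - 1) * (-(p * s')) ≤ (p - 1) * E := mul_le_mul_of_nonneg_left h3 (by linarith)
  have h4 : p < (p * s') ^ 2 + (p - 1) * E := by nlinarith
  exact_mod_cast h4

theorem valueCount_pos (H : IsSeparated p s' h L a T) (hE : E ^ 2 = (p * s') ^ 2) :
    0 < (((p * s' : ℤ) : ℚ) ^ 2 - E) / p := by
  have h1 := H.three_le
  have h2 := H.pos
  have hp : (0 : ℚ) < p := by exact_mod_cast (by linarith : 0 < p)
  apply div_pos _ hp
  have h3 : E ≤ p * s' := (abs_le_of_sq_le_sq' hE.le H.s_pos.le).2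
  have h5 : 3 ≤ p * s' := by nlinarith
  have h4 : 0 < (p * s') ^ 2 - E := by nlinarith
  exact_mod_cast h4

theorem ne_zero_of_sq (H : IsSeparated p s' h L a T) (hE : E ^ 2 = (p * s') ^ 2) : E ≠ 0 := by
  rintro rfl
  have := H.s_pos
  nlinarith

theorem h_pos (H : IsSeparated p s' h L a T) (hL : a < L) : 0 < h := by
  have h1 := H.eq
  have h2 := H.s_pos
  have h3 := H.pos_a
  by_contra hc
  nlinarith

theorem s_sub_one_pos (H : IsSeparated p s' h L a T) : (0 : ℚ) < ((p * s' : ℤ) : ℚ) - 1 := by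
  have : 0 < p * s' - 1 := by nlinarith [H.three_le, H.pos]
  exact_mod_cast this

theorem p_sub_one_pos (H : IsSeparated p s' h L a T) : (0 : ℚ) < (p : ℚ) - 1 := by
  have : 0 < p - 1 := by linarith [H.three_le]
  exact_mod_cast this

theorem r_pos (H : IsSeparated p s' h L a T) (hL : a < L) : (0 : ℚ) < ((2 * h * a : ℤ) : ℚ) := by
  have := mul_pos (mul_pos two_pos (H.h_pos hL)) H.pos_a
  exact_mod_cast this

theorem s_add_one_sub_r_pos (H : IsSeparated p s' h L a T) (hL : a < L) :
    (0 : ℚ) < ((p * s' : ℤ) : ℚ) + 1 - ((2 * h * a : ℤ) : ℚ) := by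
  have hh := H.h_pos hL
  have : 0 < p * s' + 1 - 2 * h * a := by rw [H.eq]; nlinarith
  exact_mod_cast this

theorem two_p_s_ne_zero (H : IsSeparated p s' h L a T) : 2 * p * (p * s') ≠ 0 := by
  have := H.s_pos
  have := H.three_le
  positivity

theorem p_p_sub_one_s_ne_zero (H : IsSeparated p s' h L a T) : p * (p - 1) * (p * s') ≠ 0 := by
  have := H.s_pos
  have := H.three_le
  have : 0 < p - 1 := by linarith
  positivity

/-- The deviations are pairwise distinct. -/
theorem nodup_dev (H : IsSeparated p s' h L a T) (hT : T ≠ 0) :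
    [0, devNull p (p * s') (2 * h * a) + p * (p - 1) * (p * s'), devNull p (p * s') (2 * h * a),
      devLine p (p * s') (2 * h * a) (2 * h * T) 1,
      devLine p (p * s') (2 * h * a) (2 * h * T) (-1),
      devPlane p (p * s') (2 * h * a) (2 * h * T) 1 - 2 * p * (p * s'),
      devPlane p (p * s') (2 * h * a) (2 * h * T) 1,
      devPlane p (p * s') (2 * h * a) (2 * h * T) (-1) - 2 * p * (p * s'),
      devPlane p (p * s') (2 * h * a) (2 * h * T) (-1)].Nodup := by
  have h1 : (1 : ℤ) = 1 ∨ (1 : ℤ) = -1 := Or.inl rfl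
  have h2 : (-1 : ℤ) = 1 ∨ (-1 : ℤ) = -1 := Or.inr rfl
  have z := dvd_zero (p * (p * s'))
  have n := devNull_dvd (p := p) (s' := s') (h := h) (a := a)
  have n' := devNull_add_dvd (p := p) (s' := s') (h := h) (a := a)
  have m0 := fun (y : ℤ) (hy : p * (p * s') ∣ y) => (H.ne_of_modEq h1 (devLine_dvd 1) hy).symm
  have m1 := fun (y : ℤ) (hy : p * (p * s') ∣ y) => (H.ne_of_modEq h1 (devPlane_dvd 1) hy).symm
  have m2 := fun (y : ℤ) (hy : p * (p * s') ∣ y) =>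
    (H.ne_of_modEq h1 (devPlane_sub_dvd 1) hy).symm
  have k0 := fun (y : ℤ) (hy : p * (p * s') ∣ y) => (H.ne_of_modEq h2 (devLine_dvd (-1)) hy).symm
  have k1 := fun (y : ℤ) (hy : p * (p * s') ∣ y) =>
    (H.ne_of_modEq h2 (devPlane_dvd (-1)) hy).symm
  have k2 := fun (y : ℤ) (hy : p * (p * s') ∣ y) =>
    (H.ne_of_modEq h2 (devPlane_sub_dvd (-1)) hy).symm
  simp only [List.nodup_cons, List.mem_cons, List.not_mem_nil, or_false, not_or,
    not_false_eq_true, List.nodup_nil, and_true]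
  refine ⟨⟨H.dev_zero_ne.symm, H.devNull_ne_zero.symm, m0 _ z, k0 _ z, m2 _ z, m1 _ z, k2 _ z,
      k1 _ z⟩,
    ⟨by simpa using H.p_p_sub_one_s_ne_zero, m0 _ n', k0 _ n', m2 _ n', m1 _ n', k2 _ n', k1 _ n'⟩,
    ⟨m0 _ n, k0 _ n, m2 _ n, m1 _ n, k2 _ n, k1 _ n⟩,
    ⟨H.ne_of_sign hT (devLine_dvd 1) (devLine_dvd (-1)), H.devLine_ne_devPlane_sub h1,
      H.devLine_ne_devPlane h1, H.ne_of_sign hT (devLine_dvd 1) (devPlane_sub_dvd (-1)),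
      H.ne_of_sign hT (devLine_dvd 1) (devPlane_dvd (-1))⟩,
    ⟨(H.ne_of_sign hT (devPlane_sub_dvd 1) (devLine_dvd (-1))).symm,
      (H.ne_of_sign hT (devPlane_dvd 1) (devLine_dvd (-1))).symm,
      H.devLine_ne_devPlane_sub h2, H.devLine_ne_devPlane h2⟩,
    ⟨by simpa using H.two_p_s_ne_zero,
      H.ne_of_sign hT (devPlane_sub_dvd 1) (devPlane_sub_dvd (-1)),
      H.ne_of_sign hT (devPlane_sub_dvd 1) (devPlane_dvd (-1))⟩,
    ⟨H.ne_of_sign hT (devPlane_dvd 1) (devPlane_sub_dvd (-1)),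
      H.ne_of_sign hT (devPlane_dvd 1) (devPlane_dvd (-1))⟩, by simpa using H.two_p_s_ne_zero⟩

variable {q : ℕ} [Fact q.Prime] {ι : Type*} [Fintype ι] {C : Submodule (ZMod q) (ι → ZMod q)}

theorem numWeights_tableHalf (H : IsSeparated p s' h L a 0) (hE : E ^ 2 = (p * s') ^ 2)
    (hL : a < L) (hC : HasWeightDistribution C (tableHalf p (p * s') E (2 * h * a))) :
    numWeights C = 6 := by
  have hZ := H.one_lt_zeroCount hE
  have hY := H.valueCount_pos hE
  have hs1 := H.s_sub_one_pos
  have hp1 := H.p_sub_one_pos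
  have hr := H.r_pos hL
  have hr1 := H.s_add_one_sub_r_pos hL
  have hr2 : (0 : ℚ) < 2 * (((p * s' : ℤ) : ℚ) + 1) - ((2 * h * a : ℤ) : ℚ) := by linarith
  rw [tableHalf] at hC
  have hnum := hC.numWeights_eq (by
    simp only [List.mem_cons, List.not_mem_nil, or_false, forall_eq_or_imp, forall_eq]
    have hZ0 := one_pos.trans hZ
    refine ⟨by linarith, ?_, ?_, ?_, ?_, ?_⟩ <;> positivity) (by
    have hinj := weightOf_injective (s := p * s') (by linarith [H.three_le] : p ≠ 0)
      (H.ne_zero_of_sq hE)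
    have h1 : (1 : ℤ) = 1 ∨ (1 : ℤ) = -1 := Or.inl rfl
    have d0 := H.devLine_ne_devPlane h1
    have d1 := H.devLine_ne_devPlane_sub h1
    have m0 := fun (y : ℤ) (hy : p * (p * s') ∣ y) => H.ne_of_modEq h1 (devLine_dvd 1) hy
    have m1 := fun (y : ℤ) (hy : p * (p * s') ∣ y) => H.ne_of_modEq h1 (devPlane_dvd 1) hy
    have m2 := fun (y : ℤ) (hy : p * (p * s') ∣ y) => H.ne_of_modEq h1 (devPlane_sub_dvd 1) hy
    simp only [mul_zero] at d0 d1 m0 m1 m2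
    change (List.map (weightOf p (p * s') E) [_, _, _, _, _, _]).Nodup
    refine List.Nodup.map hinj ?_
    have z := dvd_zero (p * (p * s'))
    have n := devNull_dvd (p := p) (s' := s') (h := h) (a := a)
    have n' := devNull_add_dvd (p := p) (s' := s') (h := h) (a := a)
    simp only [List.nodup_cons, List.mem_cons, List.not_mem_nil, or_false, not_or,
      not_false_eq_true, List.nodup_nil, and_true]
    refine ⟨⟨H.dev_zero_ne.symm, H.devNull_ne_zero.symm, (m0 _ z).symm, (m2 _ z).symm,
      (m1 _ z).symm⟩, ⟨by simpa using H.p_p_sub_one_s_ne_zero, (m0 _ n').symm, (m2 _ n').symm, (m1 _ n').symm⟩,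
      ⟨(m0 _ n).symm, (m2 _ n).symm, (m1 _ n).symm⟩, ⟨d1, d0⟩,
      by simpa using H.two_p_s_ne_zero⟩)
  exact hnum

theorem numWeights_generalTable (H : IsSeparated p s' h L a T) (hE : E ^ 2 = (p * s') ^ 2)
    (hT : T ≠ 0) (hL : a < L) {u v : ℤ} (hu : 0 < u) (hv : 0 < v) (huv : u + v = 2 * h * a)
    (huv' : u - v = 2 * h * T) (hC : HasWeightDistribution C (generalTable p (p * s') E u v)) :
    numWeights C = 9 := by
  have hZ := H.one_lt_zeroCount hE
  have hY := H.valueCount_pos hE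
  have hs1 := H.s_sub_one_pos
  have hp1 := H.p_sub_one_pos
  have hr1 := H.s_add_one_sub_r_pos hL
  have hu' : (0 : ℚ) < u := by exact_mod_cast hu
  have hv' : (0 : ℚ) < v := by exact_mod_cast hv
  rw [← huv, Int.cast_add, ← sub_sub] at hr1
  have hr2 : (0 : ℚ) < ((p * s' : ℤ) : ℚ) + 1 - u := by linarith
  have hr3 : (0 : ℚ) < ((p * s' : ℤ) : ℚ) + 1 - v := by linarith
  have hnd := H.nodup_dev hT
  rw [← huv, ← huv'] at hnd
  rw [generalTable] at hC
  exact hC.numWeights_eq (by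
    simp only [List.mem_cons, List.not_mem_nil, or_false, forall_eq_or_imp, forall_eq]
    have hZ0 := one_pos.trans hZ
    refine ⟨by linarith, ?_, ?_, ?_, ?_, ?_, ?_, ?_, ?_⟩ <;> positivity)
    (by
      change (List.map (weightOf p (p * s') E) [_, _, _, _, _, _, _, _, _]).Nodup
      exact List.Nodup.map (weightOf_injective (by linarith [H.three_le] : p ≠ 0)
        (H.ne_zero_of_sq hE)) hnd)

theorem numWeights_tableEq {σ : ℤ} (hσ : σ = 1 ∨ σ = -1) (H : IsSeparated p s' h L a (σ * a))
    (hE : E ^ 2 = (p * s') ^ 2) (hL : a < L)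
    (hC : HasWeightDistribution C (tableEq p (p * s') E (2 * h * a) σ)) :
    numWeights C = 8 := by
  have hZ := H.one_lt_zeroCount hE
  have hY := H.valueCount_pos hE
  have hs1 := H.s_sub_one_pos
  have hp1 := H.p_sub_one_pos
  have hr := H.r_pos hL
  have hr1 := H.s_add_one_sub_r_pos hL
  have hs2 : (0 : ℚ) < ((p * s' : ℤ) : ℚ) + 1 := by linarith
  have hnd := H.nodup_dev (by
    have := H.pos_a
    rcases hσ with rfl | rfl <;> simp <;> omega)
  rw [show 2 * h * (σ * a) = σ * (2 * h * a) by ring] at hnd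
  rw [tableEq] at hC
  exact hC.numWeights_eq (by
    simp only [List.mem_cons, List.not_mem_nil, or_false, forall_eq_or_imp, forall_eq]
    have hZ0 := one_pos.trans hZ
    refine ⟨by linarith, ?_, ?_, ?_, ?_, ?_, ?_, ?_⟩ <;> positivity)
    (by
      change (List.map (weightOf p (p * s') E) [_, _, _, _, _, _, _, _]).Nodup
      refine List.Nodup.map (weightOf_injective (by linarith [H.three_le] : p ≠ 0)
        (H.ne_zero_of_sq hE)) ?_
      rcases hσ with rfl | rfl
      · exact (nodup_of_nodup_nine hnd).1
      · rw [neg_neg]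
        exact (nodup_of_nodup_nine hnd).2)

end IsSeparated

end Count

theorem HasWeightDistribution.of_rowSum_eq {p : ℕ} {ι : Type*} [Fintype ι]
    {C : Submodule (ZMod p) (ι → ZMod p)} {t t' : List (ℚ × ℚ)} (hC : HasWeightDistribution C t)
    (h : ∀ w, rowSum w t = rowSum w t') : HasWeightDistribution C t' := fun w => by
  rw [hC w, sum_filter_eq_rowSum, sum_filter_eq_rowSum, h]

/-! ### Sufficient conditions for separation -/

section Separation

variable {p s' h L a T : ℤ}

/-- In `ne` the left side is at least 3a(s'(p - 1) + 2), which exceeds 2a(ps' + 1), a bound for the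
right side, by a(s'(p - 3) + 4). -/
theorem isSeparated_of_three_mul_le (hp : 3 ≤ p) (hodd : Odd p) (heq : p * s' + 1 = 2 * h * L)
    (ha : 0 < a) (hT : |T| ≤ a) (hlt : a + |T| < s') (hL : 3 * a ≤ L) :
    IsSeparated p s' h L a T where
  three_le := hp
  odd := hodd
  pos := by linarith [abs_nonneg T]
  eq := heq
  pos_a := ha
  abs_le := hT
  abs_lt := hlt
  ne σ hσ := by
    have hs : 0 < s' := by linarith [abs_nonneg T]
    have h1 : a + σ * T ≤ 2 * a := by
      rcases hσ with rfl | rfl <;> linarith [le_abs_self T, neg_abs_le T]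
    have h2 : (p * s' + 1) * (a + σ * T) ≤ (p * s' + 1) * (2 * a) :=
      mul_le_mul_of_nonneg_left h1 (by positivity)
    have h3 : 0 < s' * (p - 1) + 2 := by
      have : 0 ≤ s' * (p - 1) := mul_nonneg hs.le (by linarith)
      linarith
    have h4 := mul_le_mul_of_nonneg_left hL h3.le
    have h5 : 0 ≤ a * s' * (p - 3) := mul_nonneg (by positivity) (by linarith)
    nlinarith

/-- This covers k = 1 with ℓ ≡ 1 (mod p), where L = ℓ = a + 1 is too small for the previous
estimate. In `ne` the right side is the larger one, except for T = a and σ = -1, where it is 0. -/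
theorem isSeparated_of_eq_add_one (hp : 3 ≤ p) (hodd : Odd p) (heq : p * s' + 1 = 2 * h * L)
    (ha : 2 * p ≤ a) (hT : T = a ∨ T = 0) (hlt : a + |T| < s') (hL : L = a + 1) :
    IsSeparated p s' h L a T where
  three_le := hp
  odd := hodd
  pos := by linarith [abs_nonneg T]
  eq := heq
  pos_a := by linarith
  abs_le := by
    rcases hT with rfl | rfl
    · rw [abs_of_nonneg (by linarith)]
    · rw [abs_zero]
      linarith
  abs_lt := hlt
  ne σ hσ := by
    have hs : a + 1 ≤ s' := by linarith [abs_nonneg T]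
    subst hL
    rcases hT with rfl | rfl
    · rcases hσ with rfl | rfl
      · have h1 : 0 ≤ p * s' * (T - 1) := by
          refine mul_nonneg (mul_nonneg ?_ ?_) ?_ <;> linarith
        nlinarith
      · have h1 : 0 ≤ s' * (p - 1) := by
          refine mul_nonneg ?_ ?_ <;> linarith
        nlinarith
    · have h1 : (a + 1) * (p + 1) ≤ s' * (a + 1 - p) := by
        refine mul_le_mul hs ?_ ?_ ?_ <;> linarith
      nlinarith

end Separation

/-! ### Growth estimates giving a + |T| < p^(m-1) -/

section Size

theorem add_one_lt_three_pow {n : ℕ} (hn : 2 ≤ n) : n + 1 < 3 ^ n := by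
  induction n, hn using Nat.le_induction with
  | base => norm_num
  | succ n hn ih => rw [pow_succ]; omega

theorem two_mul_add_two_lt_five_pow {n : ℕ} (hn : 2 ≤ n) : 2 * n + 2 < 5 ^ n := by
  induction n, hn using Nat.le_induction with
  | base => norm_num
  | succ n hn ih => rw [pow_succ]; omega

theorem two_mul_lt_three_pow {n : ℕ} (hn : 3 ≤ n) : 2 * n < 3 ^ (n - 1) := by
  obtain ⟨n, rfl⟩ := Nat.exists_eq_add_of_le' (by omega : 1 ≤ n)
  rw [Nat.add_sub_cancel]
  have h2 : 2 ≤ n := by omega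
  clear hn
  induction n, h2 using Nat.le_induction with
  | base => norm_num
  | succ n hn ih => rw [pow_succ]; omega

theorem four_mul_lt_five_pow {n : ℕ} (hn : 3 ≤ n) : 4 * n < 5 ^ (n - 1) := by
  obtain ⟨n, rfl⟩ := Nat.exists_eq_add_of_le' (by omega : 1 ≤ n)
  rw [Nat.add_sub_cancel]
  have h2 : 2 ≤ n := by omega
  clear hn
  induction n, h2 using Nat.le_induction with
  | base => norm_num
  | succ n hn ih => rw [pow_succ]; omega

variable {p ℓ k m : ℕ}

theorem three_mul_le_pow (hℓ : 3 ≤ ℓ) (hk : 2 ≤ k) : 3 * ℓ ≤ ℓ ^ k :=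
  calc 3 * ℓ ≤ ℓ * ℓ := Nat.mul_le_mul_right _ hℓ
    _ = ℓ ^ 2 := (sq ℓ).symm
    _ ≤ ℓ ^ k := Nat.pow_le_pow_right (by omega) hk

/-- For k ≥ 2 one has 2m = ℓ^(k-1)(ℓ - 1) ≥ 2ℓ. -/
theorem le_half_totient_sub_one (hℓ : ℓ.Prime) (hℓ2 : ℓ ≠ 2) (hk : 2 ≤ k)
    (hm : Nat.totient (ℓ ^ k) = 2 * m) : ℓ - 1 ≤ m - 1 := by
  rw [Nat.totient_prime_pow hℓ (by omega)] at hm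
  have h3 : 3 ≤ ℓ := lt_of_le_of_ne hℓ.two_le hℓ2.symm
  have h1 : ℓ ≤ ℓ ^ (k - 1) := Nat.le_self_pow (by omega) ℓ
  have h2 : ℓ * 2 ≤ ℓ ^ (k - 1) * (ℓ - 1) := Nat.mul_le_mul h1 (by omega)
  omega

theorem lt_pow_of_two_le (hp : 3 ≤ p) (hℓ : ℓ.Prime) (hℓ2 : ℓ ≠ 2) (hk : 2 ≤ k)
    (hm : Nat.totient (ℓ ^ k) = 2 * m) : ℓ < p ^ (m - 1) := by
  have h3 : 3 ≤ ℓ := lt_of_le_of_ne hℓ.two_le hℓ2.symm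
  calc ℓ = ℓ - 1 + 1 := by omega
    _ < 3 ^ (ℓ - 1) := add_one_lt_three_pow (by omega)
    _ ≤ p ^ (ℓ - 1) := Nat.pow_le_pow_left hp _
    _ ≤ p ^ (m - 1) := Nat.pow_le_pow_right (by omega) (le_half_totient_sub_one hℓ hℓ2 hk hm)

theorem two_mul_lt_pow_of_two_le (hp : 5 ≤ p) (hℓ : ℓ.Prime) (hℓ2 : ℓ ≠ 2) (hk : 2 ≤ k)
    (hm : Nat.totient (ℓ ^ k) = 2 * m) : 2 * ℓ < p ^ (m - 1) := by
  have h3 : 3 ≤ ℓ := lt_of_le_of_ne hℓ.two_le hℓ2.symm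
  calc 2 * ℓ = 2 * (ℓ - 1) + 2 := by omega
    _ < 5 ^ (ℓ - 1) := two_mul_add_two_lt_five_pow (by omega)
    _ ≤ p ^ (ℓ - 1) := Nat.pow_le_pow_left hp _
    _ ≤ p ^ (m - 1) := Nat.pow_le_pow_right (by omega) (le_half_totient_sub_one hℓ hℓ2 hk hm)

/-- Both 2 and the odd p divide ℓ - 1. In particular (ℓ - 1)/2 ≥ 3, where the exponential estimates
start to hold. -/
theorem two_mul_le_sub_one (hp : Odd p) (hℓ : ℓ.Prime) (hℓ2 : ℓ ≠ 2) (h1 : ℓ ≡ 1 [MOD p]) :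
    2 * p ≤ ℓ - 1 := by
  have hodd := hℓ.odd_of_ne_two hℓ2
  have h2 : p ∣ ℓ - 1 := (Nat.modEq_iff_dvd' hℓ.one_le).mp h1.symm
  have h3 : 2 ∣ ℓ - 1 := by
    obtain ⟨c, hc⟩ := hodd
    omega
  have h4 : Nat.Coprime 2 p := (Nat.coprime_two_left).mpr hp
  exact Nat.le_of_dvd (by have := hℓ.two_le; omega) (h4.mul_dvd_of_dvd_of_dvd h3 h2)

theorem half_le_half_totient (hℓ : ℓ.Prime) (hk : 1 ≤ k)
    (hm : Nat.totient (ℓ ^ k) = 2 * m) : (ℓ - 1) / 2 ≤ m := by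
  rw [Nat.totient_prime_pow hℓ (by omega)] at hm
  have h2 : 1 * (ℓ - 1) ≤ ℓ ^ (k - 1) * (ℓ - 1) :=
    Nat.mul_le_mul_right _ (Nat.one_le_pow _ _ hℓ.pos)
  omega

theorem sub_one_lt_pow (hp : 3 ≤ p) (hpo : Odd p) (hℓ : ℓ.Prime) (hℓ2 : ℓ ≠ 2) (hk : 1 ≤ k)
    (hm : Nat.totient (ℓ ^ k) = 2 * m) (h1 : ℓ ≡ 1 [MOD p]) : ℓ - 1 < p ^ (m - 1) := by
  have h3 := two_mul_le_sub_one hpo hℓ hℓ2 h1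
  obtain ⟨c, hc⟩ := hℓ.odd_of_ne_two hℓ2
  have h4 := half_le_half_totient hℓ hk hm
  calc ℓ - 1 = 2 * ((ℓ - 1) / 2) := by omega
    _ < 3 ^ ((ℓ - 1) / 2 - 1) := two_mul_lt_three_pow (by omega)
    _ ≤ p ^ ((ℓ - 1) / 2 - 1) := Nat.pow_le_pow_left hp _
    _ ≤ p ^ (m - 1) := Nat.pow_le_pow_right (by omega) (by omega)

theorem two_mul_sub_one_lt_pow (hp : 5 ≤ p) (hpo : Odd p) (hℓ : ℓ.Prime) (hℓ2 : ℓ ≠ 2)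
    (hk : 1 ≤ k) (hm : Nat.totient (ℓ ^ k) = 2 * m) (h1 : ℓ ≡ 1 [MOD p]) :
    2 * (ℓ - 1) < p ^ (m - 1) := by
  have h3 := two_mul_le_sub_one hpo hℓ hℓ2 h1
  obtain ⟨c, hc⟩ := hℓ.odd_of_ne_two hℓ2
  have h4 := half_le_half_totient hℓ hk hm
  calc 2 * (ℓ - 1) = 4 * ((ℓ - 1) / 2) := by omega
    _ < 5 ^ ((ℓ - 1) / 2 - 1) := four_mul_lt_five_pow (by omega)
    _ ≤ p ^ ((ℓ - 1) / 2 - 1) := Nat.pow_le_pow_left hp _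
    _ ≤ p ^ (m - 1) := Nat.pow_le_pow_right (by omega) (by omega)

/-- For `ℓ ≡ 1 (mod p)` the weights are separated. -/
theorem isSeparated_of_modEq_one {h : ℕ} {T : ℤ} (hp : 3 ≤ p) (hpo : Odd p) (hℓ : ℓ.Prime)
    (hℓ2 : ℓ ≠ 2) (hk : 1 ≤ k) (h1 : ℓ ≡ 1 [MOD p])
    (hh : (p : ℤ) * (p : ℤ) ^ (m - 1) + 1 = 2 * h * (ℓ : ℤ) ^ k) (hT : T = (ℓ : ℤ) - 1 ∨ T = 0)
    (hlt : (ℓ : ℤ) - 1 + |T| < (p : ℤ) ^ (m - 1)) :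
    IsSeparated p ((p : ℤ) ^ (m - 1)) h ((ℓ : ℤ) ^ k) ((ℓ : ℤ) - 1) T := by
  have h3 : 3 ≤ ℓ := lt_of_le_of_ne hℓ.two_le hℓ2.symm
  have h4 := two_mul_le_sub_one hpo hℓ hℓ2 h1
  have hp' : (3 : ℤ) ≤ p := by exact_mod_cast hp
  have hodd : Odd (p : ℤ) := by exact_mod_cast hpo
  rcases eq_or_lt_of_le hk with rfl | hk
  · refine isSeparated_of_eq_add_one hp' hodd hh ?_ hT hlt (by ring)
    omega
  · refine isSeparated_of_three_mul_le hp' hodd hh (by omega) ?_ hlt ?_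
    · rcases hT with rfl | rfl
      · rw [abs_of_nonneg (by omega)]
      · rw [abs_zero]
        omega
    · have h5 : 3 * (ℓ : ℤ) ≤ (ℓ : ℤ) ^ k := by exact_mod_cast three_mul_le_pow h3 hk
      linarith

/-- For `k ≥ 2` the weights are separated. -/
theorem isSeparated_of_two_le {h : ℕ} {T : ℤ} (hp : 3 ≤ p) (hpo : Odd p) (hℓ : ℓ.Prime)
    (hℓ2 : ℓ ≠ 2) (hk : 2 ≤ k) (hh : (p : ℤ) * (p : ℤ) ^ (m - 1) + 1 = 2 * h * (ℓ : ℤ) ^ k)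
    (hT : |T| ≤ (ℓ : ℤ)) (hlt : (ℓ : ℤ) + |T| < (p : ℤ) ^ (m - 1)) :
    IsSeparated p ((p : ℤ) ^ (m - 1)) h ((ℓ : ℤ) ^ k) ℓ T := by
  have h3 : 3 ≤ ℓ := lt_of_le_of_ne hℓ.two_le hℓ2.symm
  refine isSeparated_of_three_mul_le (by exact_mod_cast hp) (by exact_mod_cast hpo) hh (by omega)
    hT hlt ?_
  exact_mod_cast three_mul_le_pow h3 hk

end Size

/-! ### Counting square and nonsquare values of -Tr(y^N) -/

section SignCount

/-- `2 ℓ ^ k / (q - 1)` times the number of `y ≠ 0` with `η (-Tr (y ^ N)) = σ`. -/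
noncomputable def signCount (p ℓ k : ℕ) [Fact p.Prime] (σ : ℤ) : ℤ :=
  let i : ZMod p → ℤ := fun x => if quadraticChar (ZMod p) (-x) = σ then 1 else 0
  i (Nat.totient (ℓ ^ k)) + i (-Nat.totient (ℓ ^ k)) +
    (ℓ - 1) * (i ((ℓ : ZMod p) ^ (k - 1)) + i (-(ℓ : ZMod p) ^ (k - 1)))

variable {p ℓ k : ℕ} [Fact p.Prime] {σ : ℤ}

theorem quadraticChar_neg_of_one (h4 : p ≡ 1 [MOD 4]) (x : ZMod p) :
    quadraticChar (ZMod p) (-x) = quadraticChar (ZMod p) x := by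
  have hp : p ≠ 2 := by rintro rfl; revert h4; decide
  rw [← neg_one_mul, map_mul, quadraticChar_neg_one (by rwa [ZMod.ringChar_zmod_n]), ZMod.card,
    ZMod.χ₄_nat_one_mod_four h4, one_mul]

theorem quadraticChar_neg_of_three (h4 : p ≡ 3 [MOD 4]) (x : ZMod p) :
    quadraticChar (ZMod p) (-x) = -quadraticChar (ZMod p) x := by
  have hp : p ≠ 2 := by rintro rfl; revert h4; decide
  rw [← neg_one_mul, map_mul, quadraticChar_neg_one (by rwa [ZMod.ringChar_zmod_n]), ZMod.card,
    ZMod.χ₄_nat_three_mod_four h4, neg_one_mul]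

/-- Here η is even, so opposite trace values contribute equally. -/
theorem signCount_of_one (h4 : p ≡ 1 [MOD 4]) : signCount p ℓ k σ =
    2 * ((if quadraticChar (ZMod p) (Nat.totient (ℓ ^ k)) = σ then 1 else 0) +
      (ℓ - 1) * (if quadraticChar (ZMod p) ((ℓ : ZMod p) ^ (k - 1)) = σ then 1 else 0)) := by
  simp only [signCount, quadraticChar_neg_of_one h4]
  ring

/-- For p ≡ 3 (mod 4), η is odd: of two opposite nonzero trace values exactly one has the prescribed
sign, so the counts for both signs agree. -/
theorem ite_add_ite_neg {x : ℤ} (hx : x = 1 ∨ x = -1) (hσ : σ = 1 ∨ σ = -1) :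
    (if -x = σ then (1 : ℤ) else 0) + (if x = σ then 1 else 0) = 1 := by
  rcases hx with rfl | rfl <;> rcases hσ with rfl | rfl <;> norm_num

theorem natCast_pow_ne_zero (hpℓ : p ≠ ℓ) (hℓ : ℓ.Prime) (n : ℕ) : ((ℓ : ZMod p) ^ n) ≠ 0 := by
  refine pow_ne_zero _ fun h => ?_
  rw [ZMod.natCast_eq_zero_iff] at h
  exact hpℓ ((Nat.prime_dvd_prime_iff_eq Fact.out hℓ).mp h)

theorem totient_cast_eq (hℓ : ℓ.Prime) (hk : 1 ≤ k) :
    ((Nat.totient (ℓ ^ k) : ℕ) : ZMod p) = (ℓ : ZMod p) ^ (k - 1) * (ℓ - 1) := by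
  rw [Nat.totient_prime_pow hℓ (by omega), Nat.cast_mul, Nat.cast_pow, Nat.cast_pred hℓ.pos]

theorem natCast_sub_one_eq_zero_iff : ((ℓ : ZMod p) - 1 = 0) ↔ ℓ ≡ 1 [MOD p] := by
  rw [sub_eq_zero, ← ZMod.natCast_eq_natCast_iff, Nat.cast_one]

theorem signCount_of_three_of_one (h4 : p ≡ 3 [MOD 4]) (hpℓ : p ≠ ℓ) (hℓ : ℓ.Prime) (hk : 1 ≤ k)
    (h1 : ℓ ≡ 1 [MOD p]) (hσ : σ = 1 ∨ σ = -1) : signCount p ℓ k σ = ℓ - 1 := by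
  have h2 := ite_add_ite_neg (quadraticChar_dichotomy (natCast_pow_ne_zero hpℓ hℓ (k - 1))) hσ
  simp only [signCount, quadraticChar_neg_of_three h4, neg_neg, h2, totient_cast_eq hℓ hk,
    natCast_sub_one_eq_zero_iff.mpr h1, mul_zero, quadraticChar_zero, neg_zero]
  rcases hσ with rfl | rfl <;> norm_num

theorem totient_cast_ne_zero (hpℓ : p ≠ ℓ) (hℓ : ℓ.Prime) (hk : 1 ≤ k) (h1 : ¬ ℓ ≡ 1 [MOD p]) :
    ((Nat.totient (ℓ ^ k) : ℕ) : ZMod p) ≠ 0 := by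
  rw [totient_cast_eq hℓ hk]
  exact mul_ne_zero (natCast_pow_ne_zero hpℓ hℓ _) fun h => h1 (natCast_sub_one_eq_zero_iff.mp h)

theorem signCount_of_three_of_not_one (h4 : p ≡ 3 [MOD 4]) (hpℓ : p ≠ ℓ) (hℓ : ℓ.Prime)
    (hk : 1 ≤ k) (h1 : ¬ ℓ ≡ 1 [MOD p]) (hσ : σ = 1 ∨ σ = -1) : signCount p ℓ k σ = ℓ := by
  have h2 := ite_add_ite_neg (quadraticChar_dichotomy (natCast_pow_ne_zero hpℓ hℓ (k - 1))) hσ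
  have h3 := ite_add_ite_neg (quadraticChar_dichotomy (totient_cast_ne_zero hpℓ hℓ hk h1)) hσ
  simp only [signCount, quadraticChar_neg_of_three h4, neg_neg, h2, h3]
  ring

theorem signCount_nonneg (hℓ : ℓ.Prime) : 0 ≤ signCount p ℓ k σ := by
  have h1 : (0 : ℤ) ≤ ℓ - 1 := by have := hℓ.one_le; omega
  unfold signCount
  positivity

/-- The trace value ℓ^(k-1) is nonzero modulo p, so it contributes ℓ - 1 to one of the two signs. -/
theorem one_le_signCount_add (hpℓ : p ≠ ℓ) (hℓ : ℓ.Prime) :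
    1 ≤ signCount p ℓ k 1 + signCount p ℓ k (-1) := by
  have h1 : (1 : ℤ) ≤ ℓ - 1 := by have := hℓ.two_le; omega
  have h2 : ∀ σ : ℤ, (ℓ - 1) * (if quadraticChar (ZMod p) (-(-(ℓ : ZMod p) ^ (k - 1))) = σ then
      (1 : ℤ) else 0) ≤ signCount p ℓ k σ := by
    intro σ
    have h3 : (0 : ℤ) ≤ ℓ - 1 := by omega
    simp only [signCount, mul_add, ← add_assoc]
    exact le_add_of_nonneg_left (by positivity)
  refine le_trans ?_ (add_le_add (h2 1) (h2 (-1)))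
  rw [neg_neg]
  rcases quadraticChar_dichotomy (natCast_pow_ne_zero hpℓ hℓ (k - 1)) with h | h <;>
    simp [h, h1]

end SignCount

/-! ### Producing the weight data from the hypotheses on f, p and ℓ -/

section Data

variable {p ℓ k : ℕ} [Fact p.Prime] {F : Type*} [Field F] [Fintype F] [Algebra (ZMod p) F]

theorem card_quadraticChar_trace_pow [DecidableEq F] (hp : p ≠ 2) (hℓ : ℓ.Prime) (hℓ2 : ℓ ≠ 2)
    (hk : 1 ≤ k) (hpℓ : p ≠ ℓ) (hord : orderOf (p : ZMod (ℓ ^ k)) = Nat.totient (ℓ ^ k))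
    (hF : Fintype.card F = p ^ Nat.totient (ℓ ^ k)) {N : ℕ}
    (hN : Fintype.card F - 1 = N * (2 * ℓ ^ k)) {σ : ℤ} (hσ : σ = 1 ∨ σ = -1) :
    (#{y : F | y ≠ 0 ∧ quadraticChar (ZMod p) (-Algebra.trace (ZMod p) F (y ^ N)) = σ} : ℤ) =
      N * signCount p ℓ k σ := by
  have h := sum_trace_pow hp hℓ hℓ2 hk hpℓ hord hF hN
    (fun x => if quadraticChar (ZMod p) (-x) = σ then 1 else 0)
  rw [← filter_filter, card_filter]
  push_cast
  rw [h, signCount]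
  have h0 : (if quadraticChar (ZMod p) (-0) = σ then (1 : ℤ) else 0) = 0 := by
    rcases hσ with rfl | rfl <;> simp
  rw [h0, mul_zero, add_zero]

theorem sqrtPStarPow_sq (p m : ℕ) : sqrtPStarPow p (2 * m) ^ 2 = ((p : ℤ) ^ m) ^ 2 := by
  rw [sqrtPStarPow, Nat.mul_div_cancel_left m two_pos, pStar, mul_pow, mul_pow, ← pow_mul,
    ← pow_mul]
  rw [show (p - 1) / 2 * (m * 2) = 2 * ((p - 1) / 2 * m) by ring, pow_mul]
  norm_num

/-- The combinatorial data that determine the weights. -/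
theorem exists_isWeightData [DecidableEq F] (hp : p ≠ 2) (hℓ : ℓ.Prime) (hℓ2 : ℓ ≠ 2)
    (hpℓ : p ≠ ℓ) (hk : 1 ≤ k) (hprim : orderOf (p : ZMod (2 * ℓ ^ k)) = Nat.totient (ℓ ^ k))
    (hF : Fintype.card F = p ^ Nat.totient (ℓ ^ k)) {f fs : F → ZMod p} (hf : MemRF f)
    (hdual : IsDual f fs) (hquad : ∀ (c : ZMod p) (x : F), fs (c • x) = c ^ 2 * fs x) :
    ∃ (m h : ℕ) (ε : ℤ) (b : F), Nat.totient (ℓ ^ k) = 2 * m ∧ 1 ≤ m ∧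
      (p : ℤ) ^ m + 1 = 2 * h * (ℓ : ℤ) ^ k ∧ (ε = 1 ∨ ε = -1) ∧
      (∀ a : F, walsh f a = (ε : ℂ) * (sqrtPStarPow p (2 * m) : ℂ) * ZMod.stdAddChar (fs a)) ∧
      IsWeightData f fs
        (fun y => Algebra.trace (ZMod p) F (y ^ ((p ^ Nat.totient (ℓ ^ k) - 1) / (2 * ℓ ^ k))))
        (ε * sqrtPStarPow p (2 * m)) m b (h * signCount p ℓ k 1) (h * signCount p ℓ k (-1)) := by
  have hprime : p.Prime := Fact.out
  have hpo : Odd p := hprime.odd_of_ne_two hp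
  have hord := orderOf_natCast_prime_pow hpo (hℓ.odd_of_ne_two hℓ2) hprim
  obtain ⟨m, hm⟩ := (even_totient_prime_pow hℓ hℓ2 hk).two_dvd
  have hm1 : 1 ≤ m := by
    have := Nat.totient_pos.mpr (pow_pos hℓ.pos k)
    omega
  have hdvd := two_mul_prime_pow_dvd hpo hℓ hℓ2 hk hord
  rw [hm, Nat.mul_div_cancel_left m two_pos] at hdvd
  obtain ⟨h, hh⟩ := hdvd
  have hs1 : 1 ≤ p ^ m := Nat.one_le_pow _ _ hprime.pos
  have hs2 : 1 < p ^ m := Nat.one_lt_pow (by omega) hprime.one_lt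
  have hLpos : 0 < ℓ ^ k := pow_pos hℓ.pos k
  have hh0 : 0 < h := Nat.pos_of_ne_zero (by rintro rfl; omega)
  have hq : p ^ (2 * m) - 1 = (p ^ m - 1) * (p ^ m + 1) := by
    rw [pow_mul', ← one_pow 2, Nat.sq_sub_sq, one_pow, mul_comm]
  have hqN : p ^ (2 * m) - 1 = (p ^ m - 1) * h * (2 * ℓ ^ k) := by rw [hq, hh]; ring
  -- From q - 1 = (s - 1)(s + 1) and s + 1 = 2hℓ^k. The factor s - 1 of N makes Tr(y^N) invariant
  -- under the units of the subfield.
  have hN : (p ^ (2 * m) - 1) / (2 * ℓ ^ k) = (p ^ m - 1) * h := by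
    rw [hqN, Nat.mul_div_cancel _ (by omega)]
  have hF' : Fintype.card F = p ^ (2 * m) := by rw [hF, hm]
  have hf0 : f 0 = 0 := hf.2.1
  obtain ⟨E, hE2, hE⟩ := exists_int_eq_sum hp hF' hf.1.1 hf0 (hf.map_smul_of_dual hdual hquad)
  have hsq : E ^ 2 = sqrtPStarPow p (2 * m) ^ 2 := by rw [hE2, sqrtPStarPow_sq, pow_mul']
  -- Both E and the power of √p* are integers with square p^(2m).
  obtain ⟨ε, hε, hEε⟩ : ∃ ε : ℤ, (ε = 1 ∨ ε = -1) ∧ E = ε * sqrtPStarPow p (2 * m) := by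
    rcases sq_eq_sq_iff_eq_or_eq_neg.mp hsq with h' | h'
    · exact ⟨1, Or.inl rfl, by rw [h', one_mul]⟩
    · exact ⟨-1, Or.inr rfl, by rw [h', neg_one_mul]⟩
  obtain ⟨b, hb⟩ : ∃ b : F, b ^ (p ^ m - 1) = -1 := by
    have h1 : 2 * (p ^ m - 1) ∣ Fintype.card F - 1 := by
      rw [hF', hqN]
      exact ⟨h * ℓ ^ k, by ring⟩
    have h2 := card_pow_eq_neg_one (one_ne_neg_one_of_algebra (F := F) hp) h1
    obtain ⟨b, hb⟩ := card_pos.mp (by rw [h2]; omega : 0 < #{y : F | y ^ (p ^ m - 1) = -1})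
    exact ⟨b, (mem_filter.mp hb).2⟩
  have hcast : ((p ^ m - 1 : ℕ) : ℤ) = (p : ℤ) ^ m - 1 := by push_cast [hs1]; rfl
  have hcount := fun {σ : ℤ} (hσ : σ = 1 ∨ σ = -1) =>
    card_quadraticChar_trace_pow hp hℓ hℓ2 hk hpℓ hord hF (N := (p ^ m - 1) * h)
      (by rw [hF', hqN]) hσ
  refine ⟨m, h, ε, b, hm, hm1, ?_, hε, ?_, ?_⟩
  · have : p ^ m + 1 = 2 * h * ℓ ^ k := by rw [hh]; ring
    exact_mod_cast this
  · intro a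
    rw [hdual.walsh_eq (by simpa using hquad 0 0), hE, hEε]
    push_cast
    rfl
  rw [← hEε]
  simp only [hm, hN]
  exact
    { ne_two := hp
      one_le := hm1
      card_eq := by rw [hF', pow_mul']
      sum_eq := fun t ht a => hdual.sum_stdAddChar_sub_trace hquad hE ht a
      dual_smul := hquad
      sum_dual := hdual.sum_dual hf0 hquad hE (by rw [hE2, hF']; push_cast; rfl)
      sq_eq := by rw [hE2, pow_mul']
      map_zero := hf0
      trace_zero := by
        rw [zero_pow (Nat.mul_ne_zero (by omega) hh0.ne'), map_zero]
      trace_mul := fun u y hu => by rw [mul_pow, pow_mul u, hu, one_pow, one_mul]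
      pow_eq := hb
      nonneg_pos := mul_nonneg (Int.natCast_nonneg h) (signCount_nonneg hℓ)
      nonneg_neg := mul_nonneg (Int.natCast_nonneg h) (signCount_nonneg hℓ)
      pos_add := by
        rw [← mul_add]
        have h1 := one_le_signCount_add (k := k) hpℓ hℓ
        have h2 : (1 : ℤ) ≤ h := by exact_mod_cast hh0
        nlinarith
      card_pos := by
        rw [hcount (Or.inl rfl), Nat.cast_mul, hcast, mul_assoc]
      card_neg := by
        rw [hcount (Or.inr rfl), Nat.cast_mul, hcast, mul_assoc] }

end Data

/-! ### The length of the code -/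

section Length

variable {p ℓ k : ℕ} [Fact p.Prime] {F : Type*} [Field F] [Fintype F] [DecidableEq F]
  [Algebra (ZMod p) F] {f fs T : F → ZMod p} {E : ℤ} {m : ℕ} {b : F} {u v : ℤ}
  {D : Finset (F × F)} {h a : ℤ}

theorem IsWeightData.card_eq_rat (H : IsWeightData f fs T E m b u v)
    (hD : ∀ z, z ∈ D ↔ z ≠ 0 ∧ f z.1 + T z.2 = 0) (hℓ : ℓ ≠ 0)
    (hh : (p : ℤ) ^ m + 1 = 2 * h * (ℓ : ℤ) ^ k) (huv : u + v = 2 * h * a) :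
    (#D : ℚ) = ((p : ℚ) ^ (2 * m)) ^ 2 / p + E * ((p : ℚ) ^ (2 * m) * (p - 1) / p -
      a * ((p : ℚ) ^ (2 * m) - 1) / (ℓ : ℚ) ^ k) - 1 := by
  have h1 := H.card_eq_length hD
  have hp : (p : ℚ) ≠ 0 := by exact_mod_cast (Fact.out : p.Prime).ne_zero
  have hL : (ℓ : ℚ) ^ k ≠ 0 := by exact_mod_cast pow_ne_zero k hℓ
  rw [sub_sub _ u v, huv] at h1
  have h2 : (p : ℚ) * (#D + 1) = ((p : ℚ) ^ m) ^ 4 +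
      E * ((p - 1) + ((p : ℚ) ^ m - 1) * (p * (p ^ m + 1 - 2 * h * a) - (p ^ m + 1))) := by
    exact_mod_cast h1
  have hh' : (p : ℚ) ^ m + 1 = 2 * h * (ℓ : ℚ) ^ k := by exact_mod_cast hh
  rw [pow_mul']
  generalize (p : ℚ) ^ m = s at *
  generalize (ℓ : ℚ) ^ k = L at *
  have hh2 : (h : ℚ) = (s + 1) / (2 * L) := by field_simp; linarith
  have h3 : (#D : ℚ) = (s ^ 4 +
      E * ((p - 1) + (s - 1) * (p * (s + 1 - 2 * h * a) - (s + 1)))) / p - 1 := by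
    rw [← h2]; field_simp; ring
  rw [h3, hh2]
  field_simp
  ring

theorem IsWeightData.card_eq_lengthOne {ε : ℤ}
    (H : IsWeightData f fs T (ε * sqrtPStarPow p (2 * m)) m b u v)
    (hD : ∀ z, z ∈ D ↔ z ≠ 0 ∧ f z.1 + T z.2 = 0) (hℓ : ℓ ≠ 0)
    (hh : (p : ℤ) ^ m + 1 = 2 * h * (ℓ : ℤ) ^ k) (huv : u + v = 2 * h * (ℓ - 1)) :
    (#D : ℚ) = lengthOne p ℓ k (2 * m) ε := by
  rw [H.card_eq_rat hD hℓ hh huv, lengthOne]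
  push_cast
  rfl

theorem IsWeightData.card_eq_lengthNotOne {ε : ℤ}
    (H : IsWeightData f fs T (ε * sqrtPStarPow p (2 * m)) m b u v)
    (hD : ∀ z, z ∈ D ↔ z ≠ 0 ∧ f z.1 + T z.2 = 0) (hℓ : ℓ ≠ 0) (hk : 1 ≤ k)
    (hh : (p : ℤ) ^ m + 1 = 2 * h * (ℓ : ℤ) ^ k) (huv : u + v = 2 * h * ℓ) :
    (#D : ℚ) = lengthNotOne p ℓ k (2 * m) ε := by
  have hℓ' : (ℓ : ℚ) ≠ 0 := by exact_mod_cast hℓ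
  have hL : (ℓ : ℚ) ^ k = ℓ * (ℓ : ℚ) ^ (k - 1) := by rw [← pow_succ', Nat.sub_add_cancel hk]
  rw [H.card_eq_rat hD hℓ hh huv, lengthNotOne, hL, Int.cast_natCast,
    mul_div_mul_left _ _ hℓ']
  push_cast
  rfl

end Length

/-! ### Number of weights in each case -/

theorem natCast_pow_eq_mul {p m : ℕ} (hm : 1 ≤ m) : (p : ℤ) ^ m = p * (p : ℤ) ^ (m - 1) := by
  rw [← pow_succ', Nat.sub_add_cancel hm]

section Weights

variable {p ℓ k m h : ℕ} [Fact p.Prime] {ι : Type*} [Fintype ι]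
  {C : Submodule (ZMod p) (ι → ZMod p)} {E : ℤ}

theorem natCast_lt_pow (hℓ : ℓ.Prime) (hk : 2 ≤ k) : (ℓ : ℤ) < (ℓ : ℤ) ^ k := by
  exact_mod_cast lt_self_pow₀ hℓ.one_lt (by omega)

theorem natCast_sub_one_lt_pow (ℓ : ℕ) (hk : 1 ≤ k) : (ℓ : ℤ) - 1 < (ℓ : ℤ) ^ k := by
  have h1 : ((ℓ : ℕ) : ℤ) ≤ (ℓ : ℤ) ^ k := by exact_mod_cast Nat.le_self_pow (by omega) ℓ
  linarith

theorem five_le_of_modEq_one (h4 : p ≡ 1 [MOD 4]) : 5 ≤ p := by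
  have h1 := (Fact.out : p.Prime).one_lt
  have h2 : p % 4 = 1 := h4
  omega

theorem numWeights_eq_eight_of_modEq_one (hℓ : ℓ.Prime) (hℓ2 : ℓ ≠ 2) (hk : 1 ≤ k)
    (h1 : ℓ ≡ 1 [MOD p]) (h4 : p ≡ 1 [MOD 4]) (hm : Nat.totient (ℓ ^ k) = 2 * m) (hm1 : 1 ≤ m)
    (hh : (p : ℤ) ^ m + 1 = 2 * h * (ℓ : ℤ) ^ k) (hE : E ^ 2 = ((p : ℤ) ^ m) ^ 2)
    (hC : HasWeightDistribution C (tableEq p ((p : ℤ) ^ m) E (2 * h * (ℓ - 1)) 1)) :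
    numWeights C = 8 := by
  have hp5 := five_le_of_modEq_one h4
  have hpo : Odd p := (Fact.out : p.Prime).odd_of_ne_two (by omega)
  have hℓ1 := hℓ.one_le
  have hlt := two_mul_sub_one_lt_pow hp5 hpo hℓ hℓ2 hk hm h1
  rw [natCast_pow_eq_mul hm1] at hh hE hC
  zify [hℓ1] at hlt
  refine (isSeparated_of_modEq_one (by omega) hpo hℓ hℓ2 hk h1 hh
    (Or.inl (one_mul _)) ?_).numWeights_tableEq (Or.inl rfl) hE (natCast_sub_one_lt_pow ℓ hk) hC
  rw [one_mul, abs_of_nonneg (by omega)]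
  linarith

theorem numWeights_eq_six_of_modEq_one (hp : p ≠ 2) (hℓ : ℓ.Prime) (hℓ2 : ℓ ≠ 2) (hk : 1 ≤ k)
    (h1 : ℓ ≡ 1 [MOD p]) (hm : Nat.totient (ℓ ^ k) = 2 * m) (hm1 : 1 ≤ m)
    (hh : (p : ℤ) ^ m + 1 = 2 * h * (ℓ : ℤ) ^ k) (hE : E ^ 2 = ((p : ℤ) ^ m) ^ 2)
    (hC : HasWeightDistribution C (tableHalf p ((p : ℤ) ^ m) E (2 * h * (ℓ - 1)))) :
    numWeights C = 6 := by
  have hp3 : 3 ≤ p := lt_of_le_of_ne (Fact.out : p.Prime).two_le hp.symm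
  have hpo : Odd p := (Fact.out : p.Prime).odd_of_ne_two hp
  have hlt := sub_one_lt_pow hp3 hpo hℓ hℓ2 hk hm h1
  rw [natCast_pow_eq_mul hm1] at hh hE hC
  zify [hℓ.one_le] at hlt
  refine (isSeparated_of_modEq_one hp3 hpo hℓ hℓ2 hk h1 hh
    (Or.inr rfl) ?_).numWeights_tableHalf hE (natCast_sub_one_lt_pow ℓ hk) hC
  rwa [abs_zero, add_zero]

theorem numWeights_eq_eight_of_two_le (hℓ : ℓ.Prime) (hℓ2 : ℓ ≠ 2) (hk : 2 ≤ k)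
    (h4 : p ≡ 1 [MOD 4]) (hm : Nat.totient (ℓ ^ k) = 2 * m) (hm1 : 1 ≤ m)
    (hh : (p : ℤ) ^ m + 1 = 2 * h * (ℓ : ℤ) ^ k) (hE : E ^ 2 = ((p : ℤ) ^ m) ^ 2) {σ : ℤ}
    (hσ : σ = 1 ∨ σ = -1)
    (hC : HasWeightDistribution C (tableEq p ((p : ℤ) ^ m) E (2 * h * ℓ) σ)) :
    numWeights C = 8 := by
  have hp5 := five_le_of_modEq_one h4
  have hpo : Odd p := (Fact.out : p.Prime).odd_of_ne_two (by omega)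
  have hlt := two_mul_lt_pow_of_two_le hp5 hℓ hℓ2 hk hm
  rw [natCast_pow_eq_mul hm1] at hh hE hC
  zify at hlt
  have habs : |σ * (ℓ : ℤ)| = ℓ := by
    rcases hσ with rfl | rfl <;> simp
  refine (isSeparated_of_two_le (by omega) hpo hℓ hℓ2 hk hh habs.le ?_).numWeights_tableEq hσ hE
    (natCast_lt_pow hℓ hk) hC
  rw [habs]
  linarith

theorem numWeights_eq_nine_of_two_le (hℓ : ℓ.Prime) (hℓ2 : ℓ ≠ 2) (hk : 2 ≤ k)
    (h4 : p ≡ 1 [MOD 4]) (hm : Nat.totient (ℓ ^ k) = 2 * m) (hm1 : 1 ≤ m)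
    (hh : (p : ℤ) ^ m + 1 = 2 * h * (ℓ : ℤ) ^ k) (hE : E ^ 2 = ((p : ℤ) ^ m) ^ 2) {u v : ℤ}
    (huv : u = 2 * h ∧ v = 2 * h * (ℓ - 1) ∨ u = 2 * h * (ℓ - 1) ∧ v = 2 * h)
    (hC : HasWeightDistribution C (generalTable p ((p : ℤ) ^ m) E u v)) :
    numWeights C = 9 := by
  have hp5 := five_le_of_modEq_one h4
  have hpo : Odd p := (Fact.out : p.Prime).odd_of_ne_two (by omega)
  have hlt := two_mul_lt_pow_of_two_le hp5 hℓ hℓ2 hk hm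
  rw [natCast_pow_eq_mul hm1] at hh hE hC
  zify at hlt
  have hℓ3 : (3 : ℤ) ≤ ℓ := by exact_mod_cast lt_of_le_of_ne hℓ.two_le hℓ2.symm
  have hL := natCast_lt_pow hℓ hk
  have hsep : ∀ {T : ℤ}, |T| ≤ (ℓ : ℤ) →
      IsSeparated p ((p : ℤ) ^ (m - 1)) h ((ℓ : ℤ) ^ k) ℓ T := fun hT =>
    isSeparated_of_two_le (by omega) hpo hℓ hℓ2 hk hh hT (by linarith)
  have hpos := (hsep (T := 0) (by rw [abs_zero]; linarith)).h_pos hL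
  have hpos1 : (0 : ℤ) < 2 * h := by linarith
  have hpos2 : (0 : ℤ) < 2 * h * (ℓ - 1) := mul_pos hpos1 (by linarith)
  rcases huv with ⟨rfl, rfl⟩ | ⟨rfl, rfl⟩
  -- T is (u - v)/(2h), nonzero since ℓ ≥ 3.
  · refine (hsep (T := 2 - ℓ) ?_).numWeights_generalTable hE (by omega) hL hpos1 hpos2 (by ring)
      (by ring) hC
    rw [abs_le]
    constructor <;> linarith
  · refine (hsep (T := ℓ - 2) ?_).numWeights_generalTable hE (by omega) hL hpos2 hpos1 (by ring)
      (by ring) hC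
    rw [abs_le]
    constructor <;> linarith

theorem numWeights_eq_six_of_two_le (hp : p ≠ 2) (hℓ : ℓ.Prime) (hℓ2 : ℓ ≠ 2) (hk : 2 ≤ k)
    (hm : Nat.totient (ℓ ^ k) = 2 * m) (hm1 : 1 ≤ m)
    (hh : (p : ℤ) ^ m + 1 = 2 * h * (ℓ : ℤ) ^ k) (hE : E ^ 2 = ((p : ℤ) ^ m) ^ 2)
    (hC : HasWeightDistribution C (tableHalf p ((p : ℤ) ^ m) E (2 * h * ℓ))) :
    numWeights C = 6 := by
  have hp3 : 3 ≤ p := lt_of_le_of_ne (Fact.out : p.Prime).two_le hp.symm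
  have hpo : Odd p := (Fact.out : p.Prime).odd_of_ne_two hp
  have hlt := lt_pow_of_two_le hp3 hℓ hℓ2 hk hm
  rw [natCast_pow_eq_mul hm1] at hh hE hC
  zify at hlt
  refine (isSeparated_of_two_le hp3 hpo hℓ hℓ2 hk hh (by rw [abs_zero]; omega)
    ?_).numWeights_tableHalf hE (natCast_lt_pow hℓ hk) hC
  rwa [abs_zero, add_zero]

end Weights

end BentCode

/-! ### The main theorem, by cases on ℓ mod p and p mod 4 -/

theorem theorem2 (p ℓ k e : ℕ) [Fact p.Prime] (hp : p ≠ 2) (hℓ : ℓ.Prime) (hℓ2 : ℓ ≠ 2)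
    (hpℓ : p ≠ ℓ) (hk : 1 ≤ k)
    (hprim : orderOf (p : ZMod (2 * ℓ ^ k)) = Nat.totient (ℓ ^ k))
    (he : e = Nat.totient (ℓ ^ k))
    {F : Type*} [Field F] [Fintype F] [Algebra (ZMod p) F] (hF : Fintype.card F = p ^ e)
    (f fs : F → ZMod p) (hf : BentCode.MemRF f) (hdual : BentCode.IsDual f fs)
    (hquad : ∀ (c : ZMod p) (x : F), fs (c • x) = c ^ 2 * fs x)
    (D : Finset (F × F)) (hD : D = BentCode.definingSet f ((p ^ e - 1) / (2 * ℓ ^ k)))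
    (h₁ h₂ : ℤ) (hh₁ : h₁ = quadraticChar (ZMod p) (Nat.totient (ℓ ^ k) : ZMod p))
    (hh₂ : h₂ = quadraticChar (ZMod p) ((ℓ : ZMod p) ^ (k - 1))) :
    ∃ ε : ℤ, (ε = 1 ∨ ε = -1) ∧
      (∀ a : F, BentCode.walsh f a =
        (ε : ℂ) * (BentCode.sqrtPStarPow p e : ℂ) * ZMod.stdAddChar (fs a)) ∧
      Module.finrank (ZMod p) (BentCode.code p D) = 2 * e ∧
      -- first case
      (ℓ ≡ 1 [MOD p] → p ≡ 1 [MOD 4] →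
        (D.card : ℚ) = BentCode.lengthOne p ℓ k e ε ∧
        BentCode.HasWeightDistribution (BentCode.code p D) (BentCode.tableOneOne p ℓ k e ε) ∧
        BentCode.numWeights (BentCode.code p D) = 8) ∧
      -- second case
      (ℓ ≡ 1 [MOD p] → p ≡ 3 [MOD 4] →
        (D.card : ℚ) = BentCode.lengthOne p ℓ k e ε ∧
        BentCode.HasWeightDistribution (BentCode.code p D) (BentCode.tableOneThree p ℓ k e ε) ∧
        BentCode.numWeights (BentCode.code p D) = 6) ∧
      -- third case; for `k = 1` some rows of the tables have frequency zero
      (¬ ℓ ≡ 1 [MOD p] → p ≡ 1 [MOD 4] →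
        (D.card : ℚ) = BentCode.lengthNotOne p ℓ k e ε ∧
        (h₁ = h₂ →
          BentCode.HasWeightDistribution (BentCode.code p D)
            (BentCode.tableNotOneOneEq p ℓ k e ε h₁ h₂) ∧
          (2 ≤ k → BentCode.numWeights (BentCode.code p D) = 8)) ∧
        (h₁ = -h₂ →
          BentCode.HasWeightDistribution (BentCode.code p D)
            (BentCode.tableNotOneOneNeg p ℓ k e ε h₁ h₂) ∧
          (2 ≤ k → BentCode.numWeights (BentCode.code p D) = 9))) ∧
      -- fourth case; for `k = 1` one row of the table has frequency zero
      (¬ ℓ ≡ 1 [MOD p] → p ≡ 3 [MOD 4] →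
        (D.card : ℚ) = BentCode.lengthNotOne p ℓ k e ε ∧
        BentCode.HasWeightDistribution (BentCode.code p D) (BentCode.tableNotOneThree p ℓ k e ε) ∧
        (2 ≤ k → BentCode.numWeights (BentCode.code p D) = 6)) := by
  classical
  have hprime : p.Prime := Fact.out
  have hp0 : p ≠ 0 := hprime.ne_zero
  have hℓ0 : ℓ ≠ 0 := hℓ.ne_zero
  subst he
  obtain ⟨m, h, ε, b, hm, hm1, hh, hε, hwalsh, H⟩ :=
    BentCode.exists_isWeightData hp hℓ hℓ2 hpℓ hk hprim hF hf hdual hquad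
  have hmem : ∀ z, z ∈ D ↔ z ≠ 0 ∧ f z.1 + Algebra.trace (ZMod p) F
      (z.2 ^ ((p ^ Nat.totient (ℓ ^ k) - 1) / (2 * ℓ ^ k))) = 0 := by
    intro z
    simp [hD, BentCode.definingSet]
  have hE := H.sq_eq
  have hC := H.hasWeightDistribution hmem
  refine ⟨ε, hε, by rwa [hm], by rw [H.finrank_code hmem, hm], ?_, ?_, ?_, ?_⟩
  · intro h1 h4
    -- Modulo p the trace values are now 0 and ±1. As -1 is a square, all nonzero ones are squares,
    -- so v = 0.
    have e1 : ((Nat.totient (ℓ ^ k) : ℕ) : ZMod p) = 0 := by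
      rw [BentCode.totient_cast_eq hℓ hk, BentCode.natCast_sub_one_eq_zero_iff.mpr h1, mul_zero]
    have e2 : (ℓ : ZMod p) = 1 := sub_eq_zero.mp (BentCode.natCast_sub_one_eq_zero_iff.mpr h1)
    have hu : (h : ℤ) * BentCode.signCount p ℓ k 1 = 2 * h * (ℓ - 1) := by
      rw [BentCode.signCount_of_one h4, e1, e2, one_pow, map_one, quadraticChar_zero]
      norm_num
      ring
    have hv : (h : ℤ) * BentCode.signCount p ℓ k (-1) = 0 := by
      rw [BentCode.signCount_of_one h4, e1, e2, one_pow, map_one, quadraticChar_zero]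
      norm_num
    rw [hu, hv] at H hC
    rw [hm]
    have hC' := hC.of_rowSum_eq (BentCode.rowSum_generalTable_left _ _ _ _)
    exact ⟨H.card_eq_lengthOne hmem hℓ0 hh (add_zero _),
      hC'.of_rowSum_eq fun w => (BentCode.rowSum_tableOneOne hp0 hℓ0 hm1 hh w).symm,
      BentCode.numWeights_eq_eight_of_modEq_one hℓ hℓ2 hk h1 h4 hm hm1 hh hE hC'⟩
  · intro h1 h4
    rw [BentCode.signCount_of_three_of_one h4 hpℓ hℓ hk h1 (Or.inl rfl),
      BentCode.signCount_of_three_of_one h4 hpℓ hℓ hk h1 (Or.inr rfl)] at H hC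
    rw [hm]
    have hC' := hC.of_rowSum_eq (BentCode.rowSum_generalTable_half _ _ _ _)
    rw [← mul_assoc] at hC'
    refine ⟨H.card_eq_lengthOne hmem hℓ0 hh (by ring), ?_,
      BentCode.numWeights_eq_six_of_modEq_one hp hℓ hℓ2 hk h1 hm hm1 hh hE hC'⟩
    rwa [BentCode.tableOneThree_eq hp0 hℓ0 hm1 hh]
  · intro h1 h4
    have d1 : h₁ = 1 ∨ h₁ = -1 := by
      rw [hh₁]
      exact quadraticChar_dichotomy (BentCode.totient_cast_ne_zero hpℓ hℓ hk h1)
    have d2 : h₂ = 1 ∨ h₂ = -1 := by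
      rw [hh₂]
      exact quadraticChar_dichotomy (BentCode.natCast_pow_ne_zero hpℓ hℓ (k - 1))
    rw [BentCode.signCount_of_one h4, BentCode.signCount_of_one h4, ← hh₁, ← hh₂] at H hC
    clear hh₁ hh₂
    rw [hm]
    refine ⟨H.card_eq_lengthNotOne hmem hℓ0 hk hh ?_, ?_, ?_⟩
    -- Whatever the signs, u + v = 2hℓ, because no trace value ±φ(ℓ^k), ±ℓ^(k-1) vanishes modulo p.
    · rcases d1 with rfl | rfl <;> rcases d2 with rfl | rfl <;> norm_num <;> ring
    · rintro rfl
      have hC' : BentCode.HasWeightDistribution (BentCode.code p D) (BentCode.tableEq p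
          ((p : ℤ) ^ m) (ε * BentCode.sqrtPStarPow p (2 * m)) (2 * h * ℓ) h₁) := by
        rcases d1 with rfl | rfl
        · refine hC.of_rowSum_eq fun w => ?_
          rw [← BentCode.rowSum_generalTable_left]
          norm_num
          ring_nf
        · refine hC.of_rowSum_eq fun w => ?_
          rw [← BentCode.rowSum_generalTable_right]
          norm_num
          ring_nf
      refine ⟨?_, fun hk2 => BentCode.numWeights_eq_eight_of_two_le hℓ hℓ2 hk2 h4 hm hm1 hh hE d1
        hC'⟩
      rwa [BentCode.tableNotOneOneEq_eq hp0 hℓ0 hk hm1 hh d1]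
    · intro h12
      obtain rfl : h₂ = -h₁ := by rw [h12, neg_neg]
      rcases d1 with rfl | rfl
      · have hu : (h : ℤ) * (2 * ((if (1 : ℤ) = 1 then 1 else 0) +
            (ℓ - 1) * (if (-1 : ℤ) = 1 then 1 else 0))) = 2 * h := by
          norm_num
          ring
        have hv : (h : ℤ) * (2 * ((if (1 : ℤ) = -1 then 1 else 0) +
            (ℓ - 1) * (if (-1 : ℤ) = -1 then 1 else 0))) = 2 * h * (ℓ - 1) := by
          norm_num
          ring
        rw [hu, hv] at hC
        refine ⟨?_, fun hk2 => BentCode.numWeights_eq_nine_of_two_le hℓ hℓ2 hk2 h4 hm hm1 hh hE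
          (Or.inl ⟨rfl, rfl⟩) hC⟩
        rwa [BentCode.tableNotOneOneNeg_eq hp0 hℓ0 hk hm1 hh]
      · rw [neg_neg] at hC ⊢
        have hu : (h : ℤ) * (2 * ((if (-1 : ℤ) = 1 then 1 else 0) +
            (ℓ - 1) * (if (1 : ℤ) = 1 then 1 else 0))) = 2 * h * (ℓ - 1) := by
          norm_num
          ring
        have hv : (h : ℤ) * (2 * ((if (-1 : ℤ) = -1 then 1 else 0) +
            (ℓ - 1) * (if (1 : ℤ) = -1 then 1 else 0))) = 2 * h := by
          norm_num
          ring
        rw [hu, hv] at hC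
        exact ⟨hC.of_rowSum_eq fun w =>
          (BentCode.rowSum_tableNotOneOneNeg hp0 hℓ0 hk hm1 hh w).symm,
          fun hk2 => BentCode.numWeights_eq_nine_of_two_le hℓ hℓ2 hk2 h4 hm hm1 hh hE
            (Or.inr ⟨rfl, rfl⟩) hC⟩
  · intro h1 h4
    rw [BentCode.signCount_of_three_of_not_one h4 hpℓ hℓ hk h1 (Or.inl rfl),
      BentCode.signCount_of_three_of_not_one h4 hpℓ hℓ hk h1 (Or.inr rfl)] at H hC
    rw [hm]
    have hC' := hC.of_rowSum_eq (BentCode.rowSum_generalTable_half _ _ _ _)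
    rw [← mul_assoc] at hC'
    refine ⟨H.card_eq_lengthNotOne hmem hℓ0 hk hh (by ring), ?_, fun hk2 =>
      BentCode.numWeights_eq_six_of_two_le hp hℓ hℓ2 hk2 hm hm1 hh hE hC'⟩
    rwa [BentCode.tableNotOneThree_eq hp0 hℓ0 hk hm1 hh]
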